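/- All locally compact groups are assumed Hausdorff. Let $G$ be a locally compact group with left Haar measure $m_G$ and modular function $\Delta$, normalised by $m_G(Es)=\Delta(s)m_G(E)$. Let $\lambda,\rho$ be the left and right regular representations on $L^2(G)$, $\lambda(s)f(x)=f(s^{-1}x)$ and $\rho(t)f(x)=f(xt)\Delta(t)^{1/2}$, and use the same letters for their extensions to *-representations of the full group C*-algebra $C^*(G)$. We say that $G$ has the *factorization property* if the linear map $$C^*(G)\odot C^*(G)\to \mathcal B(L^2(G)),\qquad a\otimes b\mapsto \lambda(a)\rho(b),$$ on the algebraic tensor product is continuous with respect to the minimal (spatial) C*-norm, i.e. extends continuously to $C^*(G)\otimes_{\min}C^*(G)$. We say that $G$ is *QSIN* if $L^1(G)$ has a bounded two-sided approximate identity $(e_\alpha)$ (for convolution) such that $\|\tau_1(s)e_\alpha-e_\alpha\|_1\to 0$ uniformly for $s$ in compact subsets of $G$, where $\tau_1(s)f(x)=f(s^{-1}xs)\Delta(s)$. **Corollary.** Let $G$ and $H$ be locally compact groups and suppose that there is a continuous injective group homomorphism $\iota\colon H\to G$. If $G$ is QSIN and has the factorization property, then $H$ has the factorization property. -/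

import Mathlib

open MeasureTheory
open scoped TensorProduct ENNReal NNReal CompactlySupported

universe u

noncomputable section

/-! ## Haar measure, the modular function, and translations on `L^p(G)` -/

section Translations

variable {G : Type u} [Group G] [TopologicalSpace G] [IsTopologicalGroup G]
  [LocallyCompactSpace G]

/-- The modular function `Δ` of `G`, normalised by `m(E s) = Δ(s) m(E)` for the left Haar measure
`m`. (Mathlib's `modularCharacter` is `s ↦ m(E s⁻¹) / m(E)`.) -/
def modularFn (s : G) : ℝ≥0 := Measure.modularCharacter s⁻¹

theorem modularFn_pos (s : G) : 0 < modularFn s := Measure.modularCharacterFun_pos _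

theorem modularFn_one : modularFn (1 : G) = 1 := by simp [modularFn]

theorem modularFn_mul (s t : G) : modularFn (s * t) = modularFn s * modularFn t := by
  simp [modularFn, mul_comm]

variable [MeasurableSpace G] [BorelSpace G]

theorem map_mul_right_haar (t : G) :
    Measure.map (· * t) (Measure.haar : Measure G) = (modularFn t)⁻¹ • Measure.haar := by
  have h1 : (Measure.map (· * t) (Measure.haar : Measure G)).Regular :=
    Measure.Regular.map (Homeomorph.mulRight t)
  have h2 : (modularFn t)⁻¹ = Measure.modularCharacterFun t := by
    rw [inv_eq_iff_eq_inv]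
    change Measure.modularCharacter t⁻¹ = (Measure.modularCharacter t)⁻¹
    refine eq_inv_of_mul_eq_one_left ?_
    rw [← map_mul]; simp
  rw [h2, Measure.modularCharacterFun_eq_haarScalarFactor Measure.haar t]
  exact Measure.isMulLeftInvariant_eq_smul_of_regular _ _

theorem haar_mul_right (s : G) (E : Set G) :
    (Measure.haar : Measure G) ((· * s) '' E) = modularFn s * Measure.haar E := by
  have h := congrArg (fun m : Measure G => m E) (map_mul_right_haar s⁻¹)
  have e : (fun x : G => x * s⁻¹) = Homeomorph.mulRight s⁻¹ := rfl
  have e2 : (Homeomorph.mulRight s⁻¹) ⁻¹' E = (· * s) '' E := by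
    ext x; simp
  have h3 : (modularFn s⁻¹)⁻¹ = modularFn s := by
    refine inv_eq_of_mul_eq_one_left ?_
    rw [← modularFn_mul]; simp [modularFn_one]
  simp only [e] at h
  rw [← Homeomorph.toMeasurableEquiv_coe, MeasurableEquiv.map_apply] at h
  rw [Homeomorph.toMeasurableEquiv_coe, e2, h3] at h
  simpa using h

theorem map_bimul_haar (s t : G) :
    Measure.map (fun x => s⁻¹ * x * t) (Measure.haar : Measure G)
      = (modularFn t)⁻¹ • Measure.haar := by
  have : (fun x : G => s⁻¹ * x * t) = (· * t) ∘ (s⁻¹ * ·) := rfl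
  rw [this, ← Measure.map_map (measurable_mul_const t) (measurable_const_mul s⁻¹),
    map_mul_left_eq_self, map_mul_right_haar]

theorem quasiMeasurePreserving_bimul (s t : G) :
    Measure.QuasiMeasurePreserving (fun x => s⁻¹ * x * t) (Measure.haar : Measure G)
      Measure.haar := by
  refine ⟨by fun_prop, ?_⟩
  rw [map_bimul_haar]
  exact Measure.smul_absolutelyContinuous

variable (p : ℝ≥0∞)

theorem memLp_bimul {f : G → ℂ} (s t : G) (hf : MemLp f p Measure.haar) :
    MemLp (fun x => f (s⁻¹ * x * t)) p Measure.haar := by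
  have h : MemLp f p (Measure.map (fun x => s⁻¹ * x * t) (Measure.haar : Measure G)) := by
    rw [map_bimul_haar]
    exact hf.smul_measure ENNReal.coe_ne_top
  exact h.comp_of_map (by fun_prop)

theorem eLpNorm_bimul (hp : p ≠ ∞) {f : G → ℂ} (s t : G) (hf : MemLp f p Measure.haar) :
    eLpNorm (fun x => f (s⁻¹ * x * t)) p Measure.haar
      = ((modularFn t)⁻¹ ^ p.toReal⁻¹ : ℝ≥0) • eLpNorm f p Measure.haar := by
  have hm : AEMeasurable (fun x => s⁻¹ * x * t) (Measure.haar : Measure G) := by fun_prop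
  have h1 := eLpNorm_map_measure (p := p) (g := f) (f := fun x => s⁻¹ * x * t)
    (μ := (Measure.haar : Measure G))
    (by rw [map_bimul_haar]; exact hf.aestronglyMeasurable.smul_measure _) hm
  rw [map_bimul_haar, eLpNorm_smul_measure_of_ne_top' hp] at h1
  exact h1.symm

/-- The two-sided translation `f ↦ Δ(t)^{1/p} f(s⁻¹ · t)` on `L^p(G)`. -/
def biTranslateFun (s t : G) (f : Lp ℂ p (Measure.haar : Measure G)) :
    Lp ℂ p (Measure.haar : Measure G) :=
  ((modularFn t ^ p.toReal⁻¹ : ℝ≥0) : ℂ) •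
    (memLp_bimul p s t (Lp.memLp f)).toLp (fun x => f (s⁻¹ * x * t))

theorem coeFn_biTranslateFun (s t : G) (f : Lp ℂ p (Measure.haar : Measure G)) :
    biTranslateFun p s t f =ᵐ[Measure.haar]
      fun x => ((modularFn t ^ p.toReal⁻¹ : ℝ≥0) : ℂ) * f (s⁻¹ * x * t) := by
  filter_upwards [Lp.coeFn_smul ((modularFn t ^ p.toReal⁻¹ : ℝ≥0) : ℂ)
    ((memLp_bimul p s t (Lp.memLp f)).toLp (fun x => f (s⁻¹ * x * t))),
    (memLp_bimul p s t (Lp.memLp f)).coeFn_toLp] with x h1 h2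
  rw [biTranslateFun, h1, Pi.smul_apply, h2, smul_eq_mul]

open scoped Pointwise in
theorem continuous_modularFn : Continuous (modularFn : G → ℝ≥0) := by
  obtain ⟨⟨f, f_cont⟩, f_comp, f_nonneg, f_one⟩ :
    ∃ f : C(G, ℝ), HasCompactSupport f ∧ 0 ≤ f ∧ f 1 ≠ 0 := exists_continuous_nonneg_pos 1
  simp only [ContinuousMap.coe_mk] at f_comp f_one
  have int_ne : ∫ x, f x ∂(Measure.haar : Measure G) ≠ 0 :=
    ne_of_gt (f_cont.integral_pos_of_hasCompactSupport_nonneg_nonzero f_comp f_nonneg f_one)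
  have key : ∀ t : G, (modularFn t : ℝ) =
      (∫ x, f (x * t⁻¹) ∂(Measure.haar : Measure G)) / ∫ x, f x ∂(Measure.haar : Measure G) := by
    intro t
    have h := integral_map (μ := (Measure.haar : Measure G)) (φ := fun x => x * t⁻¹) (f := f)
      (by fun_prop) f_cont.aestronglyMeasurable
    rw [map_mul_right_haar, integral_smul_nnreal_measure] at h
    rw [← h, NNReal.smul_def, smul_eq_mul, mul_div_assoc, div_self int_ne, mul_one]
    have : modularFn t * modularFn t⁻¹ = 1 := by rw [← modularFn_mul]; simp [modularFn_one]
    rw [eq_inv_of_mul_eq_one_left this]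
  have cont : Continuous fun t : G =>
      ∫ x, f (x * t⁻¹) ∂(Measure.haar : Measure G) := by
    rw [continuous_iff_continuousAt]
    intro t₀
    obtain ⟨K, hK, hKt⟩ := exists_compact_mem_nhds t₀
    refine (continuousOn_integral_of_compact_support (f := fun (t : G) x => f (x * t⁻¹))
      (k := tsupport f * K) (s := K) (f_comp.isCompact.mul hK) ?_ ?_).continuousAt hKt
    · exact (f_cont.comp (by fun_prop : Continuous fun q : G × G => q.2 * q.1⁻¹)).continuousOn
    · intro t x ht hx
      by_contra h
      exact hx ⟨x * t⁻¹, subset_tsupport f h, t, ht, by simp⟩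
  rw [NNReal.isEmbedding_coe.continuous_iff]
  exact (cont.div_const _).congr fun t => (key t).symm

theorem exists_continuous_approx {f : G → ℂ} (hp' : p ≠ ∞)
    (hf : MemLp f p (Measure.haar : Measure G)) {ε : ℝ≥0∞} (hε : ε ≠ 0) :
    ∃ g : G → ℂ, eLpNorm (f - g) p (Measure.haar : Measure G) ≤ ε ∧
      (Continuous g ∧ MemLp g p (Measure.haar : Measure G) ∧ HasCompactSupport g) := by
  refine hf.induction_dense hp' _ ?_ ?_ ?_ hε
  · intro c t ht htμ ε hε
    obtain ⟨η, ηpos, hη⟩ : ∃ η : ℝ≥0, 0 < η ∧ ∀ s : Set G, (Measure.haar : Measure G) s ≤ η →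
        eLpNorm (s.indicator fun _x => c) p (Measure.haar : Measure G) ≤ ε :=
      exists_eLpNorm_indicator_le hp' c hε
    have hη2 : ((η : ℝ≥0∞) / 2) ≠ 0 := by simp [ηpos.ne']
    obtain ⟨K, hKt, hK, hKc, hμK⟩ := ht.exists_isCompact_isClosed_sdiff_lt htμ.ne hη2
    obtain ⟨U, hUt, hU, -, hμU⟩ := ht.exists_isOpen_sdiff_lt htμ.ne hη2
    obtain ⟨f, hf1, hf0, hfs, hf01⟩ := exists_continuous_one_zero_of_isCompact hK
      hU.isClosed_compl (Set.disjoint_compl_right_iff_subset.2 (hKt.trans hUt))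
    have hgs : HasCompactSupport fun x => (f x : ℂ) * c :=
      (hfs.comp_left (g := fun r : ℝ => (r : ℂ)) (by simp)).mul_right
    have hgc : Continuous fun x => (f x : ℂ) * c :=
      (Complex.continuous_ofReal.comp f.continuous).mul continuous_const
    refine ⟨fun x => (f x : ℂ) * c, ?_, hgc, hgc.memLp_of_hasCompactSupport hgs, hgs⟩
    refine le_trans (eLpNorm_mono (g := (U \ K).indicator fun _ => c) fun x => ?_) (hη _ ?_)
    · by_cases hxU : x ∈ U
      · by_cases hxK : x ∈ K
        · simp [hf1 hxK, hKt hxK]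
        · have hxm : x ∈ U \ K := ⟨hxU, hxK⟩
          rw [Set.indicator_of_mem hxm]
          have h01 := hf01 x
          by_cases hxt : x ∈ t
          · have : (f x : ℂ) * c - c = ((f x - 1 : ℝ) : ℂ) * c := by push_cast; ring
            rw [Pi.sub_apply, Set.indicator_of_mem hxt, this, norm_mul, Complex.norm_real]
            refine mul_le_of_le_one_left (norm_nonneg _) ?_
            rw [Real.norm_eq_abs, abs_le]
            constructor <;> linarith [h01.1, h01.2]
          · rw [Pi.sub_apply, Set.indicator_of_notMem hxt, sub_zero, norm_mul, Complex.norm_real]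
            refine mul_le_of_le_one_left (norm_nonneg _) ?_
            rw [Real.norm_eq_abs, abs_le]
            constructor <;> linarith [h01.1, h01.2]
      · have h1 : x ∉ t := fun h => hxU (hUt h)
        simp [hf0 (show x ∈ Uᶜ from hxU), h1]
    · calc (Measure.haar : Measure G) (U \ K)
          ≤ (Measure.haar : Measure G) ((U \ t) ∪ (t \ K)) := by
            apply measure_mono
            intro x hx
            by_cases hxt : x ∈ t
            · exact Or.inr ⟨hxt, hx.2⟩
            · exact Or.inl ⟨hx.1, hxt⟩
        _ ≤ _ := measure_union_le _ _
        _ ≤ η / 2 + η / 2 := by gcongr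
        _ = η := ENNReal.add_halves _
  · rintro f g ⟨h1, h2, h3⟩ ⟨h4, h5, h6⟩
    exact ⟨h1.add h4, h2.add h5, h3.add h6⟩
  · rintro f ⟨-, h, -⟩
    exact h.aestronglyMeasurable

open scoped Pointwise in
theorem continuousAt_integral_bimul {g : G → ℂ} (g_cont : Continuous g)
    (g_supp : HasCompactSupport g) (s₀ t₀ : G) (r : ℝ) (hr : 0 < r) (c : G → ℂ)
    (hc : Continuous c) :
    ContinuousAt (fun st : G × G => ∫ x, ‖c st.2 * g (st.1⁻¹ * x * st.2)
      - c t₀ * g (s₀⁻¹ * x * t₀)‖ ^ r ∂(Measure.haar : Measure G)) (s₀, t₀) := by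
  obtain ⟨K, hK, hKs⟩ := exists_compact_mem_nhds s₀
  obtain ⟨L, hL, hLt⟩ := exists_compact_mem_nhds t₀
  have hKL : K ×ˢ L ∈ nhds (s₀, t₀) := prod_mem_nhds hKs hLt
  refine (continuousOn_integral_of_compact_support
    (f := fun (st : G × G) x => ‖c st.2 * g (st.1⁻¹ * x * st.2)
      - c t₀ * g (s₀⁻¹ * x * t₀)‖ ^ r)
    (k := K * tsupport g * L⁻¹) (s := K ×ˢ L)
    ((hK.mul g_supp.isCompact).mul hL.inv) ?_ ?_).continuousAt hKL
  · refine Continuous.continuousOn ?_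
    refine Continuous.rpow_const ?_ fun _ => Or.inr hr.le
    fun_prop
  · intro st x hst hx
    have hz : ∀ st ∈ K ×ˢ L, g (st.1⁻¹ * x * st.2) = 0 := by
      intro st hst
      by_contra h
      have h1 : st.1⁻¹ * x * st.2 ∈ tsupport g := subset_tsupport g h
      have h2 : x = st.1 * (st.1⁻¹ * x * st.2) * st.2⁻¹ := by group
      rw [h2] at hx
      exact hx (Set.mul_mem_mul (Set.mul_mem_mul hst.1 h1) (Set.inv_mem_inv.2 hst.2))
    have h0 := hz (s₀, t₀) (mem_of_mem_nhds hKL)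
    simp only [hz st hst, h0, mul_zero, sub_zero, norm_zero]
    exact Real.zero_rpow hr.ne'

/-- `biTranslateFun` as a linear map. -/
def biTranslateLin (s t : G) :
    Lp ℂ p (Measure.haar : Measure G) →ₗ[ℂ] Lp ℂ p (Measure.haar : Measure G) where
  toFun := biTranslateFun p s t
  map_add' f g := by
    apply Lp.ext
    have h := (quasiMeasurePreserving_bimul s t).ae (Lp.coeFn_add f g)
    filter_upwards [h, coeFn_biTranslateFun p s t (f + g), coeFn_biTranslateFun p s t f,
      coeFn_biTranslateFun p s t g,
      Lp.coeFn_add (biTranslateFun p s t f) (biTranslateFun p s t g)] with x h h1 h2 h3 h4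
    rw [h1, h4, Pi.add_apply, h2, h3, h, Pi.add_apply, mul_add]
  map_smul' c f := by
    apply Lp.ext
    have h := (quasiMeasurePreserving_bimul s t).ae (Lp.coeFn_smul c f)
    filter_upwards [h, coeFn_biTranslateFun p s t (c • f), coeFn_biTranslateFun p s t f,
      Lp.coeFn_smul c (biTranslateFun p s t f)] with x h h1 h2 h4
    rw [h1, RingHom.id_apply, h4, Pi.smul_apply, h2, h, Pi.smul_apply, smul_eq_mul, smul_eq_mul,
      mul_left_comm]

theorem coeFn_biTranslateLin (s t : G) (f : Lp ℂ p (Measure.haar : Measure G)) :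
    biTranslateLin p s t f =ᵐ[Measure.haar]
      fun x => ((modularFn t ^ p.toReal⁻¹ : ℝ≥0) : ℂ) * f (s⁻¹ * x * t) :=
  coeFn_biTranslateFun p s t f

theorem biTranslateLin_mul (s t s' t' : G) (f : Lp ℂ p (Measure.haar : Measure G)) :
    biTranslateLin p (s * s') (t * t') f = biTranslateLin p s t (biTranslateLin p s' t' f) := by
  apply Lp.ext
  filter_upwards [coeFn_biTranslateLin p (s * s') (t * t') f,
    coeFn_biTranslateLin p s t (biTranslateLin p s' t' f),
    (quasiMeasurePreserving_bimul s t).ae (coeFn_biTranslateLin p s' t' f)]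
    with x h1 h2 h3
  rw [h1, h2, h3, modularFn_mul, NNReal.mul_rpow]
  push_cast
  simp only [mul_inv_rev, mul_assoc]

theorem biTranslateLin_one (f : Lp ℂ p (Measure.haar : Measure G)) :
    biTranslateLin p 1 1 f = f := by
  apply Lp.ext
  filter_upwards [coeFn_biTranslateLin p 1 1 f] with x h1
  rw [h1]; simp [modularFn_one]

variable [Fact (1 ≤ p)] [hp : Fact (p ≠ ∞)]

theorem norm_biTranslateLin (s t : G) (f : Lp ℂ p (Measure.haar : Measure G)) :
    ‖biTranslateLin p s t f‖ = ‖f‖ := by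
  have : biTranslateLin p s t f = ((modularFn t ^ p.toReal⁻¹ : ℝ≥0) : ℂ) •
    (memLp_bimul p s t (Lp.memLp f)).toLp (fun x => f (s⁻¹ * x * t)) := rfl
  rw [this, norm_smul, Lp.norm_toLp, eLpNorm_bimul p hp.out s t (Lp.memLp f), ENNReal.smul_def,
    smul_eq_mul, ENNReal.toReal_mul, ENNReal.coe_toReal, ← mul_assoc, Lp.norm_def,
    NNReal.inv_rpow]
  have h : (modularFn t ^ p.toReal⁻¹ : ℝ≥0) ≠ 0 :=
    (NNReal.rpow_pos (modularFn_pos t)).ne'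
  have h' : ((modularFn t ^ p.toReal⁻¹ : ℝ≥0) : ℝ) ≠ 0 := by exact_mod_cast h
  simp only [Complex.norm_real, Real.norm_eq_abs, NNReal.abs_eq, NNReal.coe_inv]
  rw [mul_inv_cancel₀ h', one_mul]

/-- The action of `G × G` on `L^p(G)` (`1 ≤ p < ∞`) by linear isometries,
`((s, t) f)(x) = Δ(t)^{1/p} f(s⁻¹ x t)`. -/
def biTranslate : G × G →* (Lp ℂ p (Measure.haar : Measure G) ≃ₗᵢ[ℂ]
    Lp ℂ p (Measure.haar : Measure G)) where
  toFun st :=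
    { toLinearEquiv := LinearEquiv.ofLinearMap (biTranslateLin p st.1 st.2)
        (biTranslateLin p st.1⁻¹ st.2⁻¹)
        (by ext1 f; simp [← biTranslateLin_mul, biTranslateLin_one])
        (by ext1 f; simp [← biTranslateLin_mul, biTranslateLin_one])
      norm_map' := norm_biTranslateLin p st.1 st.2 }
  map_one' := by ext1 f; exact biTranslateLin_one p f
  map_mul' a b := by ext1 f; exact biTranslateLin_mul p a.1 a.2 b.1 b.2 f

theorem coeFn_biTranslate (s t : G) (f : Lp ℂ p (Measure.haar : Measure G)) :
    biTranslate p (s, t) f =ᵐ[Measure.haar]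
      fun x => ((modularFn t ^ p.toReal⁻¹ : ℝ≥0) : ℂ) * f (s⁻¹ * x * t) :=
  coeFn_biTranslateLin p s t f

/-- The two-sided translation action on `L^p(G)` is strongly continuous. -/
theorem continuous_biTranslate (f : Lp ℂ p (Measure.haar : Measure G)) :
    Continuous fun st : G × G => biTranslate p st f := by
  have hp0 : p ≠ 0 := (zero_lt_one.trans_le (Fact.out : 1 ≤ p)).ne'
  have hpos : 0 < p.toReal := ENNReal.toReal_pos hp0 hp.out
  refine continuous_of_uniform_approx_of_continuous fun u hu => ?_
  obtain ⟨ε, hε, hεu⟩ := Metric.mem_uniformity_dist.1 hu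
  obtain ⟨g, hg, g_cont, g_mem, g_supp⟩ :=
    exists_continuous_approx p hp.out (Lp.memLp f) (ε := ENNReal.ofReal (ε / 2)) (by simpa using hε)
  refine ⟨fun st => biTranslate p st (g_mem.toLp g), ?_, fun st => hεu ?_⟩
  swap
  · rw [(biTranslate p st).dist_map, Lp.dist_def]
    have : eLpNorm (⇑f - ⇑(g_mem.toLp g)) p (Measure.haar : Measure G)
        ≤ ENNReal.ofReal (ε / 2) := by
      refine le_trans (le_of_eq ?_) hg
      exact eLpNorm_congr_ae (Filter.EventuallyEq.rfl.sub g_mem.coeFn_toLp)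
    refine lt_of_le_of_lt (ENNReal.toReal_mono ENNReal.ofReal_ne_top this) ?_
    rw [ENNReal.toReal_ofReal (by positivity)]
    linarith
  rw [continuous_iff_continuousAt]
  rintro ⟨s₀, t₀⟩
  let c : G → ℂ := fun t => ((modularFn t ^ p.toReal⁻¹ : ℝ≥0) : ℂ)
  have hc : Continuous c := Complex.continuous_ofReal.comp (NNReal.continuous_coe.comp
    ((NNReal.continuous_rpow_const (y := p.toReal⁻¹) (by positivity)).comp continuous_modularFn))
  let F : G × G → G → ℂ := fun st x => c st.2 * g (st.1⁻¹ * x * st.2)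
  have hF : ∀ st : G × G, biTranslate p st (g_mem.toLp g) =ᵐ[Measure.haar] F st := by
    intro st
    filter_upwards [coeFn_biTranslate p st.1 st.2 (g_mem.toLp g),
      (quasiMeasurePreserving_bimul st.1 st.2).ae g_mem.coeFn_toLp] with x h1 h2
    rw [h1, h2]
  have hnorm : ∀ st : G × G,
      ‖biTranslate p st (g_mem.toLp g) - biTranslate p (s₀, t₀) (g_mem.toLp g)‖ =
      (∫ x, ‖F st x - F (s₀, t₀) x‖ ^ p.toReal ∂(Measure.haar : Measure G)) ^ p.toReal⁻¹ := by
    intro st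
    rw [Lp.norm_def, (Lp.memLp _).eLpNorm_eq_integral_rpow_norm hp0 hp.out,
      ENNReal.toReal_ofReal (Real.rpow_nonneg (integral_nonneg fun x => by positivity) _)]
    congr 1
    apply integral_congr_ae
    filter_upwards [hF st, hF (s₀, t₀), Lp.coeFn_sub (biTranslate p st (g_mem.toLp g))
      (biTranslate p (s₀, t₀) (g_mem.toLp g))] with x h1 h2 h3
    rw [h3, Pi.sub_apply, h1, h2]
  have hI := continuousAt_integral_bimul g_cont g_supp s₀ t₀ p.toReal hpos c hc
  rw [ContinuousAt, tendsto_iff_norm_sub_tendsto_zero]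
  have hI2 := (hI.rpow_const (p := p.toReal⁻¹) (Or.inr (by positivity))).tendsto
  refine (hI2.congr fun st => (hnorm st).symm).trans (le_of_eq ?_)
  simp only [sub_self, norm_zero, Real.zero_rpow hpos.ne', integral_zero,
    Real.zero_rpow (inv_pos.2 hpos).ne']

end Translations

/-! ## Unitary representations and the full group C*-algebra -/

/-- A (strongly continuous) unitary representation of `G` on a complex Hilbert space. Every cyclic
representation of `G` is unitarily equivalent to one on a Hilbert space in the universe of `G`. -/
structure UnitaryRep (G : Type u) [Group G] [TopologicalSpace G] : Type (u + 1) where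
  /-- the Hilbert space -/
  H : Type u
  [instNACG : NormedAddCommGroup H]
  [instIPS : InnerProductSpace ℂ H]
  [instComplete : CompleteSpace H]
  /-- the homomorphism into the unitary group -/
  toHom : G →* (H ≃ₗᵢ[ℂ] H)
  continuous_apply : ∀ ξ : H, Continuous fun s => toHom s ξ

attribute [instance] UnitaryRep.instNACG UnitaryRep.instIPS UnitaryRep.instComplete

section OperatorFamilies

variable {G : Type u} [Group G] [TopologicalSpace G]

variable (G) in
/-- The C*-algebra `∏_π B(H_π)` of bounded families of operators, `π` running over all unitary
representations of `G`, with the supremum norm. -/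
def OperatorFamily : Type (u + 1) := lp (fun π : UnitaryRep G => π.H →L[ℂ] π.H) ∞

instance : NonUnitalCStarAlgebra (OperatorFamily G) :=
  inferInstanceAs (NonUnitalCStarAlgebra (lp (fun π : UnitaryRep G => π.H →L[ℂ] π.H) ∞))

/-- The component of a family of operators at `π`, as a *-homomorphism. -/
def OperatorFamily.eval (π : UnitaryRep G) : OperatorFamily G →⋆ₙₐ[ℂ] (π.H →L[ℂ] π.H) where
  toFun a := a.1 π
  map_smul' _ _ := rfl
  map_zero' := rfl
  map_add' _ _ := rfl
  map_mul' _ _ := rfl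
  map_star' _ := rfl

theorem OperatorFamily.norm_eq (a : OperatorFamily G) :
    ‖a‖ = ⨆ π : UnitaryRep G, ‖OperatorFamily.eval π a‖ :=
  lp.norm_eq_ciSup (E := fun π : UnitaryRep G => π.H →L[ℂ] π.H) a

theorem OperatorFamily.norm_eval_le (π : UnitaryRep G) (a : OperatorFamily G) :
    ‖OperatorFamily.eval π a‖ ≤ ‖a‖ :=
  lp.norm_apply_le_norm (E := fun π : UnitaryRep G => π.H →L[ℂ] π.H) ENNReal.top_ne_zero a π

end OperatorFamilies

section GroupCStarAlgebra

variable {G : Type u} [Group G] [TopologicalSpace G] [IsTopologicalGroup G]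
  [LocallyCompactSpace G] [MeasurableSpace G] [BorelSpace G]

namespace UnitaryRep

theorem integrable_smul (π : UnitaryRep G) (f : C_c(G, ℂ)) (ξ : π.H) :
    Integrable (fun s => f s • π.toHom s ξ) (Measure.haar : Measure G) :=
  (f.continuous.smul (π.continuous_apply ξ)).integrable_of_hasCompactSupport
    f.hasCompactSupport.smul_right

/-- The integrated form `π(f) = ∫ f(s) π(s) ds` of a representation, for `f ∈ C_c(G)`. -/
def integrated (π : UnitaryRep G) (f : C_c(G, ℂ)) : π.H →L[ℂ] π.H :=
  LinearMap.mkContinuous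
    { toFun := fun ξ => ∫ s, f s • π.toHom s ξ ∂(Measure.haar : Measure G)
      map_add' := fun ξ η => by
        rw [← integral_add (π.integrable_smul f ξ) (π.integrable_smul f η)]
        simp only [map_add, smul_add]
      map_smul' := fun c ξ => by
        rw [RingHom.id_apply, ← integral_smul]
        simp only [map_smul, smul_comm c] }
    (∫ s, ‖f s‖ ∂(Measure.haar : Measure G))
    (fun ξ => by
      refine (norm_integral_le_integral_norm _).trans (le_of_eq ?_)
      simp only [norm_smul, LinearIsometryEquiv.norm_map]
      exact integral_mul_const _ _)

theorem integrated_apply (π : UnitaryRep G) (f : C_c(G, ℂ)) (ξ : π.H) :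
    π.integrated f ξ = ∫ s, f s • π.toHom s ξ ∂(Measure.haar : Measure G) := rfl

theorem norm_integrated_le (π : UnitaryRep G) (f : C_c(G, ℂ)) :
    ‖π.integrated f‖ ≤ ∫ s, ‖f s‖ ∂(Measure.haar : Measure G) :=
  LinearMap.mkContinuous_norm_le _ (integral_nonneg fun _ => norm_nonneg _) _

end UnitaryRep

/-- The image `(π(f))_π` of `f ∈ C_c(G)` in `∏_π B(H_π)`. Its norm is the universal norm
`sup_π ‖π(f)‖`. -/
def universalImage (f : C_c(G, ℂ)) : OperatorFamily G :=
  ⟨fun π => π.integrated f, memℓp_infty ⟨∫ s, ‖f s‖ ∂(Measure.haar : Measure G), by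
    rintro _ ⟨π, rfl⟩; exact π.norm_integrated_le f⟩⟩

variable (G) in
/-- The C*-subalgebra of `∏_π B(H_π)` generated by the image of `C_c(G)`. -/
def groupCStarSubalgebra : NonUnitalStarSubalgebra ℂ (OperatorFamily G) :=
  (NonUnitalStarAlgebra.adjoin ℂ (Set.range (universalImage (G := G)))).topologicalClosure

variable (G) in
/-- The full group C*-algebra `C*(G)`: the C*-algebra generated by `C_c(G)` (equivalently by
`L¹(G)`, in which `C_c(G)` is dense) in its universal representation, i.e. the completion of the
convolution *-algebra for the norm `sup_π ‖π(f)‖`. -/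
def GroupCStar : Type (u + 1) := groupCStarSubalgebra G

instance : NonUnitalCStarAlgebra (GroupCStar G) :=
  haveI : IsClosed (groupCStarSubalgebra G : Set (OperatorFamily G)) :=
    NonUnitalStarSubalgebra.isClosed_topologicalClosure _
  inferInstanceAs (NonUnitalCStarAlgebra (groupCStarSubalgebra G))

/-- The inclusion of `C*(G)` into `∏_π B(H_π)`. -/
def GroupCStar.incl : GroupCStar G →⋆ₙₐ[ℂ] OperatorFamily G where
  toFun a := a.1
  map_smul' _ _ := rfl
  map_zero' := rfl
  map_add' _ _ := rfl
  map_mul' _ _ := rfl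
  map_star' _ := rfl

/-- The *-representation of `C*(G)` extending the integrated form of `π`. -/
def UnitaryRep.extend (π : UnitaryRep G) : GroupCStar G →⋆ₙₐ[ℂ] (π.H →L[ℂ] π.H) :=
  (OperatorFamily.eval π).comp GroupCStar.incl

/-- The canonical image of `f ∈ C_c(G)` in `C*(G)`. -/
def GroupCStar.ofCc (f : C_c(G, ℂ)) : GroupCStar G :=
  ⟨universalImage f, NonUnitalStarSubalgebra.le_topologicalClosure _
    (NonUnitalStarAlgebra.subset_adjoin ℂ _ ⟨f, rfl⟩)⟩

theorem UnitaryRep.extend_ofCc (π : UnitaryRep G) (f : C_c(G, ℂ)) :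
    π.extend (GroupCStar.ofCc f) = π.integrated f := rfl

/-- The representations `π.extend` form a jointly isometric (in particular faithful) family. -/
theorem GroupCStar.norm_eq (a : GroupCStar G) : ‖a‖ = ⨆ π : UnitaryRep G, ‖π.extend a‖ :=
  OperatorFamily.norm_eq (GroupCStar.incl a)

theorem UnitaryRep.norm_extend_le (π : UnitaryRep G) (a : GroupCStar G) : ‖π.extend a‖ ≤ ‖a‖ :=
  OperatorFamily.norm_eval_le π (GroupCStar.incl a)

end GroupCStarAlgebra

/-! ## The minimal tensor norm -/

section MinimalNorm

/-- For *-representations `φ : A → B(H)` and `ψ : B → B(K)`, the representation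
`a ⊗ b ↦ φ(a) ⊗ ψ(b)` of the algebraic tensor product on the (algebraic, hence dense in the
Hilbert space) tensor product of `H` and `K`. -/
def tensorRep {A B H K : Type*} [NonUnitalCStarAlgebra A] [NonUnitalCStarAlgebra B]
    [NormedAddCommGroup H] [InnerProductSpace ℂ H] [CompleteSpace H]
    [NormedAddCommGroup K] [InnerProductSpace ℂ K] [CompleteSpace K]
    (φ : A →⋆ₙₐ[ℂ] (H →L[ℂ] H)) (ψ : B →⋆ₙₐ[ℂ] (K →L[ℂ] K)) :
    A ⊗[ℂ] B →ₗ[ℂ] (H ⊗[ℂ] K →L[ℂ] H ⊗[ℂ] K) :=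
  TensorProduct.lift (LinearMap.mk₂ ℂ (fun a b => TensorProduct.mapL (φ a) (ψ b))
    (fun a a' b => by rw [map_add, TensorProduct.mapL_add_left])
    (fun c a b => by rw [map_smul, TensorProduct.mapL_smul_left])
    (fun a b b' => by rw [map_add, TensorProduct.mapL_add_right])
    (fun c a b => by rw [map_smul, TensorProduct.mapL_smul_right]))

theorem tensorRep_tmul {A B H K : Type*} [NonUnitalCStarAlgebra A] [NonUnitalCStarAlgebra B]
    [NormedAddCommGroup H] [InnerProductSpace ℂ H] [CompleteSpace H]
    [NormedAddCommGroup K] [InnerProductSpace ℂ K] [CompleteSpace K]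
    (φ : A →⋆ₙₐ[ℂ] (H →L[ℂ] H)) (ψ : B →⋆ₙₐ[ℂ] (K →L[ℂ] K)) (a : A) (b : B) :
    tensorRep φ ψ (a ⊗ₜ b) = TensorProduct.mapL (φ a) (ψ b) := rfl

/-- For *-representations `φ`, `ψ` of `A`, `B` on the same Hilbert space `H`, the linear map
`A ⊙ B → B(H)`, `a ⊗ b ↦ φ(a)ψ(b)`. -/
def productMap {A B H : Type*} [NonUnitalCStarAlgebra A] [NonUnitalCStarAlgebra B]
    [NormedAddCommGroup H] [InnerProductSpace ℂ H] [CompleteSpace H]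
    (φ : A →⋆ₙₐ[ℂ] (H →L[ℂ] H)) (ψ : B →⋆ₙₐ[ℂ] (H →L[ℂ] H)) :
    A ⊗[ℂ] B →ₗ[ℂ] (H →L[ℂ] H) :=
  TensorProduct.lift (LinearMap.mk₂ ℂ (fun a b => φ a * ψ b)
    (fun a a' b => by rw [map_add, add_mul])
    (fun c a b => by rw [map_smul, smul_mul_assoc])
    (fun a b b' => by rw [map_add, mul_add])
    (fun c a b => by rw [map_smul, mul_smul_comm]))

/-- The norm of the image of `x ∈ A ⊙ B` under `φ ⊗ ψ`. -/
def tensorRepNorm {A B H K : Type*} [NonUnitalCStarAlgebra A] [NonUnitalCStarAlgebra B]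
    [NormedAddCommGroup H] [InnerProductSpace ℂ H] [CompleteSpace H]
    [NormedAddCommGroup K] [InnerProductSpace ℂ K] [CompleteSpace K]
    (φ : A →⋆ₙₐ[ℂ] (H →L[ℂ] H)) (ψ : B →⋆ₙₐ[ℂ] (K →L[ℂ] K)) (x : A ⊗[ℂ] B) : ℝ :=
  ‖tensorRep φ ψ x‖

section
variable {A B H K : Type*} [NonUnitalCStarAlgebra A] [NonUnitalCStarAlgebra B]
    [NormedAddCommGroup H] [InnerProductSpace ℂ H] [CompleteSpace H]
    [NormedAddCommGroup K] [InnerProductSpace ℂ K] [CompleteSpace K]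
    (φ : A →⋆ₙₐ[ℂ] (H →L[ℂ] H)) (ψ : B →⋆ₙₐ[ℂ] (K →L[ℂ] K))

theorem tensorRepNorm_zero : tensorRepNorm φ ψ 0 = 0 := by
  rw [tensorRepNorm, LinearMap.map_zero]
  exact norm_zero (E := H ⊗[ℂ] K →L[ℂ] H ⊗[ℂ] K)

theorem tensorRepNorm_add_le (x y : A ⊗[ℂ] B) :
    tensorRepNorm φ ψ (x + y) ≤ tensorRepNorm φ ψ x + tensorRepNorm φ ψ y := by
  rw [tensorRepNorm, LinearMap.map_add]
  exact norm_add_le (E := H ⊗[ℂ] K →L[ℂ] H ⊗[ℂ] K) _ _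

theorem tensorRepNorm_tmul_le (a : A) (b : B) :
    tensorRepNorm φ ψ (a ⊗ₜ b) ≤ ‖φ a‖ * ‖ψ b‖ :=
  TensorProduct.norm_mapL_le (φ a) (ψ b)

end

variable {G : Type u} [Group G] [TopologicalSpace G] [IsTopologicalGroup G]
  [LocallyCompactSpace G] [MeasurableSpace G] [BorelSpace G]

/-- The minimal (spatial) C*-norm on `C*(G) ⊙ C*(G)`: the operator norm of `x` in the tensor
product of the faithful representation `⨁_π π` of `C*(G)` with itself. As that tensor product is the
direct sum of the representations `π ⊗ σ`, the norm is the supremum of the norms in these. -/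
def minNorm (x : GroupCStar G ⊗[ℂ] GroupCStar G) : ℝ :=
  ⨆ q : UnitaryRep G × UnitaryRep G, tensorRepNorm q.1.extend q.2.extend x

theorem bddAbove_minNorm (x : GroupCStar G ⊗[ℂ] GroupCStar G) :
    BddAbove (Set.range fun q : UnitaryRep G × UnitaryRep G =>
      tensorRepNorm q.1.extend q.2.extend x) := by
  induction x with
  | zero => exact ⟨0, by rintro _ ⟨q, rfl⟩; exact (tensorRepNorm_zero _ _).le⟩
  | tmul a b =>
    refine ⟨‖a‖ * ‖b‖, ?_⟩
    rintro _ ⟨q, rfl⟩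
    exact (tensorRepNorm_tmul_le _ _ a b).trans (mul_le_mul (q.1.norm_extend_le a)
      (q.2.norm_extend_le b) (norm_nonneg _) (norm_nonneg _))
  | add x y hx hy =>
    obtain ⟨C, hC⟩ := hx
    obtain ⟨D, hD⟩ := hy
    refine ⟨C + D, ?_⟩
    rintro _ ⟨q, rfl⟩
    exact (tensorRepNorm_add_le _ _ x y).trans (add_le_add (hC ⟨q, rfl⟩) (hD ⟨q, rfl⟩))

end MinimalNorm

/-! ## The factorization property and QSIN groups -/

section Main

instance : Fact ((1 : ℝ≥0∞) ≠ ∞) := ⟨ENNReal.one_ne_top⟩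

instance : Fact ((2 : ℝ≥0∞) ≠ ∞) := ⟨ENNReal.ofNat_ne_top⟩

variable (G : Type u) [Group G] [TopologicalSpace G] [IsTopologicalGroup G]
  [LocallyCompactSpace G] [MeasurableSpace G] [BorelSpace G]

/-- The left regular representation `λ(s)f(x) = f(s⁻¹x)` on `L²(G)`. -/
def leftRegular : UnitaryRep G where
  H := Lp ℂ 2 (Measure.haar : Measure G)
  toHom := (biTranslate 2).comp (MonoidHom.inl G G)
  continuous_apply ξ := (continuous_biTranslate 2 ξ).comp
    (by fun_prop : Continuous fun s : G => (s, (1 : G)))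

/-- The right regular representation `ρ(t)f(x) = f(xt)Δ(t)^{1/2}` on `L²(G)`. -/
def rightRegular : UnitaryRep G where
  H := Lp ℂ 2 (Measure.haar : Measure G)
  toHom := (biTranslate 2).comp (MonoidHom.inr G G)
  continuous_apply ξ := (continuous_biTranslate 2 ξ).comp
    (by fun_prop : Continuous fun t : G => ((1 : G), t))

theorem leftRegular_apply (s : G) (f : Lp ℂ 2 (Measure.haar : Measure G)) :
    (leftRegular G).toHom s f = biTranslate 2 (s, 1) f := rfl

theorem rightRegular_apply (t : G) (f : Lp ℂ 2 (Measure.haar : Measure G)) :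
    (rightRegular G).toHom t f = biTranslate 2 (1, t) f := rfl

theorem coeFn_leftRegular (s : G) (f : Lp ℂ 2 (Measure.haar : Measure G)) :
    biTranslate 2 (s, 1) f =ᵐ[Measure.haar] fun x => f (s⁻¹ * x) := by
  filter_upwards [coeFn_biTranslate 2 s 1 f] with x h
  refine h.trans ?_
  simp [modularFn_one]

theorem coeFn_rightRegular (t : G) (f : Lp ℂ 2 (Measure.haar : Measure G)) :
    biTranslate 2 (1, t) f =ᵐ[Measure.haar]
      fun x => (Real.sqrt (modularFn t) : ℂ) * f (x * t) := by
  filter_upwards [coeFn_biTranslate 2 1 t f] with x h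
  refine h.trans ?_
  simp [Real.sqrt_eq_rpow]

/-- The linear map `λ·ρ : C*(G) ⊙ C*(G) → B(L²(G))`, `a ⊗ b ↦ λ(a)ρ(b)`. -/
def leftRight : GroupCStar G ⊗[ℂ] GroupCStar G →ₗ[ℂ]
    (Lp ℂ 2 (Measure.haar : Measure G) →L[ℂ] Lp ℂ 2 (Measure.haar : Measure G)) :=
  productMap (H := Lp ℂ 2 (Measure.haar : Measure G)) (leftRegular G).extend
    (rightRegular G).extend

/-- The factorization property: `λ·ρ : C*(G) ⊙ C*(G) → B(L²(G))` is continuous for the minimal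
C*-norm, i.e. extends continuously to `C*(G) ⊗_min C*(G)`. -/
def HasFactorizationProperty : Prop :=
  ∃ C : ℝ, ∀ x : GroupCStar G ⊗[ℂ] GroupCStar G, ‖leftRight G x‖ ≤ C * minNorm x

variable {G}

/-- Convolution `e * f = ∫ e(s) f(s⁻¹ ·) ds` on `L¹(G)`, as an `L¹(G)`-valued Bochner integral. -/
def convL1 (e f : Lp ℂ 1 (Measure.haar : Measure G)) : Lp ℂ 1 (Measure.haar : Measure G) :=
  ∫ s, e s • biTranslate 1 (s, 1) f ∂(Measure.haar : Measure G)

/-- The isometric conjugation action `τ₁(s)f(x) = f(s⁻¹xs)Δ(s)` on `L¹(G)`. -/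
def conjL1 (s : G) (f : Lp ℂ 1 (Measure.haar : Measure G)) : Lp ℂ 1 (Measure.haar : Measure G) :=
  biTranslate 1 (s, s) f

theorem coeFn_conjL1 (s : G) (f : Lp ℂ 1 (Measure.haar : Measure G)) :
    conjL1 s f =ᵐ[Measure.haar] fun x => (modularFn s : ℂ) * f (s⁻¹ * x * s) := by
  filter_upwards [coeFn_biTranslate 1 s s f] with x h
  refine h.trans ?_
  simp

variable (G)

/-- `G` is QSIN: `L¹(G)` has a bounded (two-sided) approximate identity `(e_α)`, a net, with
`‖τ₁(s)e_α - e_α‖₁ → 0` uniformly for `s` in compact subsets of `G`. -/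
def IsQSIN : Prop :=
  ∃ (A : Type u) (_ : Preorder A) (_ : IsDirectedOrder A) (_ : Nonempty A)
    (e : A → Lp ℂ 1 (Measure.haar : Measure G)),
    (∃ M : ℝ, ∀ α, ‖e α‖ ≤ M) ∧
    (∀ f : Lp ℂ 1 (Measure.haar : Measure G),
      Filter.Tendsto (fun α => convL1 (e α) f) Filter.atTop (nhds f) ∧
      Filter.Tendsto (fun α => convL1 f (e α)) Filter.atTop (nhds f)) ∧
    ∀ K : Set G, IsCompact K → ∀ ε : ℝ, 0 < ε → ∃ α₀, ∀ α, α₀ ≤ α →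
      ∀ s ∈ K, ‖conjL1 s (e α) - e α‖ < ε

end Main

end

/-! Let `x ∈ C*(H) ⊙ C*(H)`, and let `λ_G`, `ρ_G` also denote their pull-backs to `H` along `ι`. The
proof is the chain `‖(λ_H · ρ_H)(x)‖ ≤ ‖(λ_G · ρ_G)(x)‖ ≤ C ‖x‖_min`.

The second inequality (`norm_leftRightRestrict_le`) holds for every continuous homomorphism. An
element of `C*(H)` acts only as a multiplier of `C*(G)`, so it is first multiplied by a bump `e ∈
C_c(G)` of `L¹` norm one. This `smoothing` does not increase the minimal norm
(`minNorm_map_smoothing_le`), the factorization property of `G` bounds the result, and `e` is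
removed by a strong limit.

The first inequality is weak containment of `λ_H ρ_H` in the restriction of `λ_G ρ_G`. By
`RepPair.norm_sum_op_le` it is enough to approximate, uniformly on compact sets, the coefficients of
`λ_H ρ_H` at vectors `f ∈ C_c(H)` by coefficients at single vectors of `L²(G)`. QSIN and injectivity
are used here (`IsQSIN.exists_coefficient_approx`). QSIN gives a probability density `v` near `1 ∈
G`, almost invariant under conjugation by a compact set (`IsQSIN.exists_quasicentral`). The
approximating vector is `λ_G(f)ξ`. Its coefficient at `(s, t)` is the integral over `k ∈ H` of a
correlation function of `f` against the overlap of `λ_G(k)ξ` with `λ_G(t)ρ_G(t)ξ`. By injectivity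
and compactness, small support of `ξ` concentrates the overlap near `k = 1`, where the correlation
is the desired coefficient.

It remains to give the overlap total mass close to one. Without conjugation this mass is `∫ ξ(x)
(∫_H ξ(k⁻¹x) dk) dx`, so `ξ = v / √(v_H)` is taken, with `v_H` the local average of `v` over
`H`-orbits, regularised by a small `κ > 0`. Conjugation by `t` rescales Haar measure on `G` and on
`H` by different modular functions; `modularRatio` does the bookkeeping.
`IsLocalizing.abs_overlap_sub_one_le` bounds the error by `‖τ₁(t)v - v‖₁` and a term that vanishes
as `κ → 0`. -/

noncomputable section

set_option linter.unusedSectionVars false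

/-! ### Integrated forms, and averages over `H` of translated operators. -/

section IntegratedForm

open Filter Topology

variable {G : Type u} [Group G] [TopologicalSpace G] [IsTopologicalGroup G]
  [LocallyCompactSpace G] [MeasurableSpace G] [BorelSpace G]

/-- The left translate `x ↦ e (h⁻¹ x)` of a compactly supported continuous function. -/
def translateCc (h : G) (e : C_c(G, ℂ)) : C_c(G, ℂ) :=
  ⟨⟨fun x => e (h⁻¹ * x), by fun_prop⟩,
    e.hasCompactSupport.comp_homeomorph (Homeomorph.mulLeft h⁻¹)⟩

theorem translateCc_apply (h : G) (e : C_c(G, ℂ)) (x : G) :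
    translateCc h e x = e (h⁻¹ * x) := rfl

/-- Left invariance of Haar measure absorbs `π(h)` into a translate of `e`; this is how group
elements multiply `C*(G)`. -/
theorem UnitaryRep.toHom_integrated (π : UnitaryRep G) (h : G) (e : C_c(G, ℂ)) (ξ : π.H) :
    π.toHom h (π.integrated e ξ) = π.integrated (translateCc h e) ξ := by
  rw [π.integrated_apply, π.integrated_apply,
    ← integral_mul_left_eq_self (fun s => translateCc h e s • π.toHom s ξ) h]
  have := ((π.toHom h).toContinuousLinearEquiv.toContinuousLinearMap).integral_comp_comm
    (π.integrable_smul e ξ)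
  refine this.symm.trans (integral_congr_ae (.of_forall fun s => ?_))
  simp [translateCc_apply]

theorem UnitaryRep.integrated_add (π : UnitaryRep G) (f g : C_c(G, ℂ)) :
    π.integrated (f + g) = π.integrated f + π.integrated g := by
  ext ξ
  simp only [add_apply, π.integrated_apply]
  rw [← integral_add (π.integrable_smul f ξ) (π.integrable_smul g ξ)]
  simp [add_smul]

theorem UnitaryRep.integrated_smul (π : UnitaryRep G) (c : ℂ) (f : C_c(G, ℂ)) :
    π.integrated (c • f) = c • π.integrated f := by
  ext ξ
  simp only [smul_apply, π.integrated_apply]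
  rw [← integral_smul]
  simp [mul_smul]

theorem OperatorFamily.ext_eval {a b : OperatorFamily G}
    (h : ∀ π, OperatorFamily.eval π a = OperatorFamily.eval π b) : a = b :=
  Subtype.ext (funext h)

theorem OperatorFamily.norm_le {a : OperatorFamily G} {C : ℝ} (hC : 0 ≤ C)
    (h : ∀ π, ‖OperatorFamily.eval π a‖ ≤ C) : ‖a‖ ≤ C :=
  lp.norm_le_of_forall_le (E := fun π : UnitaryRep G => π.H →L[ℂ] π.H) (f := a) hC h

theorem eval_universalImage (π : UnitaryRep G) (f : C_c(G, ℂ)) :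
    OperatorFamily.eval π (universalImage f) = π.integrated f := rfl

variable (G) in
/-- `universalImage` as a linear map. -/
def universalImageLin : C_c(G, ℂ) →ₗ[ℂ] OperatorFamily G where
  toFun := universalImage
  map_add' f g := OperatorFamily.ext_eval fun π => by
    rw [map_add]; exact π.integrated_add f g
  map_smul' c f := OperatorFamily.ext_eval fun π => by
    rw [map_smul]; exact π.integrated_smul c f

theorem norm_universalImage_le (f : C_c(G, ℂ)) :
    ‖universalImage f‖ ≤ ∫ s, ‖f s‖ ∂(Measure.haar : Measure G) :=
  OperatorFamily.norm_le (integral_nonneg fun _ => norm_nonneg _) fun π => π.norm_integrated_le f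

theorem norm_universalImage_sub_le (f g : C_c(G, ℂ)) :
    ‖universalImage f - universalImage g‖ ≤ ∫ s, ‖f s - g s‖ ∂(Measure.haar : Measure G) := by
  have : universalImage f - universalImage g = universalImage (f - g) :=
    ((universalImageLin G).map_sub f g).symm
  rw [this]
  exact norm_universalImage_le (f - g)

/-- The universal norm is dominated by the `L¹` norm, in which left translation of a `C_c` function
is continuous. Norm continuity makes `actIntegral` a Bochner integral. -/
theorem continuous_universalImage_translateCc (e : C_c(G, ℂ)) :
    Continuous fun h : G => universalImage (translateCc h e) := by
  rw [continuous_iff_continuousAt]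
  intro h₀
  have h1 := continuousAt_integral_bimul e.continuous e.hasCompactSupport h₀ 1 1 one_pos
    (fun _ => 1) continuous_const
  have h2 : Tendsto (fun h : G => ∫ x, ‖e (h⁻¹ * x) - e (h₀⁻¹ * x)‖ ∂(Measure.haar : Measure G))
      (𝓝 h₀) (𝓝 0) := by
    have := h1.tendsto.comp ((by fun_prop : Continuous fun h : G => (h, (1 : G))).tendsto h₀)
    simpa [Function.comp_def] using this
  rw [ContinuousAt, tendsto_iff_norm_sub_tendsto_zero]
  exact squeeze_zero (fun _ => norm_nonneg _) (fun h => norm_universalImage_sub_le _ _) h2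

/-- Evaluation of a family of operators at a vector of one of the representations. -/
def OperatorFamily.evalVec (π : UnitaryRep G) (ξ : π.H) : OperatorFamily G →L[ℂ] π.H :=
  LinearMap.mkContinuous
    { toFun := fun a => OperatorFamily.eval π a ξ
      map_add' := fun a b => by simp
      map_smul' := fun c a => by simp } ‖ξ‖ fun a => by
    rw [mul_comm]
    exact (ContinuousLinearMap.le_opNorm _ _).trans
      (mul_le_mul_of_nonneg_right (a.norm_eval_le π) (norm_nonneg _))

theorem OperatorFamily.evalVec_apply (π : UnitaryRep G) (ξ : π.H) (a : OperatorFamily G) :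
    OperatorFamily.evalVec π ξ a = OperatorFamily.eval π a ξ := rfl

variable (G) in
/-- The closure of the image of `C_c(G)` in `∏_π B(H_π)`. -/
def ccClosure : Submodule ℂ (OperatorFamily G) :=
  (LinearMap.range (universalImageLin G)).topologicalClosure

theorem isClosed_ccClosure : IsClosed (ccClosure G : Set (OperatorFamily G)) :=
  Submodule.isClosed_topologicalClosure _

theorem universalImage_mem_ccClosure (f : C_c(G, ℂ)) : universalImage f ∈ ccClosure G :=
  Submodule.le_topologicalClosure _ ⟨f, rfl⟩

theorem ccClosure_induction {p : OperatorFamily G → Prop} (hp : IsClosed {a | p a})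
    (h : ∀ f : C_c(G, ℂ), p (universalImage f)) {a : OperatorFamily G} (ha : a ∈ ccClosure G) :
    p a := by
  have : (ccClosure G : Set (OperatorFamily G)) ⊆ {a | p a} := by
    refine hp.closure_subset_iff.2 ?_
    rintro _ ⟨f, rfl⟩
    exact h f
  exact this ha

theorem ccClosure_le_groupCStar {a : OperatorFamily G} (ha : a ∈ ccClosure G) :
    a ∈ groupCStarSubalgebra G :=
  ccClosure_induction (p := fun a => a ∈ groupCStarSubalgebra G)
    (NonUnitalStarSubalgebra.isClosed_topologicalClosure _)
    (fun f => (GroupCStar.ofCc f).2) ha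

variable {H : Type u} [Group H] [TopologicalSpace H] [IsTopologicalGroup H]
  [LocallyCompactSpace H] [MeasurableSpace H] [BorelSpace H]

/-- The operator family `∫ k(h) π(φ h) π(e) dh`. -/
def actIntegral (φ : H → G) (k : H → ℂ) (e : C_c(G, ℂ)) : OperatorFamily G :=
  ∫ h, k h • universalImage (translateCc (φ h) e) ∂(Measure.haar : Measure H)

section
variable {φ : H → G} (hφ : Continuous φ) {k : H → ℂ} (hk : Continuous k)
  (hk' : HasCompactSupport k) (e : C_c(G, ℂ))
include hφ hk hk'

theorem integrable_actIntegral : Integrable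
    (fun h => k h • universalImage (translateCc (φ h) e)) (Measure.haar : Measure H) :=
  (hk.smul ((continuous_universalImage_translateCc e).comp hφ)).integrable_of_hasCompactSupport
    hk'.smul_right

/-- The integrand is continuous with values in a closed subspace, so the integral can be formed
there; the inclusion commutes with it. -/
theorem actIntegral_mem : actIntegral φ k e ∈ ccClosure G := by
  have : CompleteSpace (ccClosure G) := isClosed_ccClosure.completeSpace_coe
  let F : H → ccClosure G := fun h =>
    k h • ⟨universalImage (translateCc (φ h) e), universalImage_mem_ccClosure _⟩
  have hF : Continuous F := hk.smul
    (((continuous_universalImage_translateCc e).comp hφ).subtype_mk _)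
  have hI : Integrable F (Measure.haar : Measure H) :=
    hF.integrable_of_hasCompactSupport hk'.smul_right
  have := (ccClosure G).subtypeL.integral_comp_comm hI
  have h2 : actIntegral φ k e = (ccClosure G).subtypeL (∫ h, F h ∂(Measure.haar : Measure H)) := by
    rw [← this]; rfl
  rw [h2]
  exact Submodule.coe_mem _

theorem eval_actIntegral (π : UnitaryRep G) (ξ : π.H) :
    OperatorFamily.eval π (actIntegral φ k e) ξ
      = ∫ h, k h • π.toHom (φ h) (π.integrated e ξ) ∂(Measure.haar : Measure H) := by
  rw [← OperatorFamily.evalVec_apply, actIntegral,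
    ← (OperatorFamily.evalVec π ξ).integral_comp_comm (integrable_actIntegral hφ hk hk' e)]
  refine integral_congr_ae (.of_forall fun h => ?_)
  simp only [map_smul, OperatorFamily.evalVec_apply, eval_universalImage, π.toHom_integrated]
end

end IntegratedForm

/-! ### Elements of `C*(H)` as multipliers of `C*(G)`. -/

section Restriction

open Filter Topology

variable {G : Type u} [Group G] [TopologicalSpace G] [IsTopologicalGroup G]
  [LocallyCompactSpace G] [MeasurableSpace G] [BorelSpace G]
variable {H : Type u} [Group H] [TopologicalSpace H] [IsTopologicalGroup H]
  [LocallyCompactSpace H] [MeasurableSpace H] [BorelSpace H]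
variable (ι : H →* G) (hι : Continuous ι)

/-- The pull-back of a unitary representation along a continuous homomorphism. -/
def UnitaryRep.restrict (π : UnitaryRep G) : UnitaryRep H where
  H := π.H
  toHom := π.toHom.comp ι
  continuous_apply ξ := (π.continuous_apply ξ).comp hι

/-- The *-homomorphism `(a_σ)_σ ↦ (a_{π ∘ ι})_π`. -/
def restrictFamily : OperatorFamily H →⋆ₙₐ[ℂ] OperatorFamily G where
  toFun a := ⟨fun π => OperatorFamily.eval (π.restrict ι hι) a, memℓp_infty ⟨‖a‖, by
    rintro _ ⟨π, rfl⟩; exact a.norm_eval_le (π.restrict ι hι)⟩⟩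
  map_smul' _ _ := rfl
  map_zero' := rfl
  map_add' _ _ := rfl
  map_mul' _ _ := rfl
  map_star' _ := rfl

theorem norm_restrictFamily_le (a : OperatorFamily H) : ‖restrictFamily ι hι a‖ ≤ ‖a‖ :=
  OperatorFamily.norm_le (norm_nonneg _) fun π => a.norm_eval_le (π.restrict ι hι)

theorem continuous_restrictFamily : Continuous (restrictFamily ι hι) :=
  AddMonoidHomClass.continuous_of_bound (restrictFamily ι hι) 1 fun a => by
    simpa using norm_restrictFamily_le ι hι a

/-- In every `π` both sides send `ξ` to `∫ f(h) π(ι h) π(e)ξ dh`. The left factor need not lie in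
`C*(G)`, but the product does. -/
theorem restrictFamily_universalImage_mul (f : C_c(H, ℂ)) (e : C_c(G, ℂ)) :
    restrictFamily ι hι (universalImage f) * universalImage e = actIntegral ι f e :=
  OperatorFamily.ext_eval fun π => by
    ext ξ
    exact (eval_actIntegral hι f.continuous f.hasCompactSupport e π ξ).symm

/-- Unitarity turns `π(s)` into `π(s⁻¹)`. With the inverse left inside the representation, no
modular function appears. -/
theorem UnitaryRep.adjoint_integrated_apply (π : UnitaryRep G) (f : C_c(G, ℂ)) (ξ : π.H) :
    (π.integrated f).adjoint ξ
      = ∫ s, star (f s) • π.toHom s⁻¹ ξ ∂(Measure.haar : Measure G) := by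
  have hint : Integrable (fun s => star (f s) • π.toHom s⁻¹ ξ) (Measure.haar : Measure G) :=
    ((continuous_star.comp f.continuous).smul
      ((π.continuous_apply ξ).comp continuous_inv)).integrable_of_hasCompactSupport
      (f.hasCompactSupport.comp_left (g := star) (star_zero ℂ)).smul_right
  refine ext_inner_left ℂ fun η => ?_
  rw [ContinuousLinearMap.adjoint_inner_right, π.integrated_apply,
    ← integral_inner (𝕜 := ℂ) hint η, ← inner_conj_symm,
    ← integral_inner (𝕜 := ℂ) (π.integrable_smul f η) ξ, ← integral_conj]
  refine integral_congr_ae (.of_forall fun s => ?_)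
  simp only [inner_smul_right, map_mul, inner_conj_symm]
  rw [← (π.toHom s⁻¹).inner_map_map (π.toHom s η) ξ]
  simp

theorem restrictFamily_star_universalImage_mul (f : C_c(H, ℂ)) (e : C_c(G, ℂ)) :
    restrictFamily ι hι (star (universalImage f)) * universalImage e
      = actIntegral (fun h => ι h⁻¹) (fun h => star (f h)) e :=
  OperatorFamily.ext_eval fun π => by
    ext ξ
    refine Eq.trans ?_ (eval_actIntegral (φ := fun h => ι h⁻¹) (by fun_prop)
      (continuous_star.comp f.continuous)
      (f.hasCompactSupport.comp_left (g := star) (star_zero ℂ)) e π ξ).symm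
    exact (π.restrict ι hι).adjoint_integrated_apply f _

/-- The elements which, together with their adjoints, multiply `ccClosure G` into itself form a
closed *-subalgebra, so generators suffice. Carrying the adjoint along is what makes this set stable
under `star`. -/
theorem restrictFamily_mul_mem {a : OperatorFamily H} (ha : a ∈ groupCStarSubalgebra H)
    {c : OperatorFamily G} (hc : c ∈ ccClosure G) : restrictFamily ι hι a * c ∈ ccClosure G := by
  let S : Set (OperatorFamily H) := {a | ∀ c ∈ ccClosure G, restrictFamily ι hι a * c ∈ ccClosure G
    ∧ restrictFamily ι hι (star a) * c ∈ ccClosure G}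
  have hS : IsClosed S := by
    have : S = ⋂ c ∈ ccClosure G, {a | restrictFamily ι hι a * c ∈ ccClosure G
      ∧ restrictFamily ι hι (star a) * c ∈ ccClosure G} := by
      ext; simp [S]
    rw [this]
    refine isClosed_biInter fun c _ => ?_
    have h1 : Continuous fun a => restrictFamily ι hι a * c :=
      (continuous_restrictFamily ι hι).mul continuous_const
    have h2 : Continuous fun a => restrictFamily ι hι (star a) * c :=
      ((continuous_restrictFamily ι hι).comp continuous_star).mul continuous_const
    exact (isClosed_ccClosure.preimage h1).inter (isClosed_ccClosure.preimage h2)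
  have hadj : (NonUnitalStarAlgebra.adjoin ℂ (Set.range (universalImage (G := H))) :
      Set (OperatorFamily H)) ⊆ S := by
    intro a ha
    refine NonUnitalStarAlgebra.adjoin_induction ℂ (p := fun a _ => a ∈ S) ?_ ?_ ?_ ?_ ?_ ?_ ha
    · rintro _ ⟨f, rfl⟩ c hc
      refine ccClosure_induction (p := fun c =>
        restrictFamily ι hι (universalImage f) * c ∈ ccClosure G ∧
        restrictFamily ι hι (star (universalImage f)) * c ∈ ccClosure G) ?_ ?_ hc
      · exact (isClosed_ccClosure.preimage (continuous_const_mul _)).inter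
          (isClosed_ccClosure.preimage (continuous_const_mul _))
      · intro e
        rw [restrictFamily_universalImage_mul, restrictFamily_star_universalImage_mul]
        exact ⟨actIntegral_mem hι f.continuous f.hasCompactSupport e,
          actIntegral_mem (by fun_prop) (continuous_star.comp f.continuous)
            (f.hasCompactSupport.comp_left (g := star) (star_zero ℂ)) e⟩
    · intro a b _ _ ha hb c hc
      rw [star_add, map_add, map_add, add_mul, add_mul]
      exact ⟨add_mem (ha c hc).1 (hb c hc).1, add_mem (ha c hc).2 (hb c hc).2⟩
    · intro c _
      simp
    · intro a b _ _ ha hb c hc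
      rw [star_mul, map_mul, map_mul, mul_assoc, mul_assoc]
      exact ⟨(ha _ (hb c hc).1).1, (hb _ (ha c hc).2).2⟩
    · intro z a _ ha c hc
      rw [star_smul, map_smul, map_smul, smul_mul_assoc, smul_mul_assoc]
      exact ⟨Submodule.smul_mem _ _ (ha c hc).1, Submodule.smul_mem _ _ (ha c hc).2⟩
    · intro a _ ha c hc
      rw [star_star]
      exact ⟨(ha c hc).2, (ha c hc).1⟩
  exact ((hS.closure_subset_iff.2 hadj) ha c hc).1

end Restriction

/-! ### Bump functions, and density of `C_c(G)` in `C*(G)`. -/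

section Density

open Filter Topology

variable {G : Type u} [Group G] [TopologicalSpace G] [IsTopologicalGroup G]
  [LocallyCompactSpace G] [MeasurableSpace G] [BorelSpace G]

/-- There are nonnegative functions of integral one with support in any neighbourhood of `1`. -/
theorem exists_bump {U : Set G} (hU : U ∈ 𝓝 (1 : G)) :
    ∃ e : C_c(G, ℂ), (∀ x, x ∉ U → e x = 0) ∧ (∫ x, ‖e x‖ ∂(Measure.haar : Measure G)) = 1 ∧
      ∫ x, e x ∂(Measure.haar : Measure G) = 1 := by
  obtain ⟨f, hf1, hf0, hfs, hf01⟩ := exists_continuous_one_zero_of_isCompact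
    (isCompact_singleton (x := (1 : G))) (isOpen_interior (s := U)).isClosed_compl
    (by simpa using mem_interior_iff_mem_nhds.2 hU)
  have hpos : 0 < ∫ x, f x ∂(Measure.haar : Measure G) :=
    f.continuous.integral_pos_of_hasCompactSupport_nonneg_nonzero hfs (fun x => (hf01 x).1)
      (x := 1) (by simp [hf1 (Set.mem_singleton _)])
  set I := ∫ x, f x ∂(Measure.haar : Measure G) with hI
  have hs : HasCompactSupport fun x => ((I⁻¹ * f x : ℝ) : ℂ) :=
    hfs.comp_left (g := fun r : ℝ => ((I⁻¹ * r : ℝ) : ℂ)) (by simp)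
  refine ⟨⟨⟨fun x => ((I⁻¹ * f x : ℝ) : ℂ), by fun_prop⟩, hs⟩, ?_, ?_, ?_⟩
  · intro x hx
    have : f x = 0 := hf0 fun h => hx (interior_subset h)
    simp [this]
  · have : ∀ x, ‖((I⁻¹ * f x : ℝ) : ℂ)‖ = I⁻¹ * f x := fun x => by
      rw [Complex.norm_real, Real.norm_of_nonneg (mul_nonneg (inv_nonneg.2 hpos.le) (hf01 x).1)]
    simp only [CompactlySupportedContinuousMap.coe_mk, ContinuousMap.coe_mk, this]
    rw [integral_const_mul, ← hI, inv_mul_cancel₀ hpos.ne']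
  · simp only [CompactlySupportedContinuousMap.coe_mk, ContinuousMap.coe_mk]
    rw [integral_complex_ofReal, integral_const_mul, ← hI, inv_mul_cancel₀ hpos.ne',
      Complex.ofReal_one]

/-- Averages of a continuous function over small neighbourhoods of `1` are close to its value. -/
theorem norm_integral_smul_sub_le {E : Type*} [NormedAddCommGroup E] [NormedSpace ℂ E]
    [CompleteSpace E] {F : G → E} (hF : Continuous F) {U : Set G} {ε : ℝ}
    (hU : ∀ x ∈ U, ‖F x - F 1‖ ≤ ε) {e : G → ℂ} (hec : Continuous e) (hes : HasCompactSupport e)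
    (he0 : ∀ x, x ∉ U → e x = 0) (he1 : (∫ x, ‖e x‖ ∂(Measure.haar : Measure G)) = 1)
    (he2 : ∫ x, e x ∂(Measure.haar : Measure G) = 1) :
    ‖(∫ x, e x • F x ∂(Measure.haar : Measure G)) - F 1‖ ≤ ε := by
  have h1 : F 1 = ∫ x, e x • F 1 ∂(Measure.haar : Measure G) := by
    rw [integral_smul_const, he2, one_smul]
  have hi : Integrable e (Measure.haar : Measure G) := hec.integrable_of_hasCompactSupport hes
  have hi2 : Integrable (fun x => e x • F x) (Measure.haar : Measure G) :=
    (hec.smul hF).integrable_of_hasCompactSupport hes.smul_right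
  refine (congrArg (fun y => ‖(∫ x, e x • F x ∂(Measure.haar : Measure G)) - y‖) h1).le.trans ?_
  rw [← integral_sub hi2 (hi.smul_const _)]
  calc _ ≤ ∫ x, ‖e x • F x - e x • F 1‖ ∂(Measure.haar : Measure G) :=
        norm_integral_le_integral_norm _
    _ ≤ ∫ x, ‖e x‖ * ε ∂(Measure.haar : Measure G) := by
        refine integral_mono (hi2.sub (hi.smul_const _)).norm (hi.norm.mul_const _) fun x => ?_
        simp only [← smul_sub, norm_smul]
        by_cases hx : x ∈ U
        · exact mul_le_mul_of_nonneg_left (hU x hx) (norm_nonneg _)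
        · simp [he0 x hx]
    _ = ε := by rw [integral_mul_const, he1, one_mul]

/-- The product of `star f` with a bump `e` lies in the closure, by the multiplier property for the
identity map. It tends to `star f`, because `star e * f` is an average of translates close to `f`.
The involution on `C_c(G)` need not be computed. -/
theorem star_universalImage_mem (f : C_c(G, ℂ)) : star (universalImage f) ∈ ccClosure G := by
  refine (isClosed_ccClosure.mem_iff_infDist_zero ⟨0, zero_mem _⟩).2 ?_
  refine le_antisymm (le_of_forall_pos_le_add fun ε hε => ?_) Metric.infDist_nonneg
  let F : G → OperatorFamily G := fun h => universalImage (translateCc h⁻¹ f)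
  have hF : Continuous F := (continuous_universalImage_translateCc f).comp continuous_inv
  have hF1 : F 1 = universalImage f := by
    change universalImage _ = _
    congr 1
    ext x
    simp [translateCc_apply]
  have hU : {x | ‖F x - F 1‖ ≤ ε} ∈ 𝓝 (1 : G) := by
    have : Tendsto (fun x => ‖F x - F 1‖) (𝓝 1) (𝓝 0) := by
      rw [← tendsto_iff_norm_sub_tendsto_zero]; exact hF.tendsto 1
    exact this.eventually_le_const hε
  obtain ⟨e, he0, he1, he2⟩ := exists_bump hU
  have key := norm_integral_smul_sub_le hF (U := {x | ‖F x - F 1‖ ≤ ε}) (fun x hx => hx)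
    (continuous_star.comp e.continuous)
    (e.hasCompactSupport.comp_left (g := star) (star_zero ℂ)) (fun x hx => by simp [he0 x hx])
    (by simpa using he1) (by
      have := congrArg (starRingEnd ℂ) he2
      rw [← integral_conj] at this
      simpa using this)
  have hcont : Continuous (MonoidHom.id G) := continuous_id
  have h3 := restrictFamily_star_universalImage_mul (MonoidHom.id G) hcont e f
  have h4 : (star (universalImage e)) * universalImage f
      = ∫ x, star (e x) • F x ∂(Measure.haar : Measure G) := h3
  have h5 : star (universalImage f) * universalImage e ∈ ccClosure G := by
    have := restrictFamily_mul_mem (MonoidHom.id G) hcont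
      (star_mem (GroupCStar.ofCc f).2) (universalImage_mem_ccClosure e)
    exact this
  refine (Metric.infDist_le_dist_of_mem h5).trans ?_
  rw [zero_add, dist_eq_norm, ← norm_star, star_sub, star_star, star_mul, star_star, h4,
    ← hF1, norm_sub_rev]
  exact key

theorem star_mem_ccClosure {a : OperatorFamily G} (ha : a ∈ ccClosure G) :
    star a ∈ ccClosure G :=
  ccClosure_induction (p := fun a => star a ∈ ccClosure G)
    (isClosed_ccClosure.preimage continuous_star) star_universalImage_mem ha

/-- The closed span of `C_c(G)` is already a *-algebra: products are handled by
`restrictFamily_mul_mem` for the identity map, adjoints by `star_mem_ccClosure`. -/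
theorem mem_ccClosure {a : OperatorFamily G} (ha : a ∈ groupCStarSubalgebra G) :
    a ∈ ccClosure G := by
  refine isClosed_ccClosure.closure_subset_iff.2 ?_ ha
  intro a ha
  refine NonUnitalStarAlgebra.adjoin_induction ℂ (p := fun a _ => a ∈ ccClosure G)
    ?_ ?_ ?_ ?_ ?_ ?_ ha
  · rintro _ ⟨f, rfl⟩
    exact universalImage_mem_ccClosure f
  · exact fun _ _ _ _ => add_mem
  · exact zero_mem _
  · intro a b _ _ ha hb
    exact restrictFamily_mul_mem (MonoidHom.id G) continuous_id (ccClosure_le_groupCStar ha) hb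
  · exact fun c _ _ h => Submodule.smul_mem _ c h
  · exact fun _ _ => star_mem_ccClosure

/-- `C_c(G)` is dense in `C*(G)`. -/
theorem denseRange_ofCc : DenseRange (GroupCStar.ofCc : C_c(G, ℂ) → GroupCStar G) := by
  intro a
  refine closure_subtype.2 (closure_mono ?_ (mem_ccClosure a.2))
  rintro _ ⟨f, rfl⟩
  exact ⟨GroupCStar.ofCc f, ⟨f, rfl⟩, rfl⟩

end Density

/-! ### The factorization bound for the restriction of `λ_G · ρ_G` to `H`. -/

section MinimalNormRestriction

open Filter Topology

variable {G : Type u} [Group G] [TopologicalSpace G] [IsTopologicalGroup G]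
  [LocallyCompactSpace G] [MeasurableSpace G] [BorelSpace G]
variable {H : Type u} [Group H] [TopologicalSpace H] [IsTopologicalGroup H]
  [LocallyCompactSpace H] [MeasurableSpace H] [BorelSpace H]
variable (ι : H →* G) (hι : Continuous ι)

/-- The map `C*(H) → C*(G)`, `a ↦ a · e`, for `e ∈ C_c(G)`. -/
def smoothing (e : C_c(G, ℂ)) : GroupCStar H →ₗ[ℂ] GroupCStar G where
  toFun a := ⟨restrictFamily ι hι a.1 * universalImage e, ccClosure_le_groupCStar
    (restrictFamily_mul_mem ι hι a.2 (universalImage_mem_ccClosure e))⟩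
  map_add' a b := Subtype.ext <| (congrArg (· * universalImage e)
    (map_add (restrictFamily ι hι) a.1 b.1)).trans (add_mul _ _ _)
  map_smul' c a := Subtype.ext <| (congrArg (· * universalImage e)
    (map_smul (restrictFamily ι hι) c a.1)).trans (smul_mul_assoc _ _ _)

theorem extend_smoothing (π : UnitaryRep G) (e : C_c(G, ℂ)) (a : GroupCStar H) :
    π.extend (smoothing ι hι e a) = ((π.restrict ι hι).extend a).comp (π.integrated e) := rfl

/-- In the representation `π ⊗ σ`, smoothing both legs amounts to composing with `π(e) ⊗ σ(e)` on
the right. -/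
theorem tensorRepNorm_map_smoothing_le (π σ : UnitaryRep G) (e : C_c(G, ℂ))
    (x : GroupCStar H ⊗[ℂ] GroupCStar H) :
    tensorRepNorm π.extend σ.extend
        (TensorProduct.map (smoothing ι hι e) (smoothing ι hι e) x)
      ≤ tensorRepNorm (π.restrict ι hι).extend (σ.restrict ι hι).extend x
        * (‖π.integrated e‖ * ‖σ.integrated e‖) := by
  have key : tensorRep π.extend σ.extend
        (TensorProduct.map (smoothing ι hι e) (smoothing ι hι e) x)
      = (tensorRep (π.restrict ι hι).extend (σ.restrict ι hι).extend x).comp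
        (TensorProduct.mapL (π.integrated e) (σ.integrated e)) := by
    induction x with
    | zero => rw [map_zero, map_zero, map_zero, ContinuousLinearMap.zero_comp]; rfl
    | tmul a b =>
      rw [TensorProduct.map_tmul, tensorRep_tmul, tensorRep_tmul, extend_smoothing,
        extend_smoothing]
      exact TensorProduct.mapL_comp _ _ _ _
    | add x y hx hy =>
      rw [map_add, map_add, map_add, hx, hy, ContinuousLinearMap.add_comp]; rfl
  rw [tensorRepNorm, key]
  refine (ContinuousLinearMap.opNorm_comp_le _ _).trans
    (mul_le_mul_of_nonneg_left (TensorProduct.norm_mapL_le _ _) ?_)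
  exact norm_nonneg (E := π.H ⊗[ℂ] σ.H →L[ℂ] π.H ⊗[ℂ] σ.H) _

theorem minNorm_nonneg (x : GroupCStar G ⊗[ℂ] GroupCStar G) : 0 ≤ minNorm x :=
  Real.iSup_nonneg fun q =>
    norm_nonneg (E := q.1.H ⊗[ℂ] q.2.H →L[ℂ] q.1.H ⊗[ℂ] q.2.H) _

theorem tensorRepNorm_le_minNorm (π σ : UnitaryRep G) (x : GroupCStar G ⊗[ℂ] GroupCStar G) :
    tensorRepNorm π.extend σ.extend x ≤ minNorm x :=
  le_ciSup (bddAbove_minNorm x) (π, σ)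

/-- `π(e)` and `σ(e)` are contractions, and `(π ∘ ι, σ ∘ ι)` is one of the pairs in the supremum
defining the norm over `H`. -/
theorem minNorm_map_smoothing_le {e : C_c(G, ℂ)}
    (he : (∫ x, ‖e x‖ ∂(Measure.haar : Measure G)) = 1) (x : GroupCStar H ⊗[ℂ] GroupCStar H) :
    minNorm (TensorProduct.map (smoothing ι hι e) (smoothing ι hι e) x) ≤ minNorm x := by
  refine Real.iSup_le (fun q => ?_) (minNorm_nonneg x)
  refine (tensorRepNorm_map_smoothing_le ι hι q.1 q.2 e x).trans ?_
  have h1 := (q.1.norm_integrated_le e).trans he.le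
  have h2 := (q.2.norm_integrated_le e).trans he.le
  calc _ ≤ minNorm x * (1 * 1) := by
        gcongr
        · exact minNorm_nonneg x
        · exact tensorRepNorm_le_minNorm _ _ x
    _ = _ := by ring

variable (G) in
/-- The filter of normalised bump functions with support shrinking to `1`. -/
def bumpFilter : Filter C_c(G, ℂ) :=
  (𝓝 (1 : G)).lift' fun U => {e | (∀ x, x ∉ U → e x = 0) ∧
    (∫ x, ‖e x‖ ∂(Measure.haar : Measure G)) = 1 ∧ ∫ x, e x ∂(Measure.haar : Measure G) = 1}

instance : (bumpFilter G).NeBot := by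
  refine (lift'_neBot_iff ?_).2 fun U hU => exists_bump hU
  intro U V hUV e he
  exact ⟨fun x hx => he.1 x fun h => hx (hUV h), he.2⟩

theorem eventually_bumpFilter {U : Set G} (hU : U ∈ 𝓝 (1 : G)) :
    ∀ᶠ e in bumpFilter G, (∀ x, x ∉ U → e x = 0) ∧
    (∫ x, ‖e x‖ ∂(Measure.haar : Measure G)) = 1 ∧ ∫ x, e x ∂(Measure.haar : Measure G) = 1 :=
  mem_lift' hU

theorem UnitaryRep.tendsto_integrated (π : UnitaryRep G) (ξ : π.H) :
    Tendsto (fun e => π.integrated e ξ) (bumpFilter G) (𝓝 ξ) := by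
  rw [Metric.tendsto_nhds]
  intro ε hε
  have hc := π.continuous_apply ξ
  have hU : {x | ‖π.toHom x ξ - π.toHom 1 ξ‖ ≤ ε / 2} ∈ 𝓝 (1 : G) := by
    have : Tendsto (fun x => ‖π.toHom x ξ - π.toHom 1 ξ‖) (𝓝 1) (𝓝 0) := by
      rw [← tendsto_iff_norm_sub_tendsto_zero]; exact hc.tendsto 1
    exact this.eventually_le_const (half_pos hε)
  filter_upwards [eventually_bumpFilter hU] with e he
  have := norm_integral_smul_sub_le hc (fun x hx => hx) e.continuous e.hasCompactSupport
    he.1 he.2.1 he.2.2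
  rw [dist_eq_norm, π.integrated_apply]
  refine (le_of_eq ?_).trans_lt (this.trans_lt (half_lt_self hε))
  simp

/-- The linear map `a ⊗ b ↦ λ_G(a) ρ_G(b)` on `C*(H) ⊙ C*(H)`, for `ι : H → G`. -/
def leftRightRestrict : GroupCStar H ⊗[ℂ] GroupCStar H →ₗ[ℂ]
    (Lp ℂ 2 (Measure.haar : Measure G) →L[ℂ] Lp ℂ 2 (Measure.haar : Measure G)) :=
  productMap (H := Lp ℂ 2 (Measure.haar : Measure G)) ((leftRegular G).restrict ι hι).extend
    ((rightRegular G).restrict ι hι).extend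

/-- The smoothed product is `λ(a)λ(e)ρ(b)ρ(e)`. Both `λ(e)` and `ρ(e)` tend strongly to the
identity, and `λ(e)` stays contractive, so the product converges strongly. -/
theorem tendsto_leftRight_smoothing (x : GroupCStar H ⊗[ℂ] GroupCStar H)
    (η : Lp ℂ 2 (Measure.haar : Measure G)) :
    Tendsto (fun e => leftRight G
      (TensorProduct.map (smoothing ι hι e) (smoothing ι hι e) x) η) (bumpFilter G)
      (𝓝 (leftRightRestrict ι hι x η)) := by
  induction x with
  | zero => simp
  | add x y hx hy => simpa using hx.add hy
  | tmul a b =>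
    let π := leftRegular G
    let σ := rightRegular G
    let A : π.H →L[ℂ] π.H := (π.restrict ι hι).extend a
    let B : π.H →L[ℂ] π.H := (σ.restrict ι hι).extend b
    have h1 : Tendsto (fun e => A (π.integrated e (B (σ.integrated e η)))) (bumpFilter G)
        (𝓝 (A (B η))) := by
      refine (A.continuous.tendsto _).comp ?_
      have h2 := (B.continuous.tendsto _).comp (σ.tendsto_integrated η)
      have h3 := π.tendsto_integrated (B η)
      rw [tendsto_iff_norm_sub_tendsto_zero] at h2 h3 ⊢
      refine squeeze_zero' (.of_forall fun _ => norm_nonneg _) ?_ (by simpa using h2.add h3)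
      filter_upwards [eventually_bumpFilter (univ_mem (f := 𝓝 (1 : G)))] with e he
      have h4 : ‖π.integrated e‖ ≤ 1 := (π.norm_integrated_le e).trans he.2.1.le
      -- Contractivity of `π(e)` controls the first term, its strong convergence at the fixed vector
      -- `B η` the second.
      have h5 : π.integrated e (B (σ.integrated e η)) - B η
          = π.integrated e (B (σ.integrated e η) - B η) + (π.integrated e (B η) - B η) := by
        rw [map_sub]; abel
      rw [h5]
      refine (norm_add_le _ _).trans (add_le_add ?_ le_rfl)
      exact ((π.integrated e).le_opNorm _).trans
        (mul_le_of_le_one_left (norm_nonneg _) h4)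
    exact h1

/-- A uniform norm bound passes to strong limits. -/
theorem norm_leftRightRestrict_le {C : ℝ} (hC : 0 ≤ C)
    (hF : ∀ x : GroupCStar G ⊗[ℂ] GroupCStar G, ‖leftRight G x‖ ≤ C * minNorm x)
    (x : GroupCStar H ⊗[ℂ] GroupCStar H) : ‖leftRightRestrict ι hι x‖ ≤ C * minNorm x := by
  refine ContinuousLinearMap.opNorm_le_bound _ (mul_nonneg hC (minNorm_nonneg x)) fun η => ?_
  refine le_of_tendsto (tendsto_leftRight_smoothing ι hι x η).norm ?_
  filter_upwards [eventually_bumpFilter (univ_mem (f := 𝓝 (1 : G)))] with e he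
  refine (ContinuousLinearMap.le_opNorm _ _).trans ?_
  gcongr
  exact (hF _).trans (mul_le_mul_of_nonneg_left (minNorm_map_smoothing_le ι hι he.2.1 x) hC)

end MinimalNormRestriction

/-! ### Weak containment from approximation of coefficients. -/

section WeakContainment

open Filter Topology

variable {H : Type u} [Group H] [TopologicalSpace H] [IsTopologicalGroup H]
  [LocallyCompactSpace H] [MeasurableSpace H] [BorelSpace H]

theorem UnitaryRep.inner_integrated (π : UnitaryRep H) (a : C_c(H, ℂ)) (ζ ξ : π.H) :
    inner ℂ ζ (π.integrated a ξ)
      = ∫ s, a s * inner ℂ ζ (π.toHom s ξ) ∂(Measure.haar : Measure H) := by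
  rw [π.integrated_apply, ← integral_inner (𝕜 := ℂ) (π.integrable_smul a ξ) ζ]
  simp only [inner_smul_right]

theorem UnitaryRep.norm_inner_integrated_sub_le (π σ : UnitaryRep H) (a : C_c(H, ℂ)) {ζ ξ : π.H}
    {ζ' ξ' : σ.H} {ε : ℝ}
    (h : ∀ s, a s ≠ 0 → ‖inner ℂ ζ (π.toHom s ξ) - inner ℂ ζ' (σ.toHom s ξ')‖ ≤ ε) :
    ‖inner ℂ ζ (π.integrated a ξ) - inner ℂ ζ' (σ.integrated a ξ')‖
      ≤ ε * ∫ s, ‖a s‖ ∂(Measure.haar : Measure H) := by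
  have hi : ∀ (π : UnitaryRep H) (ζ ξ : π.H), Integrable
      (fun s => a s * inner ℂ ζ (π.toHom s ξ)) (Measure.haar : Measure H) := fun π ζ ξ =>
    (a.continuous.mul (continuous_const.inner (π.continuous_apply ξ))
      ).integrable_of_hasCompactSupport a.hasCompactSupport.mul_right
  rw [π.inner_integrated, σ.inner_integrated, ← integral_sub (hi π ζ ξ) (hi σ ζ' ξ'),
    ← integral_const_mul]
  refine (norm_integral_le_integral_norm _).trans
    (integral_mono ((hi π ζ ξ).sub (hi σ ζ' ξ')).norm
    ((a.continuous.integrable_of_hasCompactSupport a.hasCompactSupport).norm.const_mul _) ?_)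
  intro s
  simp only [← mul_sub, norm_mul]
  by_cases hs : a s = 0
  · simp [hs]
  · rw [mul_comm]
    exact mul_le_mul_of_nonneg_right (h s hs) (norm_nonneg _)

/-- A pair of commuting unitary representations of `H` on a Hilbert space. -/
structure RepPair (H : Type u) [Group H] [TopologicalSpace H] : Type (u + 1) where
  /-- the Hilbert space -/
  X : Type u
  [instNACG : NormedAddCommGroup X]
  [instIPS : InnerProductSpace ℂ X]
  [instComplete : CompleteSpace X]
  /-- the first representation -/
  left : H →* (X ≃ₗᵢ[ℂ] X)
  /-- the second representation -/
  right : H →* (X ≃ₗᵢ[ℂ] X)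
  continuous_left : ∀ ξ : X, Continuous fun s => left s ξ
  continuous_right : ∀ ξ : X, Continuous fun s => right s ξ
  commutes : ∀ s t ξ, left s (right t ξ) = right t (left s ξ)

attribute [instance] RepPair.instNACG RepPair.instIPS RepPair.instComplete

namespace RepPair

/-- The first representation of the pair. -/
def leftRep (P : RepPair H) : UnitaryRep H := ⟨P.X, P.left, P.continuous_left⟩

/-- The second representation of the pair. -/
def rightRep (P : RepPair H) : UnitaryRep H := ⟨P.X, P.right, P.continuous_right⟩

/-- The operator `left(a) right(b)`. -/
def op (P : RepPair H) (a b : C_c(H, ℂ)) : P.X →L[ℂ] P.X :=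
  (P.leftRep.integrated a : P.X →L[ℂ] P.X).comp (P.rightRep.integrated b : P.X →L[ℂ] P.X)

variable (P Q : RepPair H)

/-- The estimate for one representation is used twice: for `left(a)` at fixed `t`, and then, with
`left(a)` moved across by its adjoint, for `right(b)`. -/
theorem norm_inner_op_sub_le (a b : C_c(H, ℂ)) {z η : P.X} {z' η' : Q.X} {ε : ℝ}
    (h : ∀ s t, a s ≠ 0 → b t ≠ 0 →
      ‖inner ℂ z (P.left s (P.right t η)) - inner ℂ z' (Q.left s (Q.right t η'))‖ ≤ ε) :
    ‖inner ℂ z (P.op a b η) - inner ℂ z' (Q.op a b η')‖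
      ≤ ε * ((∫ s, ‖a s‖ ∂(Measure.haar : Measure H))
        * ∫ s, ‖b s‖ ∂(Measure.haar : Measure H)) := by
  let A : P.X →L[ℂ] P.X := P.leftRep.integrated a
  let A' : Q.X →L[ℂ] Q.X := Q.leftRep.integrated a
  have h1 : ∀ t, b t ≠ 0 → ‖inner ℂ (A.adjoint z) (P.right t η)
      - inner ℂ (A'.adjoint z') (Q.right t η')‖ ≤ ε * ∫ s, ‖a s‖ ∂(Measure.haar : Measure H) := by
    intro t ht
    rw [ContinuousLinearMap.adjoint_inner_left, ContinuousLinearMap.adjoint_inner_left]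
    exact UnitaryRep.norm_inner_integrated_sub_le P.leftRep Q.leftRep a
      (ξ := P.right t η) (ξ' := Q.right t η') fun s hs => h s t hs ht
  have h2 := UnitaryRep.norm_inner_integrated_sub_le P.rightRep Q.rightRep b
    (ζ := A.adjoint z) (ζ' := A'.adjoint z') h1
  rw [← mul_assoc]
  refine le_of_eq_of_le ?_ h2
  congr 2
  · exact (ContinuousLinearMap.adjoint_inner_left A _ z).symm
  · exact (ContinuousLinearMap.adjoint_inner_left A' _ z').symm

/-- Commutation and unitarity reduce the inner product of two translates of `η` to a single
coefficient. -/
theorem inner_left_right (s t s' t' : H) (η : P.X) :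
    inner ℂ (P.left s' (P.right t' η)) (P.left s (P.right t η))
      = inner ℂ η (P.left (s'⁻¹ * s) (P.right (t'⁻¹ * t) η)) := by
  have hl : ∀ x y ξ, P.left x (P.left y ξ) = P.left (x * y) ξ := fun x y ξ => by
    rw [map_mul]; rfl
  have hr : ∀ x y ξ, P.right x (P.right y ξ) = P.right (x * y) ξ := fun x y ξ => by
    rw [map_mul]; rfl
  have e : P.left s (P.right t η)
      = P.left s' (P.right t' (P.left (s'⁻¹ * s) (P.right (t'⁻¹ * t) η))) := by
    rw [← P.commutes, hl, hr, mul_inv_cancel_left, mul_inv_cancel_left]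
  rw [e, LinearIsometryEquiv.inner_map_map, LinearIsometryEquiv.inner_map_map]

/-- The squared norm of the left side is a combination of integrals of the coefficient at `η` over
quotients of support points. A vector `η'` with nearly the same coefficient therefore gives nearly
the same squared norm, and the operator bound for `Q` transfers as `δ → 0`. -/
theorem norm_sum_op_le {n : Type*} [Fintype n] (a b : n → C_c(H, ℂ)) (η : P.X)
    (h : ∀ K : Set H, IsCompact K → ∀ δ : ℝ, 0 < δ → ∃ η' : Q.X, ∀ s ∈ K, ∀ t ∈ K,
      ‖inner ℂ η (P.left s (P.right t η)) - inner ℂ η' (Q.left s (Q.right t η'))‖ ≤ δ) :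
    ‖(∑ i, P.op (a i) (b i)) η‖ ≤ ‖∑ i, Q.op (a i) (b i)‖ * ‖η‖ := by
  rw [sum_apply]
  set T := ‖∑ i, Q.op (a i) (b i)‖ with hT
  let I : C_c(H, ℂ) → ℝ := fun a => ∫ s, ‖a s‖ ∂(Measure.haar : Measure H)
  have hI : ∀ a, 0 ≤ I a := fun a => integral_nonneg fun _ => norm_nonneg _
  let C : ℝ := ∑ i, ∑ j, (I (a i) * I (b i)) * (I (a j) * I (b j))
  let K₀ : Set H := ⋃ i, (tsupport (a i) ∪ tsupport (b i))
  have hK₀ : IsCompact K₀ :=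
    isCompact_iUnion fun i => (a i).hasCompactSupport.isCompact.union (b i).hasCompactSupport
  -- Quotients of support points; the point `1` serves to compare `‖η'‖` with `‖η‖`.
  let K : Set H := (fun p : H × H => p.1⁻¹ * p.2) '' (K₀ ×ˢ K₀) ∪ {1}
  have hK : IsCompact K := ((hK₀.prod hK₀).image (by fun_prop)).union isCompact_singleton
  have key : ∀ δ : ℝ, 0 < δ → ‖∑ i, P.op (a i) (b i) η‖ ^ 2 ≤ T ^ 2 * (‖η‖ ^ 2 + δ) + δ * C := by
    intro δ hδ
    obtain ⟨η', hη'⟩ := h K hK δ hδ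
    have ha : ∀ i s, a i s ≠ 0 → s ∈ K₀ := fun i s hs =>
      Set.mem_iUnion.2 ⟨i, Or.inl (subset_tsupport _ hs)⟩
    have hb : ∀ i s, b i s ≠ 0 → s ∈ K₀ := fun i s hs =>
      Set.mem_iUnion.2 ⟨i, Or.inr (subset_tsupport _ hs)⟩
    have hKm : ∀ s ∈ K₀, ∀ t ∈ K₀, s⁻¹ * t ∈ K := fun s hs t ht =>
      Or.inl ⟨(s, t), ⟨hs, ht⟩, rfl⟩
    have h1 : ∀ i j, ‖inner ℂ (P.op (a i) (b i) η) (P.op (a j) (b j) η)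
        - inner ℂ (Q.op (a i) (b i) η') (Q.op (a j) (b j) η')‖
        ≤ δ * ((I (a j) * I (b j)) * (I (a i) * I (b i))) := by
      intro i j
      -- Conjugation swaps the arguments, so that each operator in turn stands on the right, where
      -- `norm_inner_op_sub_le` applies.
      rw [← inner_conj_symm, ← inner_conj_symm (𝕜 := ℂ) (Q.op (a i) (b i) η'), ← map_sub,
        RCLike.norm_conj, ← mul_assoc]
      refine norm_inner_op_sub_le P Q (a i) (b i) fun s t hs ht => ?_
      rw [← inner_conj_symm, ← inner_conj_symm (𝕜 := ℂ) (Q.op (a j) (b j) η'), ← map_sub,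
        RCLike.norm_conj]
      refine norm_inner_op_sub_le P Q (a j) (b j) fun s' t' hs' ht' => ?_
      rw [inner_left_right, inner_left_right]
      exact hη' _ (hKm _ (ha i s hs) _ (ha j s' hs')) _ (hKm _ (hb i t ht) _ (hb j t' ht'))
    have h2 : ‖inner ℂ (∑ i, P.op (a i) (b i) η) (∑ i, P.op (a i) (b i) η)
        - inner ℂ (∑ i, Q.op (a i) (b i) η') (∑ i, Q.op (a i) (b i) η')‖ ≤ δ * C := by
      simp only [sum_inner, inner_sum]
      rw [← Finset.sum_sub_distrib, Finset.mul_sum]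
      refine norm_sum_le_of_le _ fun i _ => ?_
      rw [← Finset.sum_sub_distrib, Finset.mul_sum]
      exact norm_sum_le_of_le _ fun j _ => h1 j i
    have h3 : ‖inner ℂ η η - inner ℂ η' η'‖ ≤ δ := by
      simpa using hη' 1 (Or.inr rfl) 1 (Or.inr rfl)
    have conv : ∀ (x : P.X) (y : Q.X) (r : ℝ), ‖inner ℂ x x - inner ℂ y y‖ ≤ r →
        |‖x‖ ^ 2 - ‖y‖ ^ 2| ≤ r := by
      intro x y r hr
      rw [inner_self_eq_norm_sq_to_K, inner_self_eq_norm_sq_to_K] at hr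
      rw [← Real.norm_eq_abs, ← Complex.norm_real]
      push_cast
      exact hr
    have h4 := abs_le.1 (conv _ _ _ h2)
    have h5 := abs_le.1 (conv _ _ _ h3)
    have h6 : ‖∑ i, Q.op (a i) (b i) η'‖ ≤ T * ‖η'‖ := by
      have := (∑ i, Q.op (a i) (b i)).le_opNorm η'
      rwa [sum_apply] at this
    have h7 : ‖∑ i, Q.op (a i) (b i) η'‖ ^ 2 ≤ T ^ 2 * ‖η'‖ ^ 2 := by
      rw [← mul_pow]; gcongr
    have h8 : T ^ 2 * ‖η'‖ ^ 2 ≤ T ^ 2 * (‖η‖ ^ 2 + δ) := by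
      gcongr; linarith [h5.1]
    linarith [h4.2]
  have hlim : Tendsto (fun δ : ℝ => T ^ 2 * (‖η‖ ^ 2 + δ) + δ * C) (𝓝[>] 0)
      (𝓝 (T ^ 2 * (‖η‖ ^ 2 + 0) + 0 * C)) :=
    ((by fun_prop : Continuous fun δ : ℝ => T ^ 2 * (‖η‖ ^ 2 + δ) + δ * C).tendsto 0).mono_left
      nhdsWithin_le_nhds
  have hfin := ge_of_tendsto hlim (eventually_mem_nhdsWithin.mono key)
  rw [add_zero, zero_mul, add_zero, ← mul_pow] at hfin
  exact abs_le_of_sq_le_sq' hfin (by positivity) |>.2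

end RepPair

end WeakContainment

/-! ### Reduction to coefficients of the regular representations. -/

section RegularPairs

open Filter Topology

variable {G : Type u} [Group G] [TopologicalSpace G] [IsTopologicalGroup G]
  [LocallyCompactSpace G] [MeasurableSpace G] [BorelSpace G]
variable {H : Type u} [Group H] [TopologicalSpace H] [IsTopologicalGroup H]
  [LocallyCompactSpace H] [MeasurableSpace H] [BorelSpace H]
variable (ι : H →* G) (hι : Continuous ι)

/-- The left and right regular representations of `G`, pulled back to `H`. -/
def regularPair : RepPair H where
  X := Lp ℂ 2 (Measure.haar : Measure G)
  left := ((biTranslate 2).comp (MonoidHom.inl G G)).comp ι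
  right := ((biTranslate 2).comp (MonoidHom.inr G G)).comp ι
  continuous_left := ((leftRegular G).restrict ι hι).continuous_apply
  continuous_right := ((rightRegular G).restrict ι hι).continuous_apply
  commutes s t ξ := by
    change biTranslate 2 (ι s, 1) (biTranslate 2 (1, ι t) ξ)
      = biTranslate 2 (1, ι t) (biTranslate 2 (ι s, 1) ξ)
    have h : ∀ p q : G × G, biTranslate (G := G) 2 p (biTranslate 2 q ξ)
      = biTranslate 2 (p * q) ξ := fun p q => by rw [map_mul]; rfl
    rw [h, h]
    simp

theorem dense_toLp_Cc :
    Dense {ξ : Lp ℂ 2 (Measure.haar : Measure H) | ∃ f : C_c(H, ℂ), (f : H → ℂ) =ᵐ[Measure.haar] ξ} := by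
  intro ξ
  rw [Metric.mem_closure_iff]
  intro ε hε
  obtain ⟨g, hg, g_cont, g_mem, g_supp⟩ := exists_continuous_approx 2 ENNReal.ofNat_ne_top
    (Lp.memLp ξ) (ε := ENNReal.ofReal (ε / 2)) (by simpa using hε)
  refine ⟨g_mem.toLp g, ⟨⟨⟨g, g_cont⟩, g_supp⟩, g_mem.coeFn_toLp.symm⟩, ?_⟩
  rw [Lp.dist_def]
  have : eLpNorm (⇑ξ - ⇑(g_mem.toLp g)) 2 (Measure.haar : Measure H) ≤ ENNReal.ofReal (ε / 2) := by
    refine le_trans (le_of_eq ?_) hg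
    exact eLpNorm_congr_ae (Filter.EventuallyEq.rfl.sub g_mem.coeFn_toLp)
  refine lt_of_le_of_lt (ENNReal.toReal_mono ENNReal.ofReal_ne_top this) ?_
  rw [ENNReal.toReal_ofReal (by positivity)]
  linarith

/-- If the coefficients of `λ_H ρ_H` at a dense set of vectors are limits, uniformly on compact
sets, of coefficients of the restriction of `λ_G ρ_G`, then `λ_H ρ_H` is weakly contained in that
restriction. -/
theorem norm_sum_regularPair_op_le
    (h : ∀ (f : C_c(H, ℂ)) (η : Lp ℂ 2 (Measure.haar : Measure H)), (f : H → ℂ) =ᵐ[Measure.haar] η →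
      ∀ K : Set H, IsCompact K → ∀ δ : ℝ, 0 < δ → ∃ η' : Lp ℂ 2 (Measure.haar : Measure G),
      ∀ s ∈ K, ∀ t ∈ K, ‖inner ℂ η (biTranslate 2 (s, t) η)
        - inner ℂ η' (biTranslate 2 (ι s, ι t) η')‖ ≤ δ)
    {n : Type*} [Fintype n] (a b : n → C_c(H, ℂ)) :
    ‖∑ i, (regularPair (MonoidHom.id H) continuous_id).op (a i) (b i)‖
      ≤ ‖∑ i, (regularPair ι hι).op (a i) (b i)‖ := by
  let P : RepPair H := regularPair (MonoidHom.id H) continuous_id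
  let Q : RepPair H := regularPair ι hι
  change ‖∑ i, P.op (a i) (b i)‖ ≤ ‖∑ i, Q.op (a i) (b i)‖
  have hcl : IsClosed {η : P.X | ‖(∑ i, P.op (a i) (b i)) η‖
      ≤ ‖∑ i, Q.op (a i) (b i)‖ * ‖η‖} :=
    isClosed_le (∑ i, P.op (a i) (b i)).continuous.norm (continuous_norm.const_mul _)
  refine ContinuousLinearMap.opNorm_le_bound _ (norm_nonneg _) fun η => ?_
  refine (dense_toLp_Cc (H := H)).induction (P := fun η => ‖(∑ i, P.op (a i) (b i)) η‖
      ≤ ‖∑ i, Q.op (a i) (b i)‖ * ‖η‖) ?_ hcl η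
  rintro η ⟨f, hf⟩
  refine RepPair.norm_sum_op_le P Q a b η fun K hK δ hδ => ?_
  obtain ⟨η', hη'⟩ := h f η hf K hK δ hδ
  refine ⟨η', fun s hs t ht => ?_⟩
  have hP : P.left s (P.right t η) = biTranslate 2 (s, t) η := by
    change biTranslate 2 (s, 1) (biTranslate 2 (1, t) η) = _
    have : ((s, t) : H × H) = (s, 1) * (1, t) := by simp
    rw [this, map_mul]; rfl
  have hQ : Q.left s (Q.right t η') = biTranslate 2 (ι s, ι t) η' := by
    change biTranslate 2 (ι s, 1) (biTranslate 2 (1, ι t) η') = _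
    have : ((ι s, ι t) : G × G) = (ι s, 1) * (1, ι t) := by simp
    rw [this, map_mul]; rfl
  rw [hP, hQ]
  exact hη' s hs t ht

theorem UnitaryRep.continuous_extend (π : UnitaryRep H) : Continuous π.extend :=
  AddMonoidHomClass.continuous_of_bound π.extend 1 fun a => by simpa using π.norm_extend_le a

/-- The operator `left(a) right(b)`, for `a, b` in `C*(H)`. -/
def RepPair.opExtend (P : RepPair H) (c : GroupCStar H × GroupCStar H) : P.X →L[ℂ] P.X :=
  (P.leftRep.extend c.1 : P.X →L[ℂ] P.X).comp (P.rightRep.extend c.2 : P.X →L[ℂ] P.X)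

theorem RepPair.continuous_opExtend (P : RepPair H) : Continuous P.opExtend :=
  (P.leftRep.continuous_extend.comp continuous_fst).clm_comp
    (P.rightRep.continuous_extend.comp continuous_snd)

/-- Both sides are norm continuous in the entries, and `C_c(H)` is dense in `C*(H)`. -/
theorem RepPair.norm_sum_opExtend_le (P Q : RepPair H) {n : Type*} [Fintype n]
    (h : ∀ a b : n → C_c(H, ℂ), ‖∑ i, P.op (a i) (b i)‖ ≤ ‖∑ i, Q.op (a i) (b i)‖)
    (c : n → GroupCStar H × GroupCStar H) :
    ‖∑ i, P.opExtend (c i)‖ ≤ ‖∑ i, Q.opExtend (c i)‖ := by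
  have hdense : DenseRange (Pi.map fun _ : n => Prod.map (GroupCStar.ofCc (G := H))
      (GroupCStar.ofCc (G := H))) :=
    DenseRange.piMap fun _ => denseRange_ofCc.prodMap denseRange_ofCc
  refine hdense.induction_on (p := fun c => ‖∑ i, P.opExtend (c i)‖ ≤ ‖∑ i, Q.opExtend (c i)‖)
    c ?_ fun c => h (fun i => (c i).1) (fun i => (c i).2)
  exact isClosed_le
    (continuous_norm.comp (continuous_finsetSum _ fun i _ =>
      P.continuous_opExtend.comp (continuous_apply i)))
    (continuous_norm.comp (continuous_finsetSum _ fun i _ =>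
      Q.continuous_opExtend.comp (continuous_apply i)))

theorem leftRightRestrict_tmul (a b : GroupCStar H) : leftRightRestrict ι hι (a ⊗ₜ b)
    = (regularPair ι hι).opExtend (a, b) := rfl

theorem leftRight_tmul (a b : GroupCStar H) : leftRight H (a ⊗ₜ b)
    = (regularPair (MonoidHom.id H) continuous_id).opExtend (a, b) := rfl

theorem norm_leftRight_le_leftRightRestrict
    (h : ∀ (f : C_c(H, ℂ)) (η : Lp ℂ 2 (Measure.haar : Measure H)), (f : H → ℂ) =ᵐ[Measure.haar] η →
      ∀ K : Set H, IsCompact K → ∀ δ : ℝ, 0 < δ → ∃ η' : Lp ℂ 2 (Measure.haar : Measure G),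
      ∀ s ∈ K, ∀ t ∈ K, ‖inner ℂ η (biTranslate 2 (s, t) η)
        - inner ℂ η' (biTranslate 2 (ι s, ι t) η')‖ ≤ δ)
    (x : GroupCStar H ⊗[ℂ] GroupCStar H) : ‖leftRight H x‖ ≤ ‖leftRightRestrict ι hι x‖ := by
  obtain ⟨S, rfl⟩ := TensorProduct.exists_finset x
  rw [map_sum, map_sum, ← Finset.sum_coe_sort S, ← Finset.sum_coe_sort S]
  simp only [leftRightRestrict_tmul, leftRight_tmul]
  exact RepPair.norm_sum_opExtend_le _ _ (norm_sum_regularPair_op_le ι hι h) fun i : S => i.1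

end RegularPairs

/-! ### Almost conjugation-invariant densities in QSIN groups. -/

section QuasiCentral

open Filter Topology

variable {G : Type u} [Group G] [TopologicalSpace G] [IsTopologicalGroup G]
  [LocallyCompactSpace G] [MeasurableSpace G] [BorelSpace G]

theorem integral_bimul {E : Type*} [NormedAddCommGroup E] [NormedSpace ℝ E] (F : G → E) (s t : G) :
    ∫ x, F (s⁻¹ * x * t) ∂(Measure.haar : Measure G)
      = (modularFn t : ℝ)⁻¹ • ∫ x, F x ∂(Measure.haar : Measure G) := by
  let φ : G ≃ₜ G := (Homeomorph.mulLeft s⁻¹).trans (Homeomorph.mulRight t)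
  have h := φ.measurableEmbedding.integral_map (μ := (Measure.haar : Measure G)) F
  have h2 : (φ : G → G) = fun x => s⁻¹ * x * t := rfl
  rw [h2, map_bimul_haar, integral_smul_nnreal_measure] at h
  rw [← h, NNReal.smul_def, NNReal.coe_inv]

/-- A neighbourhood of `1` all of whose conjugates by a compact set are in a given neighbourhood. -/
theorem eventually_conj_mem {K : Set G} (hK : IsCompact K) {U : Set G} (hU : U ∈ 𝓝 (1 : G)) :
    ∀ᶠ x in 𝓝 (1 : G), ∀ s ∈ K, s⁻¹ * x * s ∈ U := by
  refine hK.eventually_forall_of_forall_eventually fun s _ => ?_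
  have hc : Continuous fun z : G × G => z.2⁻¹ * z.1 * z.2 := by fun_prop
  exact hc.tendsto (1, s) (by simpa using hU)

/-- A cut-off function that is `1` near `1` and has support in a given neighbourhood of `1`. -/
theorem exists_cutoff {U : Set G} (hU : U ∈ 𝓝 (1 : G)) :
    ∃ f : G → ℝ, Continuous f ∧ HasCompactSupport f ∧ (∀ x, 0 ≤ f x) ∧ (∀ x, f x ≤ 1) ∧
      (∀ x, x ∉ U → f x = 0) ∧ ∀ᶠ x in 𝓝 (1 : G), f x = 1 := by
  obtain ⟨K, hK1, hKU, hK⟩ := local_compact_nhds hU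
  obtain ⟨f, hf1, hf0, hfs, hf01⟩ := exists_continuous_one_zero_of_isCompact
    (isCompact_singleton (x := (1 : G))) (isOpen_interior (s := K)).isClosed_compl
    (by simpa using mem_interior_iff_mem_nhds.2 hK1)
  -- Truncating `2f` at `1` spreads the value `1` from the identity to a neighbourhood.
  refine ⟨fun x => min 1 (2 * f x), by fun_prop,
    hfs.comp_left (g := fun r : ℝ => min 1 (2 * r)) (by simp), fun x => ?_, fun x => min_le_left _ _,
    fun x hx => ?_, ?_⟩
  · exact le_min zero_le_one (mul_nonneg zero_le_two (hf01 x).1)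
  · have : f x = 0 := hf0 fun h => hx (hKU (interior_subset h))
    simp [this]
  · have h1 : f 1 = 1 := hf1 rfl
    have : ∀ᶠ x in 𝓝 (1 : G), 1 / 2 < f x :=
      f.continuous.continuousAt.eventually_const_lt (by rw [h1]; norm_num)
    filter_upwards [this] with x hx
    exact min_eq_left (by linarith)

/-- A sum of `n` nested cut-off functions varies by at most `1` under conjugation. -/
theorem exists_sum_cutoff {K : Set G} (hK : IsCompact K) (n : ℕ) {U : Set G} (hU : U ∈ 𝓝 (1 : G)) :
    ∃ f : G → ℝ, Continuous f ∧ HasCompactSupport f ∧ (∀ x, 0 ≤ f x) ∧ (∀ x, f x ≤ n) ∧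
      (∀ x, x ∉ U → f x = 0) ∧ (∀ᶠ x in 𝓝 (1 : G), f x = n) ∧
      ∀ s ∈ K, ∀ x, |f (s⁻¹ * x * s) - f x| ≤ 1 := by
  induction n generalizing U with
  | zero => exact ⟨fun _ => 0, continuous_const, HasCompactSupport.zero, by simp, by simp, by simp,
      by simp, by simp⟩
  | succ n ih =>
    obtain ⟨f, hfc, hfs, hf0, hf1, hfU, hfe⟩ := exists_cutoff hU
    -- The remaining layers `g` live where all these conjugates lie in `{f = 1}`, so that `f` and
    -- `g` never both contribute to a difference. `K⁻¹` leads back from `s⁻¹xs` to `x`, and `1`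
    -- covers `x` itself.
    have hK' : IsCompact (K ∪ K⁻¹ ∪ {1}) := (hK.union hK.inv).union isCompact_singleton
    obtain ⟨g, hgc, hgs, hg0, hg1, hgU, hge, hgK⟩ := ih (eventually_conj_mem hK' hfe)
    have hone : ∀ x, (∀ s ∈ K ∪ K⁻¹ ∪ {1}, f (s⁻¹ * x * s) = 1) → f x = 1 := fun x hx => by
      simpa using hx 1 (Or.inr rfl)
    refine ⟨fun x => f x + g x, hfc.add hgc, hfs.add hgs, fun x => add_nonneg (hf0 x) (hg0 x),
      fun x => ?_, fun x hx => ?_, ?_, fun s hs x => ?_⟩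
    · push_cast; linarith [hf1 x, hg1 x]
    · change f x + g x = 0
      rw [hfU x hx, hgU x, add_zero]
      intro h
      have h1 := hone x h
      rw [hfU x hx] at h1
      exact zero_ne_one h1
    · filter_upwards [hfe, hge] with x h1 h2
      rw [h1, h2]; push_cast; ring
    · change |f (s⁻¹ * x * s) + g (s⁻¹ * x * s) - (f x + g x)| ≤ 1
      by_cases hx : ∀ r ∈ K ∪ K⁻¹ ∪ {1}, f (r⁻¹ * x * r) = 1
      · rw [hone x hx, hx s (Or.inl (Or.inl hs)), add_sub_add_left_eq_sub]
        exact hgK s hs x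
      by_cases hy : ∀ r ∈ K ∪ K⁻¹ ∪ {1}, f (r⁻¹ * (s⁻¹ * x * s) * r) = 1
      · have h1 := hy s⁻¹ (Or.inl (Or.inr (by simpa using hs)))
        have h2 : s⁻¹⁻¹ * (s⁻¹ * x * s) * s⁻¹ = x := by group
        rw [h2] at h1
        rw [hone _ hy, h1, add_sub_add_left_eq_sub]
        exact hgK s hs x
      rw [hgU x hx, hgU _ hy, add_zero, add_zero, abs_le]
      constructor <;> linarith [hf0 x, hf1 x, hf0 (s⁻¹ * x * s), hf1 (s⁻¹ * x * s)]

/-- For large `G` a continuous `F` need not be strongly measurable. The `L¹` factor repairs this: it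
is an a.e. limit of `C_c` functions, and the products with those are integrable. -/
theorem aestronglyMeasurable_smul_of_continuous {E : Type*} [NormedAddCommGroup E]
    [NormedSpace ℂ E] (e : Lp ℂ 1 (Measure.haar : Measure G)) {F : G → E} (hF : Continuous F) :
    AEStronglyMeasurable (fun s => e s • F s) (Measure.haar : Measure G) := by
  have h : ∀ n : ℕ, ∃ g : G → ℂ, eLpNorm (⇑e - g) 1 (Measure.haar : Measure G)
      ≤ ENNReal.ofReal (1 / (n + 1)) ∧
      (Continuous g ∧ MemLp g 1 (Measure.haar : Measure G) ∧ HasCompactSupport g) := fun n =>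
    exists_continuous_approx 1 ENNReal.one_ne_top (Lp.memLp e)
      (by rw [Ne, ENNReal.ofReal_eq_zero, not_le]; positivity)
  choose g hg hgc hgm hgs using h
  have hlim : Tendsto (fun n => eLpNorm (g n - ⇑e) 1 (Measure.haar : Measure G)) atTop (𝓝 0) := by
    have h0 : Tendsto (fun n : ℕ => ENNReal.ofReal (1 / ((n : ℝ) + 1))) atTop (𝓝 0) := by
      rw [← ENNReal.ofReal_zero]
      exact ENNReal.tendsto_ofReal tendsto_one_div_add_atTop_nhds_zero_nat
    refine tendsto_of_tendsto_of_tendsto_of_le_of_le tendsto_const_nhds h0 (fun _ => zero_le) ?_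
    intro n
    change eLpNorm (g n - ⇑e) 1 (Measure.haar : Measure G) ≤ _
    rw [eLpNorm_sub_comm]
    exact hg n
  obtain ⟨ns, -, hns⟩ := (tendstoInMeasure_of_tendsto_eLpNorm one_ne_zero
    (fun n => (hgm n).aestronglyMeasurable) (Lp.aestronglyMeasurable e) hlim).exists_seq_tendsto_ae
  refine aestronglyMeasurable_of_tendsto_ae atTop (f := fun n s => g (ns n) s • F s) (fun n => ?_) ?_
  · exact (((hgc _).smul hF).integrable_of_hasCompactSupport
      (hgs _).smul_right).aestronglyMeasurable
  · filter_upwards [hns] with s hs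
    exact hs.smul_const _

/-- Pairing with a bounded continuous function, as a functional on `L¹(G)`. -/
theorem exists_pairing {g : G → ℝ} (hgc : Continuous g) {B : ℝ} (hg : ∀ x, |g x| ≤ B) :
    ∃ ℓ : Lp ℂ 1 (Measure.haar : Measure G) →L[ℂ] ℂ,
      ∀ F, ℓ F = ∫ x, F x * g x ∂(Measure.haar : Measure G) := by
  have hB : 0 ≤ B := (abs_nonneg _).trans (hg 1)
  have hm : ∀ F : Lp ℂ 1 (Measure.haar : Measure G),
      Integrable (fun x => F x * (g x : ℂ)) (Measure.haar : Measure G) := fun F => by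
    refine ((L1.integrable_coeFn F).norm.mul_const B).mono' ?_ (.of_forall fun x => ?_)
    · exact aestronglyMeasurable_smul_of_continuous F
        (Complex.continuous_ofReal.comp hgc)
    · rw [norm_mul, Complex.norm_real]
      exact mul_le_mul_of_nonneg_left (hg x) (norm_nonneg _)
  refine ⟨LinearMap.mkContinuous
    { toFun := fun F => ∫ x, F x * g x ∂(Measure.haar : Measure G)
      map_add' := fun F F' => ?_
      map_smul' := fun c F => ?_ } B fun F => ?_, fun F => rfl⟩
  · rw [← integral_add (hm F) (hm F')]
    refine integral_congr_ae ?_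
    filter_upwards [Lp.coeFn_add F F'] with x hx
    rw [hx, Pi.add_apply, add_mul]
  · rw [RingHom.id_apply, ← integral_smul]
    refine integral_congr_ae ?_
    filter_upwards [Lp.coeFn_smul c F] with x hx
    rw [hx, Pi.smul_apply, smul_mul_assoc]
  · rw [L1.norm_eq_integral_norm, mul_comm, ← integral_mul_const]
    refine norm_integral_le_of_norm_le ((L1.integrable_coeFn F).norm.mul_const B)
      (.of_forall fun x => ?_)
    rw [norm_mul, Complex.norm_real]
    exact mul_le_mul_of_nonneg_left (hg x) (norm_nonneg _)

/-- A function whose overlaps with its translates are controlled by a given cut-off function. -/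
theorem exists_overlap {ψ : G → ℝ} (hψ0 : ∀ x, 0 ≤ ψ x) (hψ : ∀ᶠ x in 𝓝 (1 : G), ψ x = 1) :
    ∃ g : G → ℝ, Continuous g ∧ HasCompactSupport g ∧ (∀ x, |g x| ≤ 1) ∧
      0 < ∫ x, g ((1 : G)⁻¹ * x) * g x ∂(Measure.haar : Measure G) ∧
      ∀ s, |∫ x, g (s⁻¹ * x) * g x ∂(Measure.haar : Measure G)|
        ≤ (∫ x, g ((1 : G)⁻¹ * x) * g x ∂(Measure.haar : Measure G)) * ψ s := by
  -- With `g` supported in `W`, its translate by `s` meets it only for `s ∈ W W⁻¹`, where `ψ = 1`.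
  obtain ⟨W, hW1, hW⟩ : ∃ W ∈ 𝓝 (1 : G), ∀ x ∈ W, ∀ y ∈ W, ψ (x * y⁻¹) = 1 := by
    have hc : Tendsto (fun p : G × G => p.1 * p.2⁻¹) (𝓝 (1, 1)) (𝓝 1) := by
      simpa using (by fun_prop : Continuous fun p : G × G => p.1 * p.2⁻¹).tendsto (1, 1)
    have h := hc.eventually hψ
    rw [nhds_prod_eq] at h
    obtain ⟨W, hW1, hW⟩ := mem_prod_same_iff.1 h
    exact ⟨W, hW1, fun x hx y hy => hW (Set.mk_mem_prod hx hy)⟩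
  obtain ⟨g, hgc, hgs, hg0, hg1, hgW, hge⟩ := exists_cutoff hW1
  have hgi : ∀ s : G, Integrable (fun x => g (s⁻¹ * x) * g x) (Measure.haar : Measure G) := by
    intro s
    have h : Continuous fun x => g (s⁻¹ * x) * g x := by fun_prop
    exact h.integrable_of_hasCompactSupport hgs.mul_left
  have hg2 : ∀ s : G, Integrable (fun x => g (s⁻¹ * x) ^ 2) (Measure.haar : Measure G) := by
    intro s
    have h : Continuous fun x => g x ^ 2 := by fun_prop
    have h2 : HasCompactSupport fun x => g x ^ 2 :=
      hgs.comp_left (g := fun r : ℝ => r ^ 2) (by simp)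
    exact (h.integrable_of_hasCompactSupport h2).comp_mul_left s⁻¹
  obtain ⟨φ, hφ⟩ : ∃ φ : G → ℝ, ∀ s, φ s = ∫ x, g (s⁻¹ * x) * g x ∂(Measure.haar : Measure G) :=
    ⟨_, fun _ => rfl⟩
  have hφ1 : 0 < φ 1 := by
    have h1 : g 1 = 1 := hge.self_of_nhds
    rw [hφ]
    refine Continuous.integral_pos_of_hasCompactSupport_nonneg_nonzero (x := 1)
      (by fun_prop) hgs.mul_left (fun x => mul_nonneg (hg0 _) (hg0 _)) ?_
    simp [h1]
  have hφle : ∀ s, |φ s| ≤ φ 1 * ψ s := by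
    intro s
    rw [abs_of_nonneg (hφ s ▸ integral_nonneg fun x => mul_nonneg (hg0 _) (hg0 _))]
    by_cases hs : ψ s = 1
    · rw [hs, mul_one]
      -- Prepares `ab ≤ (a² + b²)/2`; both squares have integral `φ 1` by left invariance.
      have h1 : φ 1 = ∫ x, (1 / 2) * (g (s⁻¹ * x) ^ 2 + g (1⁻¹ * x) ^ 2)
          ∂(Measure.haar : Measure G) := by
        rw [integral_const_mul, integral_add (hg2 s) (hg2 1),
          integral_mul_left_eq_self (fun x => g x ^ 2) s⁻¹,
          integral_mul_left_eq_self (fun x => g x ^ 2) 1⁻¹]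
        simp only [hφ, inv_one, one_mul, ← sq]
        ring
      rw [h1, hφ]
      refine integral_mono (hgi s) (((hg2 s).add (hg2 1)).const_mul _) fun x => ?_
      simp only [inv_one, one_mul]
      nlinarith [sq_nonneg (g (s⁻¹ * x) - g x)]
    · have : φ s = 0 := by
        rw [hφ]
        refine integral_eq_zero_of_ae (.of_forall fun x => ?_)
        by_contra hne
        have h1 : s⁻¹ * x ∈ W := by
          by_contra h; exact hne (by simp [hgW _ h])
        have h2 : x ∈ W := by
          by_contra h; exact hne (by simp [hgW _ h])
        have := hW _ h2 _ h1
        rw [mul_inv_rev, inv_inv, mul_inv_cancel_left] at this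
        exact hs this
      rw [this]
      exact mul_nonneg hφ1.le (hψ0 s)
  simp only [hφ] at hφ1 hφle
  exact ⟨g, hgc, hgs, fun x => abs_le.2 ⟨by linarith [hg0 x], hg1 x⟩, hφ1, hφle⟩

/-- A left approximate identity has asymptotically mass at least `1` near `1`. -/
theorem eventually_mass_near_one {A : Type*} {l : Filter A}
    {e : A → Lp ℂ 1 (Measure.haar : Measure G)}
    (he : ∀ f : Lp ℂ 1 (Measure.haar : Measure G), Tendsto (fun α => convL1 (e α) f) l (𝓝 f))
    {ψ : G → ℝ} (hψc : Continuous ψ) (hψ0 : ∀ x, 0 ≤ ψ x) (hψ1 : ∀ x, ψ x ≤ 1)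
    (hψ : ∀ᶠ x in 𝓝 (1 : G), ψ x = 1) {δ : ℝ} (hδ : 0 < δ) :
    ∀ᶠ α in l, 1 - δ ≤ ∫ x, ‖e α x‖ * ψ x ∂(Measure.haar : Measure G) := by
  obtain ⟨g, hgc, hgs, hg1, hφ1, hφle⟩ := exists_overlap hψ0 hψ
  set φ : G → ℝ := fun s => ∫ x, g (s⁻¹ * x) * g x ∂(Measure.haar : Measure G) with hφ
  change 0 < φ 1 at hφ1
  replace hφle : ∀ s, |φ s| ≤ φ 1 * ψ s := hφle
  have hgC : Continuous fun x => (g x : ℂ) := Complex.continuous_ofReal.comp hgc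
  have hgm : MemLp (fun x => (g x : ℂ)) 1 (Measure.haar : Measure G) :=
    hgC.memLp_of_hasCompactSupport (hgs.comp_left (g := fun r : ℝ => (r : ℂ)) (by simp))
  let f : Lp ℂ 1 (Measure.haar : Measure G) := hgm.toLp _
  -- Pairing `e * f` with `g` gives `∫ e(s) φ(s) ds`. Since this tends to `φ(1)` and `|φ| ≤ φ(1) ψ`,
  -- the mass of `|e|` against `ψ` is eventually at least `1 - δ`.
  obtain ⟨ℓ, hℓ⟩ := exists_pairing hgc hg1
  have hℓs : ∀ s, ℓ (biTranslate 1 (s, 1) f) = φ s := by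
    intro s
    rw [hℓ, ← integral_complex_ofReal]
    refine integral_congr_ae ?_
    filter_upwards [coeFn_biTranslate 1 s 1 f,
      (quasiMeasurePreserving_bimul s 1).ae hgm.coeFn_toLp] with x h1 h2
    rw [h1, h2]
    simp [modularFn_one]
  have hℓ1 : ℓ f = φ 1 := by
    rw [← hℓs 1]
    have : (1, 1) = (1 : G × G) := rfl
    rw [this, map_one]; rfl
  have hconv : ∀ α, ‖ℓ (convL1 (e α) f)‖
      ≤ φ 1 * ∫ x, ‖e α x‖ * ψ x ∂(Measure.haar : Measure G) := by
    intro α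
    have hFc : Continuous fun s : G => biTranslate 1 (s, 1) f :=
      (continuous_biTranslate 1 f).comp (by fun_prop : Continuous fun s : G => (s, (1 : G)))
    have hint : Integrable (fun s => e α s • biTranslate 1 (s, 1) f)
        (Measure.haar : Measure G) := by
      refine ((L1.integrable_coeFn (e α)).norm.mul_const ‖f‖).mono'
        (aestronglyMeasurable_smul_of_continuous _ hFc) (.of_forall fun s => ?_)
      rw [norm_smul, LinearIsometryEquiv.norm_map]
    have hψi : Integrable (fun x => ‖e α x‖ * ψ x) (Measure.haar : Measure G) := by
      refine ((L1.integrable_coeFn (e α)).norm).mono' ?_ (.of_forall fun s => ?_)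
      · have := (aestronglyMeasurable_smul_of_continuous (e α)
          (Complex.continuous_ofReal.comp hψc)).norm
        refine this.congr (.of_forall fun x => ?_)
        simp [abs_of_nonneg (hψ0 x)]
      · rw [norm_mul, norm_norm, Real.norm_of_nonneg (hψ0 s)]
        exact mul_le_of_le_one_right (norm_nonneg _) (hψ1 s)
    rw [convL1, ← ℓ.integral_comp_comm hint, ← integral_const_mul]
    refine norm_integral_le_of_norm_le (hψi.const_mul _) (.of_forall fun s => ?_)
    rw [map_smul, hℓs, norm_smul, Complex.norm_real]
    calc ‖e α s‖ * |φ s| ≤ ‖e α s‖ * (φ 1 * ψ s) := by gcongr; exact hφle s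
      _ = _ := by ring
  have hlim := ((ℓ.continuous.tendsto f).comp (he f)).norm
  rw [hℓ1, Complex.norm_real, Real.norm_of_nonneg hφ1.le] at hlim
  have hlt : φ 1 * (1 - δ) < φ 1 := by nlinarith
  filter_upwards [hlim.eventually_const_lt hlt] with α hα
  exact le_of_mul_le_mul_left (hα.le.trans (hconv α)) hφ1

theorem norm_sub_toLp_le {p : ℝ≥0∞} (F : Lp ℂ p (Measure.haar : Measure G)) {g : G → ℂ}
    (hg : MemLp g p (Measure.haar : Measure G)) {δ : ℝ} (hδ : 0 ≤ δ)
    (h : eLpNorm (⇑F - g) p (Measure.haar : Measure G) ≤ ENNReal.ofReal δ) :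
    ‖F - hg.toLp g‖ ≤ δ := by
  have h1 : F - hg.toLp g = ((Lp.memLp F).sub hg).toLp (⇑F - g) := by
    rw [MemLp.toLp_sub (Lp.memLp F) hg, Lp.toLp_coeFn]
  rw [h1, Lp.norm_toLp]
  exact ENNReal.toReal_le_of_le_ofReal hδ h

theorem norm_toLp_one {g : G → ℂ} (hg : MemLp g 1 (Measure.haar : Measure G)) :
    ‖hg.toLp g‖ = ∫ x, ‖g x‖ ∂(Measure.haar : Measure G) := by
  rw [L1.norm_eq_integral_norm]
  refine integral_congr_ae ?_
  filter_upwards [hg.coeFn_toLp] with x hx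
  rw [hx]

theorem norm_conjL1_toLp_sub {g : G → ℂ} (hg : MemLp g 1 (Measure.haar : Measure G)) (s : G) :
    ‖conjL1 s (hg.toLp g) - hg.toLp g‖
      = ∫ x, ‖(modularFn s : ℂ) * g (s⁻¹ * x * s) - g x‖ ∂(Measure.haar : Measure G) := by
  rw [L1.norm_eq_integral_norm]
  refine integral_congr_ae ?_
  filter_upwards [hg.coeFn_toLp, coeFn_conjL1 s (hg.toLp g),
    (quasiMeasurePreserving_bimul s s).ae hg.coeFn_toLp,
    Lp.coeFn_sub (conjL1 s (hg.toLp g)) (hg.toLp g)] with x h1 h2 h3 h4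
  rw [h4, Pi.sub_apply, h2, h1, h3]

/-- A product rule: the change of `|g| ψ` splits into the change of `ψ`, at most `r`, against the
mass of `g`, and the change of `|g|` against `ψ ≤ 1`. -/
theorem integral_abs_conj_mul_sub_le {g : G → ℂ} (hgc : Continuous g) (hgs : HasCompactSupport g)
    {ψ : G → ℝ} (hψ0 : ∀ x, 0 ≤ ψ x) (hψ1 : ∀ x, ψ x ≤ 1) {s : G} {r : ℝ}
    (hψ : ∀ x, |ψ (s⁻¹ * x * s) - ψ x| ≤ r) :
    ∫ x, |modularFn s * (‖g (s⁻¹ * x * s)‖ * ψ (s⁻¹ * x * s)) - ‖g x‖ * ψ x|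
        ∂(Measure.haar : Measure G)
      ≤ r * (∫ x, ‖g x‖ ∂(Measure.haar : Measure G))
        + ∫ x, ‖(modularFn s : ℂ) * g (s⁻¹ * x * s) - g x‖ ∂(Measure.haar : Measure G) := by
  have hs : HasCompactSupport fun x => g (s⁻¹ * x * s) :=
    hgs.comp_homeomorph ((Homeomorph.mulLeft s⁻¹).trans (Homeomorph.mulRight s))
  have hint : Integrable (fun x => modularFn s * ‖g (s⁻¹ * x * s)‖) (Measure.haar : Measure G) := by
    have hc : Continuous fun x => (modularFn s : ℝ) * ‖g (s⁻¹ * x * s)‖ := by fun_prop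
    exact hc.integrable_of_hasCompactSupport hs.norm.mul_left
  have hint2 : Integrable (fun x => ‖(modularFn s : ℂ) * g (s⁻¹ * x * s) - g x‖)
      (Measure.haar : Measure G) := by
    have hc : Continuous fun x => (modularFn s : ℂ) * g (s⁻¹ * x * s) - g x := by fun_prop
    exact (hc.integrable_of_hasCompactSupport (hs.mul_left.sub hgs)).norm
  have h1 : ∫ x, ‖g x‖ ∂(Measure.haar : Measure G)
      = ∫ x, modularFn s * ‖g (s⁻¹ * x * s)‖ ∂(Measure.haar : Measure G) := by
    rw [integral_const_mul, integral_bimul (fun x => ‖g x‖), smul_eq_mul, mul_inv_cancel_left₀]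
    exact_mod_cast (modularFn_pos s).ne'
  rw [h1, ← integral_const_mul, ← integral_add (hint.const_mul r) hint2]
  refine integral_mono_of_nonneg (.of_forall fun x => abs_nonneg _)
    ((hint.const_mul r).add hint2) (.of_forall fun x => ?_)
  simp only
  set y := s⁻¹ * x * s
  have e1 : (modularFn s : ℝ) * (‖g y‖ * ψ y) - ‖g x‖ * ψ x
      = (ψ y - ψ x) * (modularFn s * ‖g y‖) + ψ x * (‖(modularFn s : ℂ) * g y‖ - ‖g x‖) := by
    rw [norm_mul, Complex.norm_real, Real.norm_of_nonneg (NNReal.coe_nonneg _)]; ring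
  rw [e1]
  refine (abs_add_le _ _).trans (add_le_add ?_ ?_)
  · rw [abs_mul, abs_of_nonneg (mul_nonneg (NNReal.coe_nonneg _) (norm_nonneg (g y)))]
    gcongr
    exact hψ x
  · rw [abs_mul, abs_of_nonneg (hψ0 x)]
    exact (mul_le_of_le_one_left (abs_nonneg _) (hψ1 x)).trans (abs_norm_sub_norm_le _ _)

/-- In a QSIN group there are normalised functions in `C_c(G)` with support in any given
neighbourhood of `1` that are almost invariant under conjugation by elements of a compact set. -/
theorem IsQSIN.exists_quasicentral (hG : IsQSIN G) {K : Set G} (hK : IsCompact K) {U : Set G}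
    (hU : U ∈ 𝓝 (1 : G)) {ε : ℝ} (hε : 0 < ε) :
    ∃ v : G → ℝ, Continuous v ∧ HasCompactSupport v ∧ (∀ x, 0 ≤ v x) ∧ (∀ x, x ∉ U → v x = 0) ∧
      ∫ x, v x ∂(Measure.haar : Measure G) = 1 ∧
      ∀ s ∈ K, ∫ x, |modularFn s * v (s⁻¹ * x * s) - v x| ∂(Measure.haar : Measure G) < ε := by
  obtain ⟨A, _, _, _, e, ⟨M, hM⟩, hai, hqc⟩ := hG
  -- The budget is `(M + 1)/n + 3δ ≤ ε/4`, to be divided by a mass of at least `1 - 2δ ≥ 1/2`.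
  obtain ⟨δ, hδ0, hδε, hδ4⟩ : ∃ δ : ℝ, 0 < δ ∧ δ ≤ ε / 16 ∧ δ ≤ 1 / 4 :=
    ⟨min (ε / 16) (1 / 4), by positivity, min_le_left _ _, min_le_right _ _⟩
  obtain ⟨n, hn0, hn⟩ : ∃ n : ℕ, 0 < (n : ℝ) ∧ (M + 1) / n ≤ ε / 16 := by
    obtain ⟨n, hn⟩ := exists_nat_gt (max 0 ((M + 1) / (ε / 16)))
    have h0 : 0 < (n : ℝ) := (le_max_left _ _).trans_lt hn
    refine ⟨n, h0, ?_⟩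
    rw [div_le_iff₀ h0, mul_comm, ← div_le_iff₀ (by positivity)]
    exact (le_max_right _ _).trans hn.le
  obtain ⟨Ψ, hΨc, hΨs, hΨ0, hΨ1, hΨU, hΨe, hΨK⟩ := exists_sum_cutoff hK n hU
  -- Averaging `n` nested cut-offs brings the variation under conjugation down to `1/n`.
  set ψ : G → ℝ := fun x => Ψ x / n with hψ
  have hψc : Continuous ψ := hΨc.div_const _
  have hψ0 : ∀ x, 0 ≤ ψ x := fun x => div_nonneg (hΨ0 x) hn0.le
  have hψ1 : ∀ x, ψ x ≤ 1 := fun x => (div_le_one hn0).2 (hΨ1 x)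
  have hψe : ∀ᶠ x in 𝓝 (1 : G), ψ x = 1 := by
    filter_upwards [hΨe] with x hx
    rw [hψ]; simp only [hx, div_self hn0.ne']
  have hψK : ∀ s ∈ K, ∀ x, |ψ (s⁻¹ * x * s) - ψ x| ≤ 1 / n := fun s hs x => by
    simp only [hψ, ← sub_div, abs_div, abs_of_pos hn0]
    exact div_le_div_of_nonneg_right (hΨK s hs x) hn0.le
  have hmass := eventually_mass_near_one (fun f => (hai f).1) hψc hψ0 hψ1 hψe hδ0
  obtain ⟨α₀, hα₀⟩ := hqc K hK δ hδ0
  obtain ⟨α, hα1, hα2⟩ := (hmass.and (eventually_ge_atTop α₀)).exists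
  replace hα2 := hα₀ α hα2
  -- `e α` is a complex-valued `L¹` class with no control of its support; `g ∈ C_c(G)` replaces it,
  -- and `|g| ψ` is then normalised.
  obtain ⟨g, hg, g_cont, g_mem, g_supp⟩ := exists_continuous_approx 1 ENNReal.one_ne_top
    (Lp.memLp (e α)) (ε := ENNReal.ofReal δ) (by simpa using hδ0)
  have hE : ‖e α - g_mem.toLp g‖ ≤ δ := norm_sub_toLp_le _ g_mem hδ0.le hg
  have hgM : ∫ x, ‖g x‖ ∂(Measure.haar : Measure G) ≤ M + 1 := by
    rw [← norm_toLp_one g_mem]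
    have := norm_le_norm_add_norm_sub' (g_mem.toLp g) (e α)
    rw [norm_sub_rev] at this
    linarith [hM α]
  have hgconj : ∀ s ∈ K, ∫ x, ‖(modularFn s : ℂ) * g (s⁻¹ * x * s) - g x‖
      ∂(Measure.haar : Measure G) ≤ 3 * δ := by
    intro s hs
    rw [← norm_conjL1_toLp_sub g_mem]
    have h1 : conjL1 s (g_mem.toLp g) - g_mem.toLp g
        = biTranslate 1 (s, s) (g_mem.toLp g - e α) + (conjL1 s (e α) - e α)
          + (e α - g_mem.toLp g) := by
      rw [map_sub, conjL1, conjL1]; abel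
    rw [h1]
    refine norm_add₃_le.trans ?_
    rw [LinearIsometryEquiv.norm_map, norm_sub_rev (g_mem.toLp g)]
    linarith [hα2 s hs]
  have hψg : Integrable (fun x => ‖g x‖ * ψ x) (Measure.haar : Measure G) := by
    have hc : Continuous fun x => ‖g x‖ * ψ x := g_cont.norm.mul hψc
    exact hc.integrable_of_hasCompactSupport g_supp.norm.mul_right
  have hI : 1 / 2 ≤ ∫ x, ‖g x‖ * ψ x ∂(Measure.haar : Measure G) := by
    have h1 : ∫ x, ‖e α x‖ * ψ x ∂(Measure.haar : Measure G)
        ≤ ∫ x, ‖g x‖ * ψ x + ‖(e α - g_mem.toLp g) x‖ ∂(Measure.haar : Measure G) := by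
      refine integral_mono_of_nonneg (.of_forall fun x => mul_nonneg (norm_nonneg _) (hψ0 x))
        (hψg.add (L1.integrable_coeFn _).norm) ?_
      filter_upwards [Lp.coeFn_sub (e α) (g_mem.toLp g), g_mem.coeFn_toLp] with x hx hx2
      rw [hx, Pi.sub_apply, hx2]
      nlinarith [hψ0 x, hψ1 x, norm_nonneg (e α x - g x), norm_le_norm_add_norm_sub' (e α x) (g x)]
    rw [integral_add hψg (L1.integrable_coeFn _).norm, ← L1.norm_eq_integral_norm] at h1
    linarith
  set I := ∫ x, ‖g x‖ * ψ x ∂(Measure.haar : Measure G) with hIdef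
  have hIpos : 0 < I := by linarith
  refine ⟨fun x => I⁻¹ * (‖g x‖ * ψ x), (g_cont.norm.mul hψc).const_mul _,
    g_supp.norm.mul_right.mul_left, fun x => mul_nonneg (inv_nonneg.2 hIpos.le)
    (mul_nonneg (norm_nonneg _) (hψ0 x)), fun x hx => ?_, ?_, fun s hs => ?_⟩
  · simp [hψ, hΨU x hx]
  · rw [integral_const_mul, ← hIdef, inv_mul_cancel₀ hIpos.ne']
  · have h1 := (integral_abs_conj_mul_sub_le g_cont g_supp hψ0 hψ1 (hψK s hs)).trans
      (add_le_add (mul_le_mul_of_nonneg_left hgM (by positivity)) (hgconj s hs))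
    have h2 : ∀ x, |modularFn s * (I⁻¹ * (‖g (s⁻¹ * x * s)‖ * ψ (s⁻¹ * x * s)))
        - I⁻¹ * (‖g x‖ * ψ x)| = I⁻¹ * |modularFn s * (‖g (s⁻¹ * x * s)‖ * ψ (s⁻¹ * x * s))
        - ‖g x‖ * ψ x| := fun x => by
      rw [← abs_of_pos (inv_pos.2 hIpos), ← abs_mul, abs_of_pos (inv_pos.2 hIpos)]
      congr 1; ring
    simp only [h2]
    rw [integral_const_mul, inv_mul_lt_iff₀ hIpos]
    refine h1.trans_lt ?_
    have h3 : 1 / (n : ℝ) * (M + 1) = (M + 1) / n := by ring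
    rw [h3]
    nlinarith

end QuasiCentral

/-! ### Fubini for compactly supported functions, and inversion of Haar measure. -/

section FubiniTools

open Filter Topology

/-- Haar measure need not be σ-finite, so integrals are interchanged for jointly continuous
functions of compact support. -/
theorem hasCompactSupport_uncurry {X Y E : Type*} [TopologicalSpace X] [TopologicalSpace Y]
    [R1Space X] [R1Space Y] [Zero E] {F : X → Y → E} {K : Set X} {L : Set Y} (hK : IsCompact K)
    (hL : IsCompact L) (h : ∀ x y, F x y ≠ 0 → x ∈ K ∧ y ∈ L) :
    HasCompactSupport (Function.uncurry F) := by
  refine HasCompactSupport.intro (hK.prod hL) fun p hp => ?_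
  by_contra hne
  exact hp (h p.1 p.2 hne)

variable {H : Type u} [Group H] [TopologicalSpace H] [IsTopologicalGroup H]
  [LocallyCompactSpace H] [MeasurableSpace H] [BorelSpace H]

theorem coe_modularFn_inv (s : H) : (modularFn s⁻¹ : ℝ) = (modularFn s : ℝ)⁻¹ := by
  have h : modularFn s⁻¹ * modularFn s = 1 := by rw [← modularFn_mul]; simp [modularFn_one]
  rw [eq_inv_of_mul_eq_one_left h, NNReal.coe_inv]

theorem coe_modularFn_pos (s : H) : 0 < (modularFn s : ℝ) := modularFn_pos s

theorem continuous_coe_modularFn : Continuous fun s : H => (modularFn s : ℝ) :=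
  NNReal.continuous_coe.comp continuous_modularFn

/-- The behaviour of left Haar measure under inversion. -/
theorem integral_inv_modularFn {φ : H → ℝ} (hφc : Continuous φ) (hφs : HasCompactSupport φ) :
    ∫ k, φ k ∂(Measure.haar : Measure H)
      = ∫ k, φ k⁻¹ * (modularFn k : ℝ)⁻¹ ∂(Measure.haar : Measure H) := by
  -- After multiplication by `∫ ψ > 0` both sides are double integrals of `ψ(h) φ(h⁻¹k)`.
  -- Integrating over `k` first gives the left side; substituting `h ↦ kh` and then integrating over
  -- `k` produces `Δ(h)⁻¹`.
  obtain ⟨ψ, hψc, hψs, hψ0, -, -, hψe⟩ := exists_cutoff (univ_mem (f := 𝓝 (1 : H)))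
  have hψ1 : ψ 1 = 1 := hψe.self_of_nhds
  have hI : 0 < ∫ h, ψ h ∂(Measure.haar : Measure H) :=
    hψc.integral_pos_of_hasCompactSupport_nonneg_nonzero hψs hψ0 (x := 1) (by simp [hψ1])
  refine mul_right_cancel₀ hI.ne' ?_
  have hprod : IsCompact ((fun p : H × H => p.1 * p.2) '' (tsupport ψ ×ˢ tsupport φ)) :=
    (hψs.isCompact.prod hφs.isCompact).image (by fun_prop)
  have hprod2 : IsCompact ((fun p : H × H => p.1⁻¹) '' (tsupport φ ×ˢ tsupport φ)) :=
    (hφs.isCompact.prod hφs.isCompact).image (by fun_prop)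
  calc (∫ k, φ k ∂(Measure.haar : Measure H)) * ∫ h, ψ h ∂(Measure.haar : Measure H)
      = ∫ h, (∫ k, ψ h * φ (h⁻¹ * k) ∂(Measure.haar : Measure H)) ∂(Measure.haar : Measure H) := by
        rw [mul_comm, ← integral_mul_const]
        refine integral_congr_ae (.of_forall fun h => ?_)
        simp only
        rw [integral_const_mul, integral_mul_left_eq_self φ h⁻¹]
    _ = ∫ k, (∫ h, ψ h * φ (h⁻¹ * k) ∂(Measure.haar : Measure H)) ∂(Measure.haar : Measure H) := by
        refine integral_integral_swap_of_hasCompactSupport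
          (f := fun h k => ψ h * φ (h⁻¹ * k)) (by unfold Function.uncurry; fun_prop) ?_
        refine hasCompactSupport_uncurry hψs.isCompact hprod fun h k hne => ?_
        have h1 : h ∈ tsupport ψ := subset_tsupport _ (left_ne_zero_of_mul hne)
        have h2 : h⁻¹ * k ∈ tsupport φ := subset_tsupport _ (right_ne_zero_of_mul hne)
        exact ⟨h1, (h, h⁻¹ * k), ⟨h1, h2⟩, by simp⟩
    _ = ∫ k, (∫ h, ψ (k * h) * φ h⁻¹ ∂(Measure.haar : Measure H)) ∂(Measure.haar : Measure H) := by
        refine integral_congr_ae (.of_forall fun k => ?_)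
        simp only
        rw [← integral_mul_left_eq_self (fun h => ψ h * φ (h⁻¹ * k)) k]
        simp
    _ = ∫ h, (∫ k, ψ (k * h) * φ h⁻¹ ∂(Measure.haar : Measure H)) ∂(Measure.haar : Measure H) := by
        refine integral_integral_swap_of_hasCompactSupport
          (f := fun k h => ψ (k * h) * φ h⁻¹) (by unfold Function.uncurry; fun_prop) ?_
        refine hasCompactSupport_uncurry hprod (hφs.isCompact.inv) fun k h hne => ?_
        have h1 : k * h ∈ tsupport ψ := subset_tsupport _ (left_ne_zero_of_mul hne)
        have h2 : h⁻¹ ∈ tsupport φ := subset_tsupport _ (right_ne_zero_of_mul hne)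
        exact ⟨⟨(k * h, h⁻¹), ⟨h1, h2⟩, by simp⟩, h2⟩
    _ = _ := by
        rw [← integral_mul_const]
        refine integral_congr_ae (.of_forall fun h => ?_)
        simp only
        have h1 := integral_bimul ψ 1 h
        simp only [inv_one, one_mul, smul_eq_mul] at h1
        rw [integral_mul_const, h1]
        ring

/-- The double integral defining a coefficient of a convolution. -/
theorem integral_convolution_coefficient {f g : H → ℂ} (hfc : Continuous f)
    (hfs : HasCompactSupport f) (hgc : Continuous g) (hgs : HasCompactSupport g) {J : H → ℂ}
    (hJ : Continuous J) :
    ∫ k, (∫ h, f k * (g h * J (h⁻¹ * k)) ∂(Measure.haar : Measure H)) ∂(Measure.haar : Measure H)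
      = ∫ k, (∫ h, f (h * k) * g h ∂(Measure.haar : Measure H)) * J k
        ∂(Measure.haar : Measure H) := by
  calc _ = ∫ h, (∫ k, f k * (g h * J (h⁻¹ * k)) ∂(Measure.haar : Measure H))
        ∂(Measure.haar : Measure H) := by
        refine integral_integral_swap_of_hasCompactSupport
          (f := fun k h => f k * (g h * J (h⁻¹ * k))) (by unfold Function.uncurry; fun_prop) ?_
        refine hasCompactSupport_uncurry hfs.isCompact hgs.isCompact fun k h hne => ?_
        exact ⟨subset_tsupport _ (left_ne_zero_of_mul hne),
          subset_tsupport _ (left_ne_zero_of_mul (right_ne_zero_of_mul hne))⟩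
    _ = ∫ h, (∫ k, f (h * k) * (g h * J k) ∂(Measure.haar : Measure H))
        ∂(Measure.haar : Measure H) := by
        refine integral_congr_ae (.of_forall fun h => ?_)
        simp only
        rw [← integral_mul_left_eq_self (fun k => f k * (g h * J (h⁻¹ * k))) h]
        simp
    _ = ∫ k, (∫ h, f (h * k) * (g h * J k) ∂(Measure.haar : Measure H))
        ∂(Measure.haar : Measure H) := by
        have hprod : IsCompact ((fun p : H × H => p.1⁻¹ * p.2) '' (tsupport g ×ˢ tsupport f)) :=
          (hgs.isCompact.prod hfs.isCompact).image (by fun_prop)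
        refine integral_integral_swap_of_hasCompactSupport
          (f := fun h k => f (h * k) * (g h * J k)) (by unfold Function.uncurry; fun_prop) ?_
        refine hasCompactSupport_uncurry hgs.isCompact hprod fun h k hne => ?_
        have h1 : h * k ∈ tsupport f := subset_tsupport _ (left_ne_zero_of_mul hne)
        have h2 : h ∈ tsupport g :=
          subset_tsupport _ (left_ne_zero_of_mul (right_ne_zero_of_mul hne))
        exact ⟨h2, (h, h * k), ⟨h2, h1⟩, by simp⟩
    _ = _ := by
        refine integral_congr_ae (.of_forall fun k => ?_)
        simp only
        rw [← integral_mul_const]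
        simp only [mul_assoc]

end FubiniTools

/-! ### Local averages over `H`-orbits in `G`. -/

section OrbitAverages

open Filter Topology

variable {G : Type u} [Group G] [TopologicalSpace G] [IsTopologicalGroup G]
  [LocallyCompactSpace G] [MeasurableSpace G] [BorelSpace G]
variable {H : Type u} [Group H] [TopologicalSpace H] [IsTopologicalGroup H]
  [LocallyCompactSpace H] [MeasurableSpace H] [BorelSpace H]

/-- The average of `p` over the orbit of `x` under the left action of `H` on `G`, with a weight. -/
def orbitAvg (ι : H →* G) (χ : H → ℝ) (p : G → ℝ) (x : G) : ℝ :=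
  ∫ k, χ k * p ((ι k)⁻¹ * x) ∂(Measure.haar : Measure H)

/-- A weight `χ` on `H` that is `1` on `N`, together with a set `U ⊆ G` so small that the elements
of `H` mapping points of `U` into `U` that matter for `χ`, its translates by `N` and its conjugates
by `T` lie in `N`. -/
structure IsLocalizing (ι : H →* G) (χ : H → ℝ) (T B N : Set H) (U : Set G) : Prop where
  cont : Continuous χ
  compact_support : HasCompactSupport χ
  nonneg : ∀ k, 0 ≤ χ k
  mem_of_ne : ∀ k, χ k ≠ 0 → k ∈ B
  mem_of_translate : ∀ k ∈ N, ∀ h, χ (k⁻¹ * h) ≠ 0 → h ∈ B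
  mem_of_conj : ∀ t ∈ T, ∀ h, χ (t⁻¹ * h * t) ≠ 0 → h ∈ B
  eq_one : ∀ k ∈ N, χ k = 1
  translate_eq_one : ∀ k ∈ N, ∀ h ∈ N, χ (k⁻¹ * h) = 1
  conj_eq_one : ∀ t ∈ T, ∀ h ∈ N, χ (t⁻¹ * h * t) = 1
  inv_mem : ∀ k ∈ N, k⁻¹ ∈ N
  modularFn_le : ∀ k ∈ N, (modularFn k : ℝ) ≤ 2
  mem_of_mul : ∀ k ∈ B, ∀ y ∈ U, ι k * y ∈ U → k ∈ N

theorem continuous_orbitAvg {ι : H →* G} (hι : Continuous ι) {χ : H → ℝ} (hχ : Continuous χ)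
    (hχs : HasCompactSupport χ) {p : G → ℝ} (hp : Continuous p) : Continuous (orbitAvg ι χ p) := by
  rw [← continuousOn_univ]
  refine continuousOn_integral_of_compact_support
    (f := fun x k => χ k * p ((ι k)⁻¹ * x)) hχs.isCompact ?_ ?_
  · unfold Function.uncurry; fun_prop
  · intro x k _ hk
    rw [image_eq_zero_of_notMem_tsupport hk, zero_mul]

theorem orbitAvg_nonneg {ι : H →* G} {χ : H → ℝ} (hχ : ∀ k, 0 ≤ χ k) {p : G → ℝ}
    (hp : ∀ x, 0 ≤ p x) (x : G) : 0 ≤ orbitAvg ι χ p x :=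
  integral_nonneg fun _ => mul_nonneg (hχ _) (hp _)

theorem integrable_orbitAvg {ι : H →* G} (hι : Continuous ι) {χ : H → ℝ} (hχ : Continuous χ)
    (hχs : HasCompactSupport χ) {p : G → ℝ} (hp : Continuous p) (x : G) :
    Integrable (fun k => χ k * p ((ι k)⁻¹ * x)) (Measure.haar : Measure H) :=
  Continuous.integrable_of_hasCompactSupport (by fun_prop) hχs.mul_right

theorem orbitAvg_pos {ι : H →* G} (hι : Continuous ι) {χ : H → ℝ} (hχ : Continuous χ)
    (hχs : HasCompactSupport χ) (hχ0 : ∀ k, 0 ≤ χ k) (hχ1 : χ 1 = 1) {p : G → ℝ}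
    (hp : Continuous p) (hp0 : ∀ x, 0 ≤ p x) {x : G} (hx : p x ≠ 0) : 0 < orbitAvg ι χ p x := by
  have hc : Continuous fun k => χ k * p ((ι k)⁻¹ * x) := by fun_prop
  refine hc.integral_pos_of_hasCompactSupport_nonneg_nonzero (x := 1) hχs.mul_right
    (fun k => mul_nonneg (hχ0 _) (hp0 _)) ?_
  simpa [hχ1] using hx

theorem abs_orbitAvg_sub_le {ι : H →* G} (hι : Continuous ι) {χ : H → ℝ} (hχ : Continuous χ)
    (hχs : HasCompactSupport χ) (hχ0 : ∀ k, 0 ≤ χ k) {p q : G → ℝ} (hp : Continuous p)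
    (hq : Continuous q) (x : G) :
    |orbitAvg ι χ p x - orbitAvg ι χ q x| ≤ orbitAvg ι χ (fun y => |q y - p y|) x := by
  rw [orbitAvg, orbitAvg, ← integral_sub (integrable_orbitAvg hι hχ hχs hp x)
    (integrable_orbitAvg hι hχ hχs hq x)]
  refine (abs_integral_le_integral_abs).trans (le_of_eq ?_)
  refine integral_congr_ae (.of_forall fun k => ?_)
  simp only
  rw [← mul_sub, abs_mul, abs_of_nonneg (hχ0 k), abs_sub_comm]

namespace IsLocalizing

variable {ι : H →* G} {χ : H → ℝ} {T B N : Set H} {U : Set G}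

/-- Only `k` with `ι(k)⁻¹x ∈ U` contribute. Among these, the ones in `B` lie in `N`, where both
weights are `1`; outside `B` both weights vanish. -/
theorem orbitAvg_congr (L : IsLocalizing ι χ T B N U) {χ' : H → ℝ} (hB : ∀ k, χ' k ≠ 0 → k ∈ B)
    (hN : ∀ k ∈ N, χ' k = 1) {p : G → ℝ} (hp : ∀ x, x ∉ U → p x = 0) {x : G} (hx : x ∈ U) :
    orbitAvg ι χ' p x = orbitAvg ι χ p x := by
  refine integral_congr_ae (.of_forall fun k => ?_)
  simp only
  by_cases hpk : (ι k)⁻¹ * x ∈ U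
  · by_cases hk : k ∈ B
    · have := L.mem_of_mul k hk _ hpk (by simpa using hx)
      rw [hN k this, L.eq_one k this]
    · rw [not_imp_comm.1 (hB k) hk, not_imp_comm.1 (L.mem_of_ne k) hk]
  · rw [hp _ hpk, mul_zero, mul_zero]

/-- Moving `x` along its orbit translates the weight, which `orbitAvg_congr` cannot see. -/
theorem orbitAvg_translate (L : IsLocalizing ι χ T B N U) {p : G → ℝ}
    (hp : ∀ x, x ∉ U → p x = 0) {x : G} (hx : x ∈ U) {k : H} (hk : k ∈ N) :
    orbitAvg ι χ p ((ι k)⁻¹ * x) = orbitAvg ι χ p x := by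
  rw [← L.orbitAvg_congr (L.mem_of_translate k hk) (L.translate_eq_one k hk) hp hx, orbitAvg,
    ← integral_mul_left_eq_self _ k⁻¹]
  refine integral_congr_ae (.of_forall fun h => ?_)
  simp [mul_assoc]

/-- Conjugating `x` conjugates the integration variable. The weight change is invisible by
`orbitAvg_congr`, while Haar measure of `H` contributes `Δ_H(t)`. -/
theorem orbitAvg_conj (L : IsLocalizing ι χ T B N U) {p : G → ℝ} {t : H} (ht : t ∈ T)
    (hp : ∀ x, x ∉ U → p ((ι t)⁻¹ * x * ι t) = 0) {x : G} (hx : x ∈ U) :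
    orbitAvg ι χ p ((ι t)⁻¹ * x * ι t)
      = modularFn t * orbitAvg ι χ (fun y => p ((ι t)⁻¹ * y * ι t)) x := by
  rw [← L.orbitAvg_congr (L.mem_of_conj t ht) (L.conj_eq_one t ht) hp hx]
  have h := integral_bimul (fun h => χ h * p ((ι h)⁻¹ * ((ι t)⁻¹ * x * ι t))) t t
  rw [smul_eq_mul, eq_inv_mul_iff_mul_eq₀ (coe_modularFn_pos t).ne'] at h
  rw [orbitAvg, orbitAvg, ← h]
  congr 1
  refine integral_congr_ae (.of_forall fun h => ?_)
  simp [mul_assoc]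

end IsLocalizing

end OrbitAverages

/-! ### Orbit normalisation and the overlap with conjugates. -/

section OverlapEstimate

open Filter Topology

variable {G : Type u} [Group G] [TopologicalSpace G] [IsTopologicalGroup G]
  [LocallyCompactSpace G] [MeasurableSpace G] [BorelSpace G]
variable {H : Type u} [Group H] [TopologicalSpace H] [IsTopologicalGroup H]
  [LocallyCompactSpace H] [MeasurableSpace H] [BorelSpace H]

/-- The conjugate `τ₁(s)v(x) = Δ(s) v(s⁻¹xs)` of a function. -/
def conjFn (s : G) (v : G → ℝ) (x : G) : ℝ := modularFn s * v (s⁻¹ * x * s)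

/-- The regularised mass of `v` on the orbit of `x`. -/
def orbitWeight (ι : H →* G) (χ : H → ℝ) (v : G → ℝ) (κ : ℝ) (x : G) : ℝ := orbitAvg ι χ v x + κ

/-- The function `v`, rescaled on each orbit by the square root of its mass there. -/
def orbitNormalize (ι : H →* G) (χ : H → ℝ) (v : G → ℝ) (κ : ℝ) (x : G) : ℝ :=
  v x / √(orbitWeight ι χ v κ x)

/-- The ratio `Δ_G(ι t) / Δ_H(t)`. -/
def modularRatio (ι : H →* G) (t : H) : ℝ := (modularFn (ι t) : ℝ) / modularFn t

theorem modularRatio_pos (ι : H →* G) (t : H) : 0 < modularRatio ι t :=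
  div_pos (coe_modularFn_pos _) (coe_modularFn_pos _)

theorem continuous_modularRatio {ι : H →* G} (hι : Continuous ι) :
    Continuous (modularRatio ι) :=
  (continuous_coe_modularFn.comp hι).div continuous_coe_modularFn
    fun t => (coe_modularFn_pos t).ne'

theorem continuous_conjFn {v : G → ℝ} (hv : Continuous v) (s : G) : Continuous (conjFn s v) := by
  unfold conjFn; fun_prop

theorem hasCompactSupport_conjFn {v : G → ℝ} (hv : HasCompactSupport v) (s : G) :
    HasCompactSupport (conjFn s v) :=
  (hv.comp_homeomorph ((Homeomorph.mulLeft s⁻¹).trans (Homeomorph.mulRight s))).mul_left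

theorem integral_conjFn (v : G → ℝ) (s : G) :
    ∫ x, conjFn s v x ∂(Measure.haar : Measure G) = ∫ x, v x ∂(Measure.haar : Measure G) := by
  unfold conjFn
  rw [integral_const_mul, integral_bimul v, smul_eq_mul,
    mul_inv_cancel_left₀ (coe_modularFn_pos s).ne']

/-- With `W = w + κ`, the difference equals `(√W - √W')/√W' - κ/(√W √W')`. The second term is
bounded by `κ ≤ √κ √W`, the first by `|√W - √W'| √W' ≤ |W - W'|`. -/
theorem abs_div_sqrt_mul_sqrt_sub_one_le {w κ W' : ℝ} (hw : 0 ≤ w) (hκ : 0 < κ) (hW' : 0 < W') :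
    |w / √(w + κ) / √W' - 1| ≤ √(κ / W') + |w + κ - W'| / W' := by
  set W := w + κ with hWdef
  have hW : 0 < W := by positivity
  have hκW : κ ≤ W := by linarith
  have ha : 0 < √W := Real.sqrt_pos.2 hW
  have hb : 0 < √W' := Real.sqrt_pos.2 hW'
  have ea : √W ^ 2 = W := Real.sq_sqrt hW.le
  have eb : √W' ^ 2 = W' := Real.sq_sqrt hW'.le
  have e1 : w / √W / √W' - 1 = (√W - √W') / √W' - κ / (√W * √W') := by
    have : w = √W ^ 2 - κ := by rw [ea]; ring
    rw [this]; field_simp; ring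
  rw [e1]
  refine (abs_sub _ _).trans ?_
  rw [add_comm]
  refine add_le_add ?_ ?_
  · rw [abs_of_nonneg (by positivity), Real.sqrt_div' _ hW'.le, ← div_div]
    refine div_le_div_of_nonneg_right ?_ hb.le
    rw [div_le_iff₀ ha]
    calc κ = √κ * √κ := (Real.mul_self_sqrt hκ.le).symm
      _ ≤ √κ * √W := by gcongr
  · rw [abs_div, abs_of_pos hb, div_le_div_iff₀ hb hW']
    have e2 : W - W' = (√W - √W') * (√W + √W') := by nlinarith
    rw [e2, abs_mul, abs_of_pos (add_pos ha hb)]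
    have : |√W - √W'| * W' = |√W - √W'| * √W' * √W' := by rw [mul_assoc, ← sq, eb]
    rw [this]
    have h0 := abs_nonneg (√W - √W')
    refine mul_le_mul_of_nonneg_right ?_ hb.le
    exact mul_le_mul_of_nonneg_left (by linarith) h0

namespace IsLocalizing

variable {ι : H →* G} (hι : Continuous ι) {χ : H → ℝ} {T B N : Set H} {U : Set G}
  (L : IsLocalizing ι χ T B N U) {v : G → ℝ} (hvc : Continuous v) (hvs : HasCompactSupport v)
  (hv0 : ∀ x, 0 ≤ v x) (hvU : ∀ x, x ∉ U → v x = 0) {t : H} (ht : t ∈ T)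
  (hvt : ∀ x, x ∉ U → v ((ι t)⁻¹ * x * ι t) = 0) {κ : ℝ} (hκ : 0 < κ)

include L in
theorem conjFn_eq_zero (hvt : ∀ x, x ∉ U → v ((ι t)⁻¹ * x * ι t) = 0) {x : G} (hx : x ∉ U) :
    conjFn (ι t) v x = 0 := by
  rw [conjFn, hvt x hx, mul_zero]

include L hv0 hκ in
theorem orbitWeight_pos (x : G) : 0 < orbitWeight ι χ v κ x :=
  add_pos_of_nonneg_of_pos (orbitAvg_nonneg L.nonneg hv0 x) hκ

include hι L hvc in
theorem continuous_orbitWeight : Continuous (orbitWeight ι χ v κ) :=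
  (continuous_orbitAvg hι L.cont L.compact_support hvc).add continuous_const

include hι L hvc hv0 hκ in
theorem continuous_orbitNormalize : Continuous (orbitNormalize ι χ v κ) :=
  hvc.div (L.continuous_orbitWeight hι hvc).sqrt
    fun x => (Real.sqrt_pos.2 (L.orbitWeight_pos hv0 hκ x)).ne'

include hvs in
theorem hasCompactSupport_orbitNormalize : HasCompactSupport (orbitNormalize ι χ v κ) := by
  refine hvs.mono fun x hx => ?_
  exact fun h => hx (by simp only [orbitNormalize, h, zero_div])

include L ht hvt in
-- Identifies the conjugated weight of `v` with the regularised orbit mass of `τ₁(t)v`. The ratio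
-- appears because `τ₁` carries `Δ_G` while the orbit average scales by `Δ_H`.
theorem modularRatio_mul_orbitWeight {x : G} (hx : x ∈ U) :
    modularRatio ι t * orbitWeight ι χ v κ ((ι t)⁻¹ * x * ι t)
      = orbitAvg ι χ (conjFn (ι t) v) x + modularRatio ι t * κ := by
  have h1 : orbitAvg ι χ (conjFn (ι t) v) x
      = modularFn (ι t) * orbitAvg ι χ (fun y => v ((ι t)⁻¹ * y * ι t)) x := by
    rw [orbitAvg, orbitAvg, ← integral_const_mul]
    refine integral_congr_ae (.of_forall fun k => ?_)
    simp only [conjFn]; ring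
  rw [orbitWeight, L.orbitAvg_conj ht hvt hx, h1, modularRatio]
  have := (coe_modularFn_pos t).ne'
  field_simp

include L hvU in
-- The weight is constant along the part of the orbit that stays in `U`, so it leaves the average.
theorem orbitAvg_orbitNormalize {x : G} (hx : x ∈ U) :
    orbitAvg ι χ (orbitNormalize ι χ v κ) x = orbitAvg ι χ v x / √(orbitWeight ι χ v κ x) := by
  rw [orbitAvg]
  conv_rhs => rw [orbitAvg]
  rw [← integral_div]
  refine integral_congr_ae (.of_forall fun k => ?_)
  simp only [orbitNormalize]
  by_cases hy : (ι k)⁻¹ * x ∈ U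
  · by_cases hk : χ k = 0
    · simp [hk]
    · have hkN := L.mem_of_mul k (L.mem_of_ne k hk) _ hy (by simpa using hx)
      rw [orbitWeight, L.orbitAvg_translate hvU hx hkN, ← orbitWeight, mul_div_assoc]
  · rw [hvU _ hy]; simp

include L hι hvc hv0 hκ ht hvt in
/-- Fubini for the average of a function over orbits, against a function that is normalised on
orbits. -/
theorem integral_mul_orbitAvg_le {D : G → ℝ} (hD : Continuous D) (hDs : HasCompactSupport D)
    (hD0 : ∀ x, 0 ≤ D x) (hDU : ∀ x, x ∉ U → D x = 0) (hvs : HasCompactSupport v) :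
    ∫ x, conjFn (ι t) v x / (modularRatio ι t * orbitWeight ι χ v κ ((ι t)⁻¹ * x * ι t))
        * orbitAvg ι χ D x ∂(Measure.haar : Measure G)
      ≤ 2 * ∫ x, D x ∂(Measure.haar : Measure G) := by
  set u : G → ℝ := conjFn (ι t) v with hu
  have huc : Continuous u := continuous_conjFn hvc _
  have hus : HasCompactSupport u := hasCompactSupport_conjFn hvs _
  have hu0 : ∀ x, 0 ≤ u x := fun x => mul_nonneg (NNReal.coe_nonneg _) (hv0 _)
  have huU : ∀ x, x ∉ U → u x = 0 := fun x hx => L.conjFn_eq_zero hvt hx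
  set V : G → ℝ := fun x => modularRatio ι t * orbitWeight ι χ v κ ((ι t)⁻¹ * x * ι t) with hV
  have hVpos : ∀ x, 0 < V x := fun x =>
    mul_pos (modularRatio_pos ι t) (L.orbitWeight_pos hv0 hκ _)
  have hVc : Continuous V := by
    have := L.continuous_orbitWeight hι hvc (κ := κ)
    fun_prop
  have hVU : ∀ x ∈ U, V x = orbitAvg ι χ u x + modularRatio ι t * κ := fun x hx =>
    L.modularRatio_mul_orbitWeight ht hvt hx
  set q : G → ℝ := fun x => u x / V x with hq
  have hqc : Continuous q := huc.div hVc fun x => (hVpos x).ne'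
  have hqs : HasCompactSupport q := by
    refine hus.mono fun x hx => ?_
    exact fun h => hx (by simp only [hq, h, zero_div])
  have hq0 : ∀ x, 0 ≤ q x := fun x => div_nonneg (hu0 x) (hVpos x).le
  have hqU : ∀ x, x ∉ U → q x = 0 := fun x hx => by simp [hq, huU x hx]
  calc ∫ x, q x * orbitAvg ι χ D x ∂(Measure.haar : Measure G)
      = ∫ x, (∫ k, q x * (χ k * D ((ι k)⁻¹ * x)) ∂(Measure.haar : Measure H))
        ∂(Measure.haar : Measure G) := by
        refine integral_congr_ae (.of_forall fun x => ?_)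
        simp only
        rw [integral_const_mul]; rfl
    _ = ∫ k, (∫ x, q x * (χ k * D ((ι k)⁻¹ * x)) ∂(Measure.haar : Measure G))
        ∂(Measure.haar : Measure H) := by
        refine integral_integral_swap_of_hasCompactSupport
          (f := fun x k => q x * (χ k * D ((ι k)⁻¹ * x)))
          (by have := L.cont; unfold Function.uncurry; fun_prop) ?_
        refine hasCompactSupport_uncurry hqs.isCompact L.compact_support.isCompact
          fun x k hne => ?_
        exact ⟨subset_tsupport _ (left_ne_zero_of_mul hne),
          subset_tsupport _ (left_ne_zero_of_mul (right_ne_zero_of_mul hne))⟩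
    _ = ∫ k, (∫ x, q (ι k * x) * (χ k * D x) ∂(Measure.haar : Measure G))
        ∂(Measure.haar : Measure H) := by
        refine integral_congr_ae (.of_forall fun k => ?_)
        simp only
        rw [← integral_mul_left_eq_self (fun x => q x * (χ k * D ((ι k)⁻¹ * x))) (ι k)]
        simp
    _ = ∫ x, (∫ k, q (ι k * x) * (χ k * D x) ∂(Measure.haar : Measure H))
        ∂(Measure.haar : Measure G) := by
        refine integral_integral_swap_of_hasCompactSupport
          (f := fun k x => q (ι k * x) * (χ k * D x))
          (by have := L.cont; unfold Function.uncurry; fun_prop) ?_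
        refine hasCompactSupport_uncurry L.compact_support.isCompact hDs.isCompact
          fun k x hne => ?_
        exact ⟨subset_tsupport _ (left_ne_zero_of_mul (right_ne_zero_of_mul hne)),
          subset_tsupport _ (right_ne_zero_of_mul (right_ne_zero_of_mul hne))⟩
    _ ≤ ∫ x, 2 * D x ∂(Measure.haar : Measure G) := by
        refine integral_mono_of_nonneg (.of_forall fun x => integral_nonneg fun k =>
          mul_nonneg (hq0 _) (mul_nonneg (L.nonneg k) (hD0 x)))
          ((hD.integrable_of_hasCompactSupport hDs).const_mul 2) (.of_forall fun x => ?_)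
        simp only
        by_cases hx : x ∈ U
        swap
        · simp [hDU x hx]
        -- `V` is constant along the part of the orbit inside `U`, so the denominator leaves the
        -- integral over `k`.
        have h1 : ∀ k, q (ι k * x) * (χ k * D x) = χ k * u (ι k * x) * (D x / V x) := by
          intro k
          by_cases hk : χ k = 0
          · simp [hk]
          by_cases hkx : ι k * x ∈ U
          · have hkN := L.mem_of_mul k (L.mem_of_ne k hk) x hx hkx
            have h2 : V (ι k * x) = V x := by
              rw [hVU _ hkx, hVU x hx, ← L.orbitAvg_translate huU hkx hkN, inv_mul_cancel_left]
            simp only [hq, h2]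
            ring
          · rw [hqU _ hkx, huU _ hkx]; simp
        simp only [h1]
        rw [integral_mul_const]
        have hφ : Continuous fun k => χ k * u (ι k * x) := by have := L.cont; fun_prop
        rw [integral_inv_modularFn hφ L.compact_support.mul_right]
        -- Inversion leads back to the orbit average of `u`; the `2` bounds the modular function on
        -- `N`.
        have h3 : ∫ k, χ k⁻¹ * u (ι k⁻¹ * x) * (modularFn k : ℝ)⁻¹ ∂(Measure.haar : Measure H)
            ≤ ∫ k, 2 * (χ k * u ((ι k)⁻¹ * x)) ∂(Measure.haar : Measure H) := by
          refine integral_mono_of_nonneg (.of_forall fun k => mul_nonneg (mul_nonneg (L.nonneg _)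
            (hu0 _)) (inv_nonneg.2 (NNReal.coe_nonneg _)))
            ((integrable_orbitAvg hι L.cont L.compact_support huc x).const_mul 2)
            (.of_forall fun k => ?_)
          simp only [map_inv]
          by_cases hk : χ k⁻¹ = 0
          · rw [hk, zero_mul, zero_mul]
            exact mul_nonneg zero_le_two (mul_nonneg (L.nonneg _) (hu0 _))
          by_cases hkx : (ι k)⁻¹ * x ∈ U
          · have hkN : k⁻¹ ∈ N := L.mem_of_mul k⁻¹ (L.mem_of_ne _ hk) x hx (by rwa [map_inv])
            have hkN' : k ∈ N := by simpa using L.inv_mem _ hkN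
            rw [L.eq_one _ hkN, L.eq_one _ hkN', ← coe_modularFn_inv]
            nlinarith [L.modularFn_le _ hkN, hu0 ((ι k)⁻¹ * x)]
          · rw [huU _ hkx]; simp
        rw [integral_const_mul] at h3
        have h4 : ∫ k, χ k * u ((ι k)⁻¹ * x) ∂(Measure.haar : Measure H) ≤ V x := by
          rw [hVU x hx]
          have := mul_pos (modularRatio_pos ι t) hκ
          exact le_add_of_nonneg_right this.le
        calc _ ≤ 2 * V x * (D x / V x) :=
              mul_le_mul_of_nonneg_right (h3.trans (by linarith))
                (div_nonneg (hD0 x) (hVpos x).le)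
          _ = 2 * D x := by
              have := (hVpos x).ne'
              field_simp
    _ = _ := integral_const_mul _ _

include L hι hvc hvs hv0 hvU ht hvt hκ in
/-- The total overlap of the normalised function with its conjugate is close to one. -/
theorem abs_overlap_sub_one_le (hv1 : ∫ x, v x ∂(Measure.haar : Measure G) = 1) :
    |∫ x, conjFn (ι t) v x / √(modularRatio ι t * orbitWeight ι χ v κ ((ι t)⁻¹ * x * ι t))
        * orbitAvg ι χ (orbitNormalize ι χ v κ) x ∂(Measure.haar : Measure G) - 1|
      ≤ ((√(modularRatio ι t))⁻¹ + |1 - modularRatio ι t| / modularRatio ι t)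
          * (∫ x, v x * √(κ / orbitWeight ι χ v κ x) ∂(Measure.haar : Measure G))
        + 2 * ∫ x, |conjFn (ι t) v x - v x| ∂(Measure.haar : Measure G) := by
  set r := modularRatio ι t with hr
  have hrpos : 0 < r := modularRatio_pos ι t
  set u : G → ℝ := conjFn (ι t) v with hu
  have huc : Continuous u := continuous_conjFn hvc _
  have hus : HasCompactSupport u := hasCompactSupport_conjFn hvs _
  have hu0 : ∀ x, 0 ≤ u x := fun x => mul_nonneg (NNReal.coe_nonneg _) (hv0 _)
  have huU : ∀ x, x ∉ U → u x = 0 := fun x hx => L.conjFn_eq_zero hvt hx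
  set W : G → ℝ := orbitWeight ι χ v κ with hW
  have hWpos : ∀ x, 0 < W x := fun x => L.orbitWeight_pos hv0 hκ x
  have hWc : Continuous W := L.continuous_orbitWeight hι hvc
  set V : G → ℝ := fun x => r * W ((ι t)⁻¹ * x * ι t) with hV
  have hVpos : ∀ x, 0 < V x := fun x => mul_pos hrpos (hWpos _)
  have hVc : Continuous V := by fun_prop
  have hVU : ∀ x ∈ U, V x = orbitAvg ι χ u x + r * κ := fun x hx =>
    L.modularRatio_mul_orbitWeight ht hvt hx
  set D : G → ℝ := fun x => |u x - v x| with hD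
  have hDc : Continuous D := (huc.sub hvc).abs
  have hDs : HasCompactSupport D := (hus.sub hvs).norm
  have hDU : ∀ x, x ∉ U → D x = 0 := fun x hx => by simp [hD, huU x hx, hvU x hx]
  have hξc : Continuous (orbitNormalize ι χ v κ) := L.continuous_orbitNormalize hι hvc hv0 hκ
  have hcut : ∀ {p : G → ℝ}, Continuous p → Integrable (fun x => u x * p x)
      (Measure.haar : Measure G) := fun hp =>
    (huc.mul hp).integrable_of_hasCompactSupport hus.mul_right
  have hint0 : Integrable u (Measure.haar : Measure G) := huc.integrable_of_hasCompactSupport hus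
  have hsqV : ∀ x, √(V x) ≠ 0 := fun x => (Real.sqrt_pos.2 (hVpos x)).ne'
  have hi1 : Integrable (fun x => u x / √(V x) * orbitAvg ι χ (orbitNormalize ι χ v κ) x)
      (Measure.haar : Measure G) := by
    have h := hcut (p := fun x => (√(V x))⁻¹ * orbitAvg ι χ (orbitNormalize ι χ v κ) x)
      ((hVc.sqrt.inv₀ hsqV).mul (continuous_orbitAvg hι L.cont L.compact_support hξc))
    refine h.congr (.of_forall fun x => ?_)
    simp only; rw [div_eq_mul_inv, mul_assoc]
  have hi2 : Integrable (fun x => u x * (√(κ / V x) + κ * |1 - r| / V x))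
      (Measure.haar : Measure G) := by
    refine hcut ?_
    have h1 : Continuous fun x => κ / V x := continuous_const.div hVc fun x => (hVpos x).ne'
    have h2 : Continuous fun x => κ * |1 - r| / V x :=
      continuous_const.div hVc fun x => (hVpos x).ne'
    exact h1.sqrt.add h2
  have hi3 : Integrable (fun x => u x / V x * orbitAvg ι χ D x) (Measure.haar : Measure G) := by
    have h := hcut (p := fun x => (V x)⁻¹ * orbitAvg ι χ D x)
      ((hVc.inv₀ fun x => (hVpos x).ne').mul
        (continuous_orbitAvg hι L.cont L.compact_support hDc))
    refine h.congr (.of_forall fun x => ?_)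
    simp only; rw [div_eq_mul_inv, mul_assoc]
  -- On `U` the orbit masses `W` of `v` and `V` of `u` differ by at most the orbit average of `D`
  -- plus `κ |1 - r|`. The factor `u / V` makes the former integrable against `D` uniformly in `κ`.
  have hpt : ∀ x, |u x / √(V x) * orbitAvg ι χ (orbitNormalize ι χ v κ) x - u x|
      ≤ u x * (√(κ / V x) + κ * |1 - r| / V x) + u x / V x * orbitAvg ι χ D x := by
    intro x
    by_cases hx : x ∈ U
    swap
    · simp [huU x hx]
    rw [L.orbitAvg_orbitNormalize hvU hx]
    have h1 := abs_div_sqrt_mul_sqrt_sub_one_le (orbitAvg_nonneg L.nonneg hv0 x (ι := ι)) hκ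
      (hVpos x)
    have h2 : |orbitAvg ι χ v x + κ - V x| ≤ orbitAvg ι χ D x + κ * |1 - r| := by
      rw [hVU x hx]
      have e : orbitAvg ι χ v x + κ - (orbitAvg ι χ u x + r * κ)
          = (orbitAvg ι χ v x - orbitAvg ι χ u x) + κ * (1 - r) := by ring
      rw [e]
      refine (abs_add_le _ _).trans (add_le_add
        (abs_orbitAvg_sub_le hι L.cont L.compact_support L.nonneg hvc huc x) ?_)
      rw [abs_mul, abs_of_pos hκ]
    have h3 : |orbitAvg ι χ v x / √(orbitWeight ι χ v κ x) / √(V x) - 1|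
        ≤ √(κ / V x) + (orbitAvg ι χ D x + κ * |1 - r|) / V x :=
      h1.trans (add_le_add le_rfl (div_le_div_of_nonneg_right h2 (hVpos x).le))
    have e1 : u x / √(V x) * (orbitAvg ι χ v x / √(W x)) - u x
        = u x * (orbitAvg ι χ v x / √(orbitWeight ι χ v κ x) / √(V x) - 1) := by
      rw [hW]; ring
    rw [e1, abs_mul, abs_of_nonneg (hu0 x)]
    refine (mul_le_mul_of_nonneg_left h3 (hu0 x)).trans (le_of_eq ?_)
    ring
  have hu1 : ∫ x, u x ∂(Measure.haar : Measure G) = 1 := by rw [hu, integral_conjFn, hv1]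
  have e0 : ∫ x, u x / √(V x) * orbitAvg ι χ (orbitNormalize ι χ v κ) x
      ∂(Measure.haar : Measure G) - 1 = ∫ x, (u x / √(V x)
      * orbitAvg ι χ (orbitNormalize ι χ v κ) x - u x) ∂(Measure.haar : Measure G) := by
    rw [integral_sub hi1 hint0, hu1]
  rw [e0]
  refine abs_integral_le_integral_abs.trans ((integral_mono (hi1.sub hint0).abs (hi2.add hi3)
    hpt).trans ?_)
  rw [integral_add' hi2 hi3]
  refine add_le_add ?_ (L.integral_mul_orbitAvg_le hι hvc hv0 ht hvt hκ hDc hDs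
    (fun x => abs_nonneg _) hDU hvs)
  -- The `κ` terms depend on the conjugated point only, so `integral_conjFn` carries them back to
  -- `v` and `W`.
  have e2 : ∀ x, u x * (√(κ / V x) + κ * |1 - r| / V x)
      = conjFn (ι t) (fun y => v y * (√(κ / W y) * (√r)⁻¹ + κ / W y * (|1 - r| / r))) x := by
    intro x
    simp only [hu, conjFn, hV]
    set y := (ι t)⁻¹ * x * ι t
    have h1 : √(κ / (r * W y)) = √(κ / W y) * (√r)⁻¹ := by
      rw [← Real.sqrt_inv, ← Real.sqrt_mul (div_nonneg hκ.le (hWpos y).le)]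
      congr 1
      field_simp
    have h2 : κ * |1 - r| / (r * W y) = κ / W y * (|1 - r| / r) := by
      have := (hWpos y).ne'
      field_simp
    rw [h1, h2]; ring
  simp only [e2]
  rw [integral_conjFn, ← integral_const_mul]
  have hκW : Continuous fun x => κ / W x := continuous_const.div hWc fun x => (hWpos x).ne'
  refine integral_mono_of_nonneg (.of_forall fun x => ?_) ?_ (.of_forall fun x => ?_)
  · have h1 := hv0 x
    have h2 := (hWpos x).le
    exact mul_nonneg h1 (by positivity)
  · exact (Continuous.integrable_of_hasCompactSupport (hvc.mul hκW.sqrt) hvs.mul_right).const_mul _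
  · simp only
    have h1 : κ / W x ≤ 1 :=
      (div_le_one (hWpos x)).2 (le_add_of_nonneg_left (orbitAvg_nonneg L.nonneg hv0 x))
    have h0 : 0 ≤ κ / W x := div_nonneg hκ.le (hWpos x).le
    have h2 : κ / W x ≤ √(κ / W x) := by
      rw [Real.le_sqrt h0]
      · nlinarith
      · exact h0
    have h3 : 0 ≤ |1 - r| / r := by positivity
    have h4 := hv0 x
    calc v x * (√(κ / W x) * (√r)⁻¹ + κ / W x * (|1 - r| / r))
        ≤ v x * (√(κ / W x) * (√r)⁻¹ + √(κ / W x) * (|1 - r| / r)) := by gcongr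
      _ = _ := by ring

include L hι hvc hvs hv0 in
-- Dominated convergence with bound `v`: where `v` is nonzero, `χ 1 = 1` makes the unregularised
-- orbit average positive, so `κ / W → 0` there.
theorem tendsto_integral_sqrt (hχ1 : χ 1 = 1) :
    Tendsto (fun κ : ℝ => ∫ x, v x * √(κ / orbitWeight ι χ v κ x) ∂(Measure.haar : Measure G))
      (𝓝[>] 0) (𝓝 0) := by
  have hv : Integrable v (Measure.haar : Measure G) := hvc.integrable_of_hasCompactSupport hvs
  suffices h : Tendsto (fun κ : ℝ => ∫ x, v x * √(κ / orbitWeight ι χ v κ x)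
      ∂(Measure.haar : Measure G)) (𝓝[>] 0) (𝓝 (∫ x, (0 : ℝ) ∂(Measure.haar : Measure G))) by
    rwa [integral_zero] at h
  refine tendsto_integral_filter_of_dominated_convergence v ?_ ?_ hv ?_
  · filter_upwards [eventually_mem_nhdsWithin] with κ hκ
    have h1 : Continuous fun x => κ / orbitWeight ι χ v κ x :=
      continuous_const.div (L.continuous_orbitWeight hι hvc)
        fun x => (L.orbitWeight_pos hv0 hκ x).ne'
    exact ((hvc.mul h1.sqrt).integrable_of_hasCompactSupport hvs.mul_right).aestronglyMeasurable
  · filter_upwards [eventually_mem_nhdsWithin] with κ hκ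
    refine .of_forall fun x => ?_
    rw [norm_mul, Real.norm_of_nonneg (hv0 x), Real.norm_of_nonneg (Real.sqrt_nonneg _)]
    refine mul_le_of_le_one_right (hv0 x) (Real.sqrt_le_one.2 ?_)
    exact (div_le_one (L.orbitWeight_pos hv0 hκ x)).2
      (le_add_of_nonneg_left (orbitAvg_nonneg L.nonneg hv0 x))
  · refine .of_forall fun x => ?_
    by_cases hx : v x = 0
    · simp [hx]
    have hpos := orbitAvg_pos hι L.cont L.compact_support L.nonneg hχ1 hvc hv0 hx
    have hc : ContinuousAt (fun κ : ℝ => v x * √(κ / (orbitAvg ι χ v x + κ))) 0 := by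
      have : ContinuousAt (fun κ : ℝ => κ / (orbitAvg ι χ v x + κ)) 0 :=
        continuousAt_id.div (by fun_prop) (by simpa using hpos.ne')
      exact continuousAt_const.mul this.sqrt
    have := hc.tendsto.mono_left (nhdsWithin_le_nhds (s := Set.Ioi 0))
    simpa [orbitWeight] using this

end IsLocalizing

end OverlapEstimate

/-! ### Correlations on `H` and coefficients at integrated vectors. -/

section Coefficients

open Filter Topology

variable {H : Type u} [Group H] [TopologicalSpace H] [IsTopologicalGroup H]
  [LocallyCompactSpace H] [MeasurableSpace H] [BorelSpace H]

/-- The function `k ↦ ⟨ρ(k)f, λ(s)ρ(t)f⟩`, up to modular factors. -/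
def correlation (f : C_c(H, ℂ)) (s t k : H) : ℂ :=
  ∫ h, starRingEnd ℂ (f (h * k)) * ((√(modularFn t : ℝ) : ℂ) * f (s⁻¹ * h * t))
    ∂(Measure.haar : Measure H)

theorem hasCompactSupport_conj (f : C_c(H, ℂ)) :
    HasCompactSupport fun k => starRingEnd ℂ (f k) :=
  f.hasCompactSupport.comp_left (g := starRingEnd ℂ) (map_zero _)

theorem continuous_conj (f : C_c(H, ℂ)) : Continuous fun k => starRingEnd ℂ (f k) :=
  Complex.continuous_conj.comp f.continuous

theorem hasCompactSupport_bimul (f : C_c(H, ℂ)) (s t : H) :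
    HasCompactSupport fun h => f (s⁻¹ * h * t) :=
  f.hasCompactSupport.comp_homeomorph ((Homeomorph.mulLeft s⁻¹).trans (Homeomorph.mulRight t))

theorem continuous_correlation (f : C_c(H, ℂ)) :
    Continuous fun p : (H × H) × H => correlation f p.1.1 p.1.2 p.2 := by
  rw [continuous_iff_continuousAt]
  rintro ⟨⟨s₀, t₀⟩, k₀⟩
  obtain ⟨C, hC, hCk⟩ := exists_compact_mem_nhds k₀
  have hm : Set.univ ×ˢ C ∈ 𝓝 ((s₀, t₀), k₀) := prod_mem_nhds univ_mem hCk
  refine (continuousOn_integral_of_compact_support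
    (f := fun (p : (H × H) × H) h => starRingEnd ℂ (f (h * p.2))
      * ((√(modularFn p.1.2 : ℝ) : ℂ) * f (p.1.1⁻¹ * h * p.1.2)))
    (k := (fun q : H × H => q.1 * q.2⁻¹) '' (tsupport f ×ˢ C)) (s := Set.univ ×ˢ C)
    ((f.hasCompactSupport.isCompact.prod hC).image (by fun_prop)) ?_ ?_).continuousAt hm
  · refine Continuous.continuousOn ?_
    have h1 := continuous_conj f
    have h2 := f.continuous
    have h3 : Continuous fun s : H => (√(modularFn s : ℝ) : ℂ) :=
      Complex.continuous_ofReal.comp continuous_coe_modularFn.sqrt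
    have e1 : Continuous fun q : ((H × H) × H) × H => starRingEnd ℂ (f (q.2 * q.1.2)) :=
      h1.comp (by fun_prop)
    have e2 : Continuous fun q : ((H × H) × H) × H => (√(modularFn q.1.1.2 : ℝ) : ℂ) :=
      h3.comp (by fun_prop)
    have e3 : Continuous fun q : ((H × H) × H) × H => f (q.1.1.1⁻¹ * q.2 * q.1.1.2) :=
      h2.comp (by fun_prop)
    exact e1.mul (e2.mul e3)
  · intro p h hp hh
    have : f (h * p.2) = 0 := by
      by_contra hne
      exact hh ⟨(h * p.2, p.2), ⟨subset_tsupport _ hne, hp.2⟩, by simp⟩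
    simp [this]

/-- Some `x` has `a = s⁻¹xt` and `b = xk` in the support; eliminating `x` confines `k` to a compact
set as `s` and `t` range over one. -/
theorem exists_of_correlation_ne_zero {f : C_c(H, ℂ)} {s t k : H} (h : correlation f s t k ≠ 0) :
    ∃ a ∈ tsupport f, ∃ b ∈ tsupport f, k = t * a⁻¹ * s⁻¹ * b := by
  by_contra hne
  push Not at hne
  refine h (integral_eq_zero_of_ae (.of_forall fun x => ?_))
  simp only [Pi.zero_apply]
  by_contra h0
  have h1 : f (x * k) ≠ 0 := fun h1 => h0 (by simp [h1])
  have h2 : f (s⁻¹ * x * t) ≠ 0 := fun h2 => h0 (by simp [h2])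
  exact hne _ (subset_tsupport _ h2) _ (subset_tsupport _ h1) (by group)

theorem hasCompactSupport_correlation (f : C_c(H, ℂ)) (s t : H) :
    HasCompactSupport (correlation f s t) := by
  refine HasCompactSupport.intro (((f.hasCompactSupport.isCompact.prod f.hasCompactSupport).image
    (by fun_prop : Continuous fun p : H × H => t * p.1⁻¹ * s⁻¹ * p.2))) fun k hk => ?_
  by_contra hne
  obtain ⟨a, ha, b, hb, rfl⟩ := exists_of_correlation_ne_zero hne
  exact hk ⟨(a, b), ⟨ha, hb⟩, rfl⟩

theorem inner_biTranslate_eq_correlation {f : C_c(H, ℂ)} {η : Lp ℂ 2 (Measure.haar : Measure H)}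
    (hf : (f : H → ℂ) =ᵐ[Measure.haar] η) (s t : H) :
    inner ℂ η (biTranslate 2 (s, t) η) = correlation f s t 1 := by
  rw [L2.inner_def, correlation]
  refine integral_congr_ae ?_
  filter_upwards [hf, coeFn_biTranslate 2 s t η, (quasiMeasurePreserving_bimul s t).ae hf]
    with x h1 h2 h3
  rw [h2, ← h1, ← h3]
  simp [Real.sqrt_eq_rpow]
  ring

/-- Coefficients at the vector `left(f)ξ`. -/
theorem RepPair.inner_left_integrated (P : RepPair H) (f : C_c(H, ℂ)) (ξ : P.X) {η : P.X}
    (hη : η = ∫ h, f h • P.left h ξ ∂(Measure.haar : Measure H)) (s t : H) :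
    inner ℂ η (P.left s (P.right t η))
      = ∫ k, correlation f s t k
          * ((√(modularFn t : ℝ) : ℂ) * inner ℂ (P.left k ξ) (P.left t (P.right t ξ)))
        ∂(Measure.haar : Measure H) := by
  have hl : ∀ x y ξ, P.left x (P.left y ξ) = P.left (x * y) ξ := fun x y ξ => by
    rw [map_mul]; rfl
  set d : ℂ := (√(modularFn t : ℝ) : ℂ) with hd
  have hdd : d * d = ((modularFn t : ℝ) : ℂ) := by
    rw [hd, ← Complex.ofReal_mul, Real.mul_self_sqrt (NNReal.coe_nonneg _)]
  obtain ⟨ζ, hζ⟩ : ∃ ζ, ζ = P.left t (P.right t ξ) := ⟨_, rfl⟩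
  have hfi : Integrable (fun h => f h • P.left h ξ) (Measure.haar : Measure H) :=
    P.leftRep.integrable_smul f ξ
  have hgi : Integrable (fun h => (d * f (s⁻¹ * h * t)) • P.left h ζ) (Measure.haar : Measure H) :=
    (((continuous_const.mul (f.continuous.comp (by fun_prop))).smul
      (P.continuous_left ζ))).integrable_of_hasCompactSupport
      (hasCompactSupport_bimul f s t).mul_left.smul_right
  have h1 : P.left s (P.right t η)
      = d • ∫ h, (d * f (s⁻¹ * h * t)) • P.left h ζ ∂(Measure.haar : Measure H) := by
    have e1 : P.left s (P.right t η)
        = ∫ h, f h • P.left s (P.right t (P.left h ξ)) ∂(Measure.haar : Measure H) := by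
      rw [hη]
      have := (((P.right t).trans (P.left s)).toContinuousLinearEquiv.integral_comp_comm
        (μ := (Measure.haar : Measure H)) (fun h => f h • P.left h ξ)).symm
      refine this.trans (integral_congr_ae (.of_forall fun h => ?_))
      simp
    rw [e1]
    -- Replacing `h` by `s⁻¹ht` turns `left(sh)` into `left(ht)`, leaving `ζ = left(t) right(t) ξ`.
    -- The factor `Δ(t) = d * d` is shared between the correlation and the coefficient of `ξ`.
    have h2 := integral_bimul (fun h => f h • P.left s (P.right t (P.left h ξ))) s t
    rw [eq_inv_smul_iff₀ (coe_modularFn_pos t).ne'] at h2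
    rw [← h2, ← integral_smul, ← integral_smul]
    refine integral_congr_ae (.of_forall fun h => ?_)
    simp only
    have e2 : s * (s⁻¹ * h * t) = h * t := by group
    rw [← P.commutes, hl, hζ, hl, e2, smul_smul, ← mul_assoc d, hdd, ← smul_smul, Complex.coe_smul]
  have hin : ∀ Y, inner ℂ η Y
      = ∫ k, starRingEnd ℂ (f k) * inner ℂ (P.left k ξ) Y ∂(Measure.haar : Measure H) := by
    intro Y
    rw [hη, ← inner_conj_symm, ← integral_inner (𝕜 := ℂ) hfi, ← integral_conj]
    refine integral_congr_ae (.of_forall fun k => ?_)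
    simp only
    rw [inner_conj_symm, inner_smul_left]
  have hJ : Continuous fun k => d * inner ℂ (P.left k ξ) ζ :=
    continuous_const.mul ((P.continuous_left ξ).inner continuous_const)
  have hg : Continuous fun h => d * f (s⁻¹ * h * t) :=
    continuous_const.mul (f.continuous.comp (by fun_prop))
  have hconv := integral_convolution_coefficient (continuous_conj f) (hasCompactSupport_conj f) hg
    (hasCompactSupport_bimul f s t).mul_left hJ
  rw [← hζ]
  refine Eq.trans ?_ hconv
  rw [hin, h1]
  refine integral_congr_ae (.of_forall fun k => ?_)
  simp only
  rw [inner_smul_right, ← integral_inner (𝕜 := ℂ) hgi, ← integral_const_mul, ← integral_const_mul]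
  refine integral_congr_ae (.of_forall fun h => ?_)
  simp only
  have : inner ℂ (P.left k ξ) (P.left h ζ) = inner ℂ (P.left (h⁻¹ * k) ξ) ζ := by
    rw [← LinearIsometryEquiv.inner_map_map (P.left h) (P.left (h⁻¹ * k) ξ), hl,
      mul_inv_cancel_left]
  rw [inner_smul_right, this]
  ring

end Coefficients

/-! ### The approximating vector in `L²(G)`. -/

section Approximation

open Filter Topology

variable {G : Type u} [Group G] [TopologicalSpace G] [IsTopologicalGroup G]
  [LocallyCompactSpace G] [MeasurableSpace G] [BorelSpace G]
variable {H : Type u} [Group H] [TopologicalSpace H] [IsTopologicalGroup H]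
  [LocallyCompactSpace H] [MeasurableSpace H] [BorelSpace H]

theorem inner_translate_conj (g t : G) {ξ : G → ℝ} {Ξ : Lp ℂ 2 (Measure.haar : Measure G)}
    (hΞ : Ξ =ᵐ[Measure.haar] fun x => (ξ x : ℂ)) :
    inner ℂ (biTranslate 2 (g, 1) Ξ) (biTranslate 2 (t, t) Ξ)
      = ((∫ x, √(modularFn t : ℝ) * ξ (t⁻¹ * x * t) * ξ (g⁻¹ * x)
        ∂(Measure.haar : Measure G) : ℝ) : ℂ) := by
  rw [L2.inner_def, ← integral_complex_ofReal]
  refine integral_congr_ae ?_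
  filter_upwards [coeFn_biTranslate 2 g 1 Ξ, coeFn_biTranslate 2 t t Ξ,
    (quasiMeasurePreserving_bimul g 1).ae hΞ, (quasiMeasurePreserving_bimul t t).ae hΞ]
    with x h1 h2 h3 h4
  rw [h1, h2, h3, h4]
  simp [Real.sqrt_eq_rpow, modularFn_one]

theorem integral_mul_overlap {ι : H →* G} (hι : Continuous ι) {χ : H → ℝ} (hχ : Continuous χ)
    (hχs : HasCompactSupport χ) {w ξ : G → ℝ} (hw : Continuous w) (hws : HasCompactSupport w)
    (hξ : Continuous ξ) :
    ∫ k, χ k * (∫ x, w x * ξ ((ι k)⁻¹ * x) ∂(Measure.haar : Measure G))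
        ∂(Measure.haar : Measure H)
      = ∫ x, w x * orbitAvg ι χ ξ x ∂(Measure.haar : Measure G) := by
  simp only [orbitAvg, ← integral_const_mul]
  rw [integral_integral_swap_of_hasCompactSupport
    (f := fun k x => χ k * (w x * ξ ((ι k)⁻¹ * x))) (by unfold Function.uncurry; fun_prop)]
  · refine integral_congr_ae (.of_forall fun x => integral_congr_ae (.of_forall fun k => ?_))
    simp only; ring
  · refine hasCompactSupport_uncurry hχs.isCompact hws.isCompact fun k x hne => ?_
    exact ⟨subset_tsupport _ (left_ne_zero_of_mul hne),
      subset_tsupport _ (left_ne_zero_of_mul (right_ne_zero_of_mul hne))⟩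

/-- On `B` the kernel `J` lives in `N`, where `χ = 1` and `c` is nearly `c 1`. So `∫ c J` is close
to `c 1` times the mass `∫ χ J`, which is compared with `1`. -/
theorem norm_integral_mul_sub_le {c : H → ℂ} {χ J : H → ℝ} {N B : Set H} {ε : ℝ}
    (hcJ : Integrable (fun k => c k * J k) (Measure.haar : Measure H))
    (hχJ : Integrable (fun k => χ k * J k) (Measure.haar : Measure H))
    (hJ0 : ∀ k, 0 ≤ J k) (hJ : ∀ k ∈ B, k ∉ N → J k = 0) (hχ : ∀ k ∈ N, χ k = 1)
    (hχB : ∀ k, χ k ≠ 0 → k ∈ B) (hcB : ∀ k, c k ≠ 0 → k ∈ B)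
    (hc : ∀ k ∈ N, ‖c k - c 1‖ ≤ ε) :
    ‖(∫ k, c k * J k ∂(Measure.haar : Measure H)) - c 1‖
      ≤ ε * (∫ k, χ k * J k ∂(Measure.haar : Measure H))
        + ‖c 1‖ * |(∫ k, χ k * J k ∂(Measure.haar : Measure H)) - 1| := by
  set A := ∫ k, χ k * J k ∂(Measure.haar : Measure H) with hA
  have hi : Integrable (fun k => c 1 * ((χ k * J k : ℝ) : ℂ)) (Measure.haar : Measure H) :=
    hχJ.ofReal.const_mul _
  have h1 : ‖(∫ k, c k * J k ∂(Measure.haar : Measure H)) - c 1 * (A : ℂ)‖ ≤ ε * A := by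
    rw [hA, ← integral_complex_ofReal, ← integral_const_mul, ← integral_sub hcJ hi,
      ← integral_const_mul]
    refine norm_integral_le_of_norm_le (hχJ.const_mul ε) (.of_forall fun k => ?_)
    by_cases hkB : k ∈ B
    · by_cases hkN : k ∈ N
      · rw [hχ k hkN, one_mul, ← sub_mul, norm_mul, Complex.norm_real,
          Real.norm_of_nonneg (hJ0 k)]
        exact mul_le_mul_of_nonneg_right (hc k hkN) (hJ0 k)
      · simp [hJ k hkB hkN]
    · rw [not_imp_comm.1 (hcB k) hkB, not_imp_comm.1 (hχB k) hkB]
      simp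
  have h2 : c 1 * (A : ℂ) - c 1 = c 1 * ((A - 1 : ℝ) : ℂ) := by push_cast; ring
  calc _ ≤ ‖(∫ k, c k * J k ∂(Measure.haar : Measure H)) - c 1 * (A : ℂ)‖
        + ‖c 1 * (A : ℂ) - c 1‖ := norm_sub_le_norm_sub_add_norm_sub _ _ _
    _ ≤ _ := by
      rw [h2, norm_mul, Complex.norm_real, Real.norm_eq_abs]
      gcongr

theorem sqrt_modular_mul {ι : H →* G} (t : H) {W : ℝ} (hW : 0 < W) (a : ℝ) :
    √(modularFn t : ℝ) * (√(modularFn (ι t) : ℝ) * (a / √W))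
      = modularFn (ι t) * a / √(modularRatio ι t * W) := by
  have h1 := Real.sqrt_pos.2 (coe_modularFn_pos (ι t))
  have h2 := Real.sqrt_pos.2 (coe_modularFn_pos t)
  have h3 := Real.sqrt_pos.2 hW
  rw [modularRatio, Real.sqrt_mul (div_nonneg (NNReal.coe_nonneg _) (NNReal.coe_nonneg _)),
    Real.sqrt_div (NNReal.coe_nonneg _)]
  have h4 := Real.mul_self_sqrt (NNReal.coe_nonneg (modularFn (ι t)))
  field_simp
  rw [sq, h4, mul_comm]

/-- The vector is `left(f)Ξ`, with `Ξ` the orbit-normalised `v`, and serves all `s` and `t` at once.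
Its coefficient is the correlation of `f` integrated against the overlap kernel `J`, and `A` is the
total overlap. -/
theorem IsLocalizing.exists_vector {ι : H →* G} (hι : Continuous ι) {χ : H → ℝ} {T B N : Set H}
    {U : Set G} (L : IsLocalizing ι χ T B N U) {v : G → ℝ} (hvc : Continuous v)
    (hvs : HasCompactSupport v) (hv0 : ∀ x, 0 ≤ v x) (hvU : ∀ x, x ∉ U → v x = 0)
    (hvt : ∀ t ∈ T, ∀ x, x ∉ U → v ((ι t)⁻¹ * x * ι t) = 0)
    (hv1 : ∫ x, v x ∂(Measure.haar : Measure G) = 1) {κ : ℝ} (hκ : 0 < κ) (f : C_c(H, ℂ)) :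
    ∃ η : Lp ℂ 2 (Measure.haar : Measure G), ∀ s, ∀ t ∈ T, ∀ ε : ℝ,
      (∀ k, correlation f s t k ≠ 0 → k ∈ B) →
      (∀ k ∈ N, ‖correlation f s t k - correlation f s t 1‖ ≤ ε) →
      ∃ A : ℝ, |A - 1| ≤ ((√(modularRatio ι t))⁻¹ + |1 - modularRatio ι t| / modularRatio ι t)
          * (∫ x, v x * √(κ / orbitWeight ι χ v κ x) ∂(Measure.haar : Measure G))
          + 2 * ∫ x, |conjFn (ι t) v x - v x| ∂(Measure.haar : Measure G) ∧
        ‖inner ℂ η (biTranslate 2 (ι s, ι t) η) - correlation f s t 1‖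
          ≤ ε * A + ‖correlation f s t 1‖ * |A - 1| := by
  set ξ := orbitNormalize ι χ v κ with hξ
  have hξc : Continuous ξ := L.continuous_orbitNormalize hι hvc hv0 hκ
  have hξs : HasCompactSupport ξ := hasCompactSupport_orbitNormalize hvs
  have hξ0 : ∀ x, 0 ≤ ξ x := fun x => div_nonneg (hv0 x) (Real.sqrt_nonneg _)
  have hξU : ∀ x, x ∉ U → ξ x = 0 := fun x hx => by simp [hξ, orbitNormalize, hvU x hx]
  have hξm : MemLp (fun x => (ξ x : ℂ)) 2 (Measure.haar : Measure G) :=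
    (Complex.continuous_ofReal.comp hξc).memLp_of_hasCompactSupport
      (hξs.comp_left (g := fun r : ℝ => (r : ℂ)) (by simp))
  let P : RepPair H := regularPair ι hι
  let Ξ : P.X := hξm.toLp _
  obtain ⟨η, hη⟩ : ∃ η : P.X, η = ∫ h, f h • P.left h Ξ ∂(Measure.haar : Measure H) := ⟨_, rfl⟩
  refine ⟨η, fun s t ht ε hB hN => ?_⟩
  set W := orbitWeight ι χ v κ with hW
  have hWpos : ∀ x, 0 < W x := fun x => L.orbitWeight_pos hv0 hκ x
  have hWc : Continuous W := L.continuous_orbitWeight hι hvc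
  set w : G → ℝ := fun x => conjFn (ι t) v x / √(modularRatio ι t * W ((ι t)⁻¹ * x * ι t)) with hw
  have hwc : Continuous w := by
    refine (continuous_conjFn hvc _).div ?_ fun x =>
      (Real.sqrt_pos.2 (mul_pos (modularRatio_pos ι t) (hWpos _))).ne'
    fun_prop
  have hws : HasCompactSupport w := by
    refine (hasCompactSupport_conjFn hvs (ι t)).mono fun x hx h => hx ?_
    simp only [hw, h, zero_div]
  have hw0 : ∀ x, 0 ≤ w x := fun x =>
    div_nonneg (mul_nonneg (NNReal.coe_nonneg _) (hv0 _)) (Real.sqrt_nonneg _)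
  have hwU : ∀ x, x ∉ U → w x = 0 := fun x hx => by
    simp only [hw, L.conjFn_eq_zero (hvt t ht) hx, zero_div]
  set J : H → ℝ := fun k => ∫ x, w x * ξ ((ι k)⁻¹ * x) ∂(Measure.haar : Measure G) with hJ
  have hPt : P.left t (P.right t Ξ) = biTranslate 2 (ι t, ι t) Ξ := by
    change biTranslate 2 (ι t, 1) (biTranslate 2 (1, ι t) Ξ) = _
    have : ((ι t, ι t) : G × G) = (ι t, 1) * (1, ι t) := by simp
    rw [this, map_mul]; rfl
  have hPst : P.left s (P.right t η) = biTranslate 2 (ι s, ι t) η := by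
    change biTranslate 2 (ι s, 1) (biTranslate 2 (1, ι t) η) = _
    have : ((ι s, ι t) : G × G) = (ι s, 1) * (1, ι t) := by simp
    rw [this, map_mul]; rfl
  have hJe : ∀ k, (√(modularFn t : ℝ) : ℂ) * inner ℂ (P.left k Ξ) (P.left t (P.right t Ξ))
      = (J k : ℂ) := by
    intro k
    rw [hPt]
    have h := inner_translate_conj (ι k) (ι t) hξm.coeFn_toLp
    refine (congrArg (fun z : ℂ => (√(modularFn t : ℝ) : ℂ) * z) h).trans ?_
    rw [← Complex.ofReal_mul, ← integral_const_mul]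
    congr 1
    refine integral_congr_ae (.of_forall fun x => ?_)
    simp only [hw, conjFn]
    rw [← sqrt_modular_mul t (hWpos _)]
    simp only [hξ, orbitNormalize, ← hW]
    ring
  have hJc : Continuous J := by
    have h : Continuous fun k => (J k : ℂ) := by
      simp only [← hJe]
      exact continuous_const.mul ((P.continuous_left Ξ).inner continuous_const)
    exact Complex.continuous_re.comp h
  have hcoef := P.inner_left_integrated f Ξ hη s t
  simp only [hJe] at hcoef
  rw [hPst] at hcoef
  refine ⟨_, L.abs_overlap_sub_one_le hι hvc hvs hv0 hvU ht (hvt t ht) hκ hv1, ?_⟩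
  rw [← integral_mul_overlap hι L.cont L.compact_support hwc hws hξc]
  refine (congrArg (fun z : ℂ => ‖z - correlation f s t 1‖) hcoef).le.trans ?_
  have hcc : Continuous (correlation f s t) :=
    (continuous_correlation f).comp (by fun_prop : Continuous fun k : H => ((s, t), k))
  refine norm_integral_mul_sub_le (N := N) (B := B) ?_ ?_ ?_ ?_ L.eq_one L.mem_of_ne hB hN
  · exact (hcc.mul (Complex.continuous_ofReal.comp hJc)).integrable_of_hasCompactSupport
      (hasCompactSupport_correlation f s t).mul_right
  · exact (L.cont.mul hJc).integrable_of_hasCompactSupport L.compact_support.mul_right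
  · exact fun k => integral_nonneg fun x => mul_nonneg (hw0 x) (hξ0 _)
  -- A nonzero overlap puts both `x` and `ι(k)⁻¹x` in `U` for some `x`, which for `k ∈ B` forces `k
  -- ∈ N`.
  · intro k hk hkN
    refine integral_eq_zero_of_ae (.of_forall fun x => ?_)
    simp only [Pi.zero_apply]
    by_contra hne
    have h1 : x ∈ U := by
      by_contra h; exact hne (by rw [hwU x h, zero_mul])
    have h2 : (ι k)⁻¹ * x ∈ U := by
      by_contra h; exact hne (by rw [hξU _ h, mul_zero])
    exact hkN (L.mem_of_mul k hk _ h2 (by simpa using h1))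

end Approximation

/-! ### Choice of the neighbourhoods and the coefficient approximation. -/

section Localization

open Filter Topology

variable {G : Type u} [Group G] [TopologicalSpace G] [IsTopologicalGroup G]
  [LocallyCompactSpace G] [MeasurableSpace G] [BorelSpace G] [T2Space G]
variable {H : Type u} [Group H] [TopologicalSpace H] [IsTopologicalGroup H]
  [LocallyCompactSpace H] [MeasurableSpace H] [BorelSpace H]

/-- On the compact set `B \ interior N`, which misses `1`, injectivity gives `ι k ≠ 1`; as `G` is
Hausdorff this persists, uniformly in `k`, near the identity. The image of `ι` need not be closed.
-/
theorem eventually_mem_of_mul_mem {ι : H →* G} (hι : Continuous ι) (hinj : Function.Injective ι)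
    {B N : Set H} (hB : IsCompact B) (hN : N ∈ 𝓝 (1 : H)) :
    ∃ U ∈ 𝓝 (1 : G), ∀ k ∈ B, ∀ y ∈ U, ι k * y ∈ U → k ∈ N := by
  have hK : IsCompact (B \ interior N) := hB.diff isOpen_interior
  have h : ∀ᶠ p : G × G in 𝓝 (1, 1), ∀ k ∈ B \ interior N, ι k * p.1 ≠ p.2 := by
    refine hK.eventually_forall_of_forall_eventually fun k hk => ?_
    have ho : IsOpen {z : (G × G) × H | ι z.2 * z.1.1 ≠ z.1.2} :=
      isOpen_ne_fun (by fun_prop) (by fun_prop)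
    refine ho.mem_nhds ?_
    rw [Set.mem_ofPred_eq, mul_one]
    intro h1
    have : k = 1 := hinj (by rw [h1, map_one])
    exact hk.2 (this ▸ mem_interior_iff_mem_nhds.2 hN)
  rw [nhds_prod_eq] at h
  obtain ⟨U, hU, h⟩ := (eventually_prod_self_iff
    (r := fun x y => ∀ k ∈ B \ interior N, ι k * x ≠ y)).1 h
  refine ⟨U, hU, fun k hk y hy hky => ?_⟩
  by_contra hkN
  exact h y hy _ hky k ⟨hk, fun h => hkN (interior_subset h)⟩ rfl

theorem exists_isLocalizing {ι : H →* G} (hι : Continuous ι) (hinj : Function.Injective ι)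
    {T D V : Set H} (hT : IsCompact T) (hD : IsCompact D) (hV : V ∈ 𝓝 (1 : H)) :
    ∃ (χ : H → ℝ) (B N : Set H), ∃ U ∈ 𝓝 (1 : G), IsLocalizing ι χ T B N U ∧ D ⊆ B ∧ N ⊆ V ∧
      χ 1 = 1 := by
  obtain ⟨χ, hχc, hχs, hχ0, -, -, hχe⟩ := exists_cutoff (univ_mem (f := 𝓝 (1 : H)))
  obtain ⟨C, hC, hC1⟩ := exists_compact_mem_nhds (1 : H)
  have h1 : ∀ᶠ p : H × H in 𝓝 (1, 1), χ (p.1⁻¹ * p.2) = 1 := by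
    have hc : ContinuousAt (fun p : H × H => p.1⁻¹ * p.2) (1, 1) := by fun_prop
    refine hc.eventually (p := fun x => χ x = 1) ?_
    simpa using hχe
  rw [nhds_prod_eq] at h1
  obtain ⟨W, hW, h1⟩ := (eventually_prod_self_iff (r := fun x y : H => χ (x⁻¹ * y) = 1)).1 h1
  have h2 : ∀ᶠ h : H in 𝓝 1, (modularFn h : ℝ) < 2 :=
    (continuous_coe_modularFn.tendsto 1).eventually_lt_const (by simp [modularFn_one])
  have h3 : ∀ᶠ h : H in 𝓝 1, h ∈ V ∩ C ∩ W ∧ (modularFn h : ℝ) < 2 ∧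
      ∀ t ∈ T, t⁻¹ * h * t ∈ {x | χ x = 1} :=
    Eventually.and (inter_mem (inter_mem hV hC1) hW) (h2.and (eventually_conj_mem hT hχe))
  have h4 : ∀ᶠ h : H in 𝓝 1, h⁻¹ ∈ V ∩ C ∩ W ∧ (modularFn h⁻¹ : ℝ) < 2 ∧
      ∀ t ∈ T, t⁻¹ * h⁻¹ * t ∈ {x | χ x = 1} := by
    have : Tendsto (fun h : H => h⁻¹) (𝓝 1) (𝓝 1) := by
      simpa using (continuous_inv (G := H)).tendsto 1
    exact this.eventually h3
  set N : Set H := {h | (h ∈ V ∩ C ∩ W ∧ (modularFn h : ℝ) < 2 ∧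
      ∀ t ∈ T, t⁻¹ * h * t ∈ {x | χ x = 1}) ∧ (h⁻¹ ∈ V ∩ C ∩ W ∧ (modularFn h⁻¹ : ℝ) < 2 ∧
      ∀ t ∈ T, t⁻¹ * h⁻¹ * t ∈ {x | χ x = 1})} with hN
  have hN1 : N ∈ 𝓝 (1 : H) := h3.and h4
  have h1N : (1 : H) ∈ N := mem_of_mem_nhds hN1
  -- The pieces are the support of `χ`, of its translates by `N ⊆ C`, of its conjugates by `T`, and
  -- the set `D` prescribed for the correlations.
  set B : Set H := tsupport χ ∪ (fun p : H × H => p.1 * p.2) '' (C ×ˢ tsupport χ)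
    ∪ (fun p : H × H => p.1 * p.2 * p.1⁻¹) '' (T ×ˢ tsupport χ) ∪ D with hB
  have hBc : IsCompact B := ((hχs.isCompact.union
    ((hC.prod hχs.isCompact).image (by fun_prop))).union
    ((hT.prod hχs.isCompact).image (by fun_prop))).union hD
  obtain ⟨U, hU, hUN⟩ := eventually_mem_of_mul_mem hι hinj hBc hN1
  refine ⟨χ, B, N, U, hU, ?_, fun x hx => Or.inr hx, fun x hx => hx.1.1.1.1, hχe.self_of_nhds⟩
  exact
    { cont := hχc
      compact_support := hχs
      nonneg := hχ0
      mem_of_ne := fun k hk => Or.inl (Or.inl (Or.inl (subset_tsupport _ hk)))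
      mem_of_translate := fun k hk h hh => Or.inl (Or.inl (Or.inr
        ⟨(k, k⁻¹ * h), ⟨hk.1.1.1.2, subset_tsupport _ hh⟩, by simp⟩))
      mem_of_conj := fun t ht h hh => Or.inl (Or.inr
        ⟨(t, t⁻¹ * h * t), ⟨ht, subset_tsupport _ hh⟩, by simp [mul_assoc]⟩)
      eq_one := fun k hk => by simpa using h1 1 h1N.1.1.2 k hk.1.1.2
      translate_eq_one := fun k hk h hh => h1 k hk.1.1.2 h hh.1.1.2
      conj_eq_one := fun t ht h hh => hh.1.2.2 t ht
      inv_mem := fun k hk => ⟨hk.2, by simpa using hk.1⟩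
      modularFn_le := fun k hk => hk.1.2.1.le
      mem_of_mul := hUN }

theorem eventually_norm_correlation_sub_le (f : C_c(H, ℂ)) {T : Set H} (hT : IsCompact T) {ε : ℝ}
    (hε : 0 < ε) : ∀ᶠ k in 𝓝 (1 : H), ∀ s ∈ T, ∀ t ∈ T,
      ‖correlation f s t k - correlation f s t 1‖ ≤ ε := by
  have h : ∀ᶠ k in 𝓝 (1 : H), ∀ p ∈ T ×ˢ T,
      ‖correlation f p.1 p.2 k - correlation f p.1 p.2 1‖ < ε := by
    refine (hT.prod hT).eventually_forall_of_forall_eventually fun p hp => ?_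
    have hc : Continuous fun z : H × (H × H) =>
        ‖correlation f z.2.1 z.2.2 z.1 - correlation f z.2.1 z.2.2 1‖ :=
      (((continuous_correlation f).comp
          (by fun_prop : Continuous fun z : H × (H × H) => (z.2, z.1))).sub
        ((continuous_correlation f).comp
          (by fun_prop : Continuous fun z : H × (H × H) => (z.2, (1 : H))))).norm
    exact (hc.tendsto (1, p)).eventually_lt_const (by simpa using hε)
  filter_upwards [h] with k hk s hs t ht using (hk (s, t) ⟨hs, ht⟩).le

/-- Coefficients of `λ_H ρ_H` are limits, uniformly on compact sets, of coefficients of the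
restriction of `λ_G ρ_G` to `H`. -/
theorem IsQSIN.exists_coefficient_approx (hG : IsQSIN G) {ι : H →* G} (hι : Continuous ι)
    (hinj : Function.Injective ι) (f : C_c(H, ℂ)) {η : Lp ℂ 2 (Measure.haar : Measure H)}
    (hf : (f : H → ℂ) =ᵐ[Measure.haar] η) {K : Set H} (hK : IsCompact K) {δ : ℝ} (hδ : 0 < δ) :
    ∃ η' : Lp ℂ 2 (Measure.haar : Measure G), ∀ s ∈ K, ∀ t ∈ K,
      ‖inner ℂ η (biTranslate 2 (s, t) η) - inner ℂ η' (biTranslate 2 (ι s, ι t) η')‖ ≤ δ := by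
  -- Including `1` lets the support condition on `v` be read off from that on its conjugates.
  set T : Set H := insert 1 K with hTdef
  have hT : IsCompact T := hK.insert 1
  have hKT : ∀ t ∈ K, t ∈ T := fun t ht => Set.mem_insert_of_mem _ ht
  set M := ‖η‖ ^ 2 with hM
  have hM0 : 0 ≤ M := by positivity
  have hcM : ∀ s t, ‖correlation f s t 1‖ ≤ M := fun s t => by
    rw [← inner_biTranslate_eq_correlation hf, hM, sq]
    refine (norm_inner_le_norm _ _).trans ?_
    rw [LinearIsometryEquiv.norm_map]
  -- `|A - 1| ≤ γ` gives `A ≤ 2` and `M |A - 1| ≤ δ/2`; with correlation error `δ/4` the total is at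
  -- most `δ`.
  set γ : ℝ := min 1 (δ / (2 * (M + 1))) with hγdef
  have hγ : 0 < γ := lt_min one_pos (by positivity)
  set D : Set H := (fun q : (H × H) × (H × H) => q.2.2 * q.1.1⁻¹ * q.2.1⁻¹ * q.1.2) ''
    ((tsupport f ×ˢ tsupport f) ×ˢ (T ×ˢ T)) with hDdef
  have hD : IsCompact D :=
    ((f.hasCompactSupport.isCompact.prod f.hasCompactSupport).prod (hT.prod hT)).image
      (by fun_prop)
  obtain ⟨χ, B, N, U, hU, L, hDB, hNV, hχ1⟩ := exists_isLocalizing hι hinj hT hD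
    (eventually_norm_correlation_sub_le f hT (ε := δ / 4) (by positivity))
  have hιT : IsCompact (ι '' T) := hT.image hι
  obtain ⟨v, hvc, hvs, hv0, hvU', hv1, hvq⟩ := hG.exists_quasicentral hιT
    (eventually_conj_mem hιT.inv hU) (ε := γ / 4) (by positivity)
  have hvt : ∀ t ∈ T, ∀ x, x ∉ U → v ((ι t)⁻¹ * x * ι t) = 0 := fun t ht x hx => by
    refine hvU' _ fun h => hx ?_
    have := h (ι t)⁻¹ (Set.inv_mem_inv.2 ⟨t, ht, rfl⟩)
    simpa [mul_assoc] using this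
  have hvU : ∀ x, x ∉ U → v x = 0 := fun x hx => by
    simpa using hvt 1 (Set.mem_insert 1 K) x hx
  have hRc : Continuous fun t : H =>
      (√(modularRatio ι t))⁻¹ + |1 - modularRatio ι t| / modularRatio ι t := by
    have := continuous_modularRatio (G := G) hι
    exact (this.sqrt.inv₀ fun t => (Real.sqrt_pos.2 (modularRatio_pos ι t)).ne').add
      ((continuous_const.sub this).abs.div this fun t => (modularRatio_pos ι t).ne')
  obtain ⟨R, hR⟩ := hT.exists_bound_of_continuousOn hRc.continuousOn
  have hlim := (L.tendsto_integral_sqrt hι hvc hvs hv0 hχ1).const_mul R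
  rw [mul_zero] at hlim
  -- `κ` comes last, since the rate of convergence depends on `v` and `χ`. It uses one half of `γ`,
  -- twice the conjugation error `γ / 4` the other.
  obtain ⟨κ, hκS, hκ⟩ := ((hlim.eventually_lt_const (half_pos hγ)).and
    self_mem_nhdsWithin).exists
  obtain ⟨η', hη'⟩ := L.exists_vector hι hvc hvs hv0 hvU hvt hv1 hκ f
  refine ⟨η', fun s hs t ht => ?_⟩
  obtain ⟨A, hA, hAb⟩ := hη' s t (hKT t ht) (δ / 4)
    (fun k hk => hDB <| by
      obtain ⟨a, ha, b, hb, rfl⟩ := exists_of_correlation_ne_zero hk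
      exact ⟨((a, b), (s, t)), ⟨⟨ha, hb⟩, hKT s hs, hKT t ht⟩, rfl⟩)
    (fun k hk => hNV hk s (hKT s hs) t (hKT t ht))
  have hS0 : 0 ≤ ∫ x, v x * √(κ / orbitWeight ι χ v κ x) ∂(Measure.haar : Measure G) :=
    integral_nonneg fun x => mul_nonneg (hv0 x) (Real.sqrt_nonneg _)
  have hA1 : |A - 1| ≤ γ := by
    have h1 := mul_le_mul_of_nonneg_right ((le_abs_self _).trans (hR t (hKT t ht))) hS0
    have h2 : ∫ x, |conjFn (ι t) v x - v x| ∂(Measure.haar : Measure G) < γ / 4 :=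
      hvq (ι t) ⟨t, hKT t ht, rfl⟩
    linarith
  have hA2 : A ≤ 2 := by
    have := (abs_le.1 hA1).2
    linarith [min_le_left 1 (δ / (2 * (M + 1)))]
  have hMγ : M * γ ≤ δ / 2 := by
    calc M * γ ≤ (M + 1) * (δ / (2 * (M + 1))) :=
          mul_le_mul (by linarith) (min_le_right _ _) hγ.le (by linarith)
      _ = δ / 2 := by field_simp
  rw [inner_biTranslate_eq_correlation hf, norm_sub_rev]
  refine hAb.trans ?_
  have h3 : ‖correlation f s t 1‖ * |A - 1| ≤ M * γ :=
    mul_le_mul (hcM s t) hA1 (abs_nonneg _) hM0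
  nlinarith

end Localization

end

theorem mainTheorem1 {G H : Type u}
    [Group G] [TopologicalSpace G] [IsTopologicalGroup G] [LocallyCompactSpace G] [T2Space G]
    [MeasurableSpace G] [BorelSpace G]
    [Group H] [TopologicalSpace H] [IsTopologicalGroup H] [LocallyCompactSpace H] [T2Space H]
    [MeasurableSpace H] [BorelSpace H]
    (ι : H →* G) (hι_cont : Continuous ι) (hι_inj : Function.Injective ι)
    (hQSIN : IsQSIN G) (hF : HasFactorizationProperty G) :
    HasFactorizationProperty H := by
  obtain ⟨C, hC⟩ := hF
  -- The constant in the factorization property is not assumed nonnegative, whereas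
  -- `norm_leftRightRestrict_le` requires it.
  refine ⟨max C 0, fun x => (norm_leftRight_le_leftRightRestrict ι hι_cont
    (fun f η hf K hK δ hδ => hQSIN.exists_coefficient_approx hι_cont hι_inj f hf hK hδ) x).trans
    (norm_leftRightRestrict_le ι hι_cont (le_max_right C 0) (fun y => (hC y).trans ?_) x)⟩
  exact mul_le_mul_of_nonneg_right (le_max_left C 0) (minNorm_nonneg y)
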